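/- **Conventions.** $C^*$-algebras need not be unital; ideals are closed and two-sided; $\overline{\mathbb N}=\{0,1,2,\dots,\infty\}$; $\mathbb K$ is the algebra of compact operators on a separable infinite-dimensional Hilbert space. The minimal unitization $\widetilde A$ of $A$ is $A$ itself if $A$ has a unit $1\neq 0$, and $A+\mathbb C1$ (a unit adjoined) otherwise; in particular $\widetilde{0}=\mathbb C$. A family of sub-$C^*$-algebras $A_i\subset A$ *approximates* $A$ if for every finite $F\subset A$ and every $\varepsilon>0$ there is an $i$ such that every $x\in F$ satisfies $\|x-y\|<\varepsilon$ for some $y\in A_i$. Let $\mathcal C$ be a class of $C^*$-algebras closed under $*$-isomorphisms, ideals, quotients, finite direct sums and minimal unitizations. A *dimension theory* for $\mathcal C$ is an assignment $d\colon\mathcal C\to\overline{\mathbb N}$, invariant under $*$-isomorphism, such that: * (D1) $d(J)\le d(A)$ whenever $J$ is an ideal of $A\in\mathcal C$; * (D2) $d(A/J)\le d(A)$ whenever $J$ is an ideal of $A\in\mathcal C$; * (D3) $d(A\oplus B)=\max\{d(A),d(B)\}$ for $A,B\in\mathcal C$; * (D4) $d(\widetilde A)=d(A)$ for $A\in\mathcal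 C$; * (D5) if $A\in\mathcal C$ is approximated by subalgebras $A_i\in\mathcal C$ with $d(A_i)\le n$, then $d(A)\le n$; * (D6) if $A\in\mathcal C$ and $C\subset A$ is a separable sub-$C^*$-algebra, then there is a separable $C^*$-algebra $D\in\mathcal C$ with $C\subset D\subset A$ and $d(D)\le d(A)$. A dimension theory $d$ on the class of all $C^*$-algebras is *Morita-invariant* if it satisfies the following (equivalent) conditions: (1) $d(A)=d(B)$ whenever $B\subset A$ is a full hereditary sub-$C^*$-algebra; (2) $d(A)=d(B)$ whenever $A$ and $B$ are (strongly) Morita equivalent; (3) $d(A)=d(A\otimes\mathbb K)$ for every $A$. **Proposition.** Let $d\colon\mathcal C\to\overline{\mathbb N}$ be a dimension theory. For every $C^*$-algebra $A$ put $$\widetilde d(A):=\inf\{k\in\mathbb N : A\text{ is approximated by sub-}C^*\text{-algebras }B\in\mathcal C\text{ with }d(B)\le k\},\qquad \inf\emptyset:=\infty.$$ Then $\widetilde d$ is a dimension theory on the class of all $C^*$-algebras, and $\widetilde d(A)=d(A)$ for every $A\in\mathcal C$. If, moreover, $\mathcal C$ is closed under stable isomorphism (that is, $A\in\mathcal C$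 and $A\otimes\mathbb K\cong B\otimes\mathbb K$ imply $B\in\mathcal C$) and $d(A)=d(A\otimes\mathbb K)$ for every separable $A\in\mathcal C$, then $\widetilde d$ is Morita-invariant. -/

import Mathlib

universe u

set_option linter.unusedSectionVars false

noncomputable section

/-! ### Completion of a normed `*`-algebra satisfying the `C*`-identity -/

section Completion

variable (E : Type u) [NonUnitalNormedRing E] [StarRing E] [CStarRing E] [NormedSpace ℂ E]
  [IsScalarTower ℂ E E] [SMulCommClass ℂ E E] [StarModule ℂ E]

/-- The norm completion of a (not necessarily complete) normed `*`-algebra whose norm satisfies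
the `C*`-identity; below it is shown to be a `C*`-algebra. -/
def CStarCompletion : Type u := UniformSpace.Completion E

namespace CStarCompletion

open UniformSpace UniformSpace.Completion

instance : NormedAddCommGroup (CStarCompletion E) :=
  inferInstanceAs (NormedAddCommGroup (Completion E))

instance : NormedSpace ℂ (CStarCompletion E) :=
  inferInstanceAs (NormedSpace ℂ (Completion E))

instance : CompleteSpace (CStarCompletion E) :=
  inferInstanceAs (CompleteSpace (Completion E))

variable {E}

/-- The canonical map into the completion. -/
def of (x : E) : CStarCompletion E := (x : Completion E)

theorem of_add (x y : E) : of (x + y) = of x + of y := Completion.coe_add x y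

theorem of_smul (c : ℂ) (x : E) : of (c • x) = c • of x := Completion.coe_smul c x

theorem of_zero : of (0 : E) = 0 := Completion.coe_zero

theorem norm_of (x : E) : ‖of x‖ = ‖x‖ := Completion.norm_coe x

theorem induction {p : CStarCompletion E → Prop} (hp : IsClosed {a | p a})
    (h : ∀ x : E, p (of x)) (a : CStarCompletion E) : p a :=
  Completion.induction_on a hp h

theorem induction₂ {p : CStarCompletion E → CStarCompletion E → Prop}
    (hp : IsClosed {a : CStarCompletion E × CStarCompletion E | p a.1 a.2})
    (h : ∀ x y : E, p (of x) (of y)) (a b : CStarCompletion E) : p a b :=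
  Completion.induction_on₂ a b hp h

theorem induction₃ {p : CStarCompletion E → CStarCompletion E → CStarCompletion E → Prop}
    (hp : IsClosed {a : CStarCompletion E × CStarCompletion E × CStarCompletion E |
      p a.1 a.2.1 a.2.2})
    (h : ∀ x y z : E, p (of x) (of y) (of z)) (a b c : CStarCompletion E) : p a b c :=
  Completion.induction_on₃ a b c hp h

/-- Multiplication: the continuous extension of the multiplication of `E`. -/
instance : Mul (CStarCompletion E) :=
  ⟨Function.curry <|
    ((isDenseInducing_coe (α := E)).prodMap (isDenseInducing_coe (α := E))).extend
      (fun p : E × E => of (p.1 * p.2))⟩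

theorem of_mul (x y : E) : of (x * y) = of x * of y :=
  ((isDenseInducing_coe.prodMap isDenseInducing_coe).extend_eq
      ((continuous_coe E).comp (@continuous_mul E _ _ _)) (x, y)).symm

instance : ContinuousMul (CStarCompletion E) where
  continuous_mul := by
    let m := (AddMonoidHom.mul : E →+ E →+ E).compr₂ toCompl
    have : Continuous fun p : E × E => m p.1 p.2 := (continuous_coe E).comp continuous_mul
    have di : IsDenseInducing (toCompl : E → Completion E) := isDenseInducing_coe
    exact (di.extend_Z_bilin di this :)

/-- The involution: the continuous extension of the involution of `E`. -/
instance : Star (CStarCompletion E) := ⟨Completion.map (star : E → E)⟩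

theorem of_star (x : E) : of (star x) = star (of x) :=
  (Completion.map_coe (starNormedAddGroupHom (E := E)).uniformContinuous x).symm

theorem continuous_star' : Continuous (star : CStarCompletion E → CStarCompletion E) :=
  Completion.continuous_map

instance : NonUnitalNormedRing (CStarCompletion E) where
  __ := (inferInstance : NormedAddCommGroup (CStarCompletion E))
  zero_mul a := induction (p := fun a => 0 * a = 0)
    (isClosed_eq (by fun_prop) continuous_const)
    (fun x => by rw [← of_zero, ← of_mul, zero_mul]) a
  mul_zero a := induction (p := fun a => a * 0 = 0)
    (isClosed_eq (by fun_prop) continuous_const)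
    (fun x => by rw [← of_zero, ← of_mul, mul_zero]) a
  mul_assoc a b c := induction₃ (p := fun a b c => a * b * c = a * (b * c))
    (isClosed_eq (by fun_prop) (by fun_prop))
    (fun x y z => by simp only [← of_mul, mul_assoc]) a b c
  left_distrib a b c := induction₃ (p := fun a b c => a * (b + c) = a * b + a * c)
    (isClosed_eq (by fun_prop) (by fun_prop))
    (fun x y z => by simp only [← of_mul, ← of_add, mul_add]) a b c
  right_distrib a b c := induction₃ (p := fun a b c => (a + b) * c = a * c + b * c)
    (isClosed_eq (by fun_prop) (by fun_prop))
    (fun x y z => by simp only [← of_mul, ← of_add, add_mul]) a b c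
  norm_mul_le a b := induction₂ (p := fun a b => ‖a * b‖ ≤ ‖a‖ * ‖b‖)
    (isClosed_le (by fun_prop) (by fun_prop))
    (fun x y => by simpa only [← of_mul, norm_of] using norm_mul_le x y) a b

instance : StarRing (CStarCompletion E) where
  star_involutive a := induction (p := fun a => star (star a) = a)
    (isClosed_eq (continuous_star'.comp continuous_star') continuous_id)
    (fun x => by simp only [← of_star, star_star]) a
  star_mul a b := induction₂ (p := fun a b => star (a * b) = star b * star a)
    (isClosed_eq (continuous_star'.comp (by fun_prop))
      ((continuous_star'.comp continuous_snd).mul (continuous_star'.comp continuous_fst)))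
    (fun x y => by simp only [← of_star, ← of_mul, star_mul]) a b
  star_add a b := induction₂ (p := fun a b => star (a + b) = star a + star b)
    (isClosed_eq (continuous_star'.comp (by fun_prop))
      ((continuous_star'.comp continuous_fst).add (continuous_star'.comp continuous_snd)))
    (fun x y => by simp only [← of_star, ← of_add, star_add]) a b

instance : CStarRing (CStarCompletion E) where
  norm_mul_self_le a := induction (p := fun a => ‖a‖ * ‖a‖ ≤ ‖star a * a‖)
    (isClosed_le (by fun_prop) ((continuous_star'.mul continuous_id).norm))
    (fun x => by
      simpa only [← of_star, ← of_mul, norm_of] using (CStarRing.norm_star_mul_self (x := x)).ge) a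

instance : IsScalarTower ℂ (CStarCompletion E) (CStarCompletion E) where
  smul_assoc c a b := induction₂ (p := fun a b => (c • a) * b = c • (a * b))
    (isClosed_eq ((continuous_fst.const_smul c).mul continuous_snd)
      ((continuous_fst.mul continuous_snd).const_smul c))
    (fun x y => by simp only [← of_smul, ← of_mul, smul_mul_assoc]) a b

instance : SMulCommClass ℂ (CStarCompletion E) (CStarCompletion E) where
  smul_comm c a b := induction₂ (p := fun a b => c • (a * b) = a * (c • b))
    (isClosed_eq ((continuous_fst.mul continuous_snd).const_smul c)
      (continuous_fst.mul (continuous_snd.const_smul c)))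
    (fun x y => by simp only [← of_smul, ← of_mul, mul_smul_comm]) a b

instance : StarModule ℂ (CStarCompletion E) where
  star_smul c a := induction (p := fun a => star (c • a) = star c • star a)
    (isClosed_eq (continuous_star'.comp (continuous_const_smul c))
      ((continuous_const_smul (star c)).comp continuous_star'))
    (fun x => by simp only [← of_smul, ← of_star, star_smul]) a

instance : NonUnitalCStarAlgebra (CStarCompletion E) where

end CStarCompletion

end Completion

/-! ### The stabilization `A ⊗ 𝕂` -/

section Stabilization

attribute [local instance] CStarAlgebra.spectralOrder CStarAlgebra.spectralOrderedRing

variable (A : Type u) [NonUnitalCStarAlgebra A]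

/-- The upper left corner extension by zero of a matrix. -/
def cornerFun {m : ℕ} (n : ℕ) (M : CStarMatrix (Fin m) (Fin m) A) :
    CStarMatrix (Fin n) (Fin n) A := fun i j =>
  if h : (i : ℕ) < m ∧ (j : ℕ) < m then M ⟨i, h.1⟩ ⟨j, h.2⟩ else 0

theorem cornerFun_apply {m n : ℕ} (M : CStarMatrix (Fin m) (Fin m) A) (i j : Fin n) :
    cornerFun A n M i j =
      if h : (i : ℕ) < m ∧ (j : ℕ) < m then M ⟨i, h.1⟩ ⟨j, h.2⟩ else 0 := rfl

theorem cornerFun_mul {m n : ℕ} (h : m ≤ n) (M N : CStarMatrix (Fin m) (Fin m) A) :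
    cornerFun A n (M * N) = cornerFun A n M * cornerFun A n N := by
  obtain ⟨k, rfl⟩ := Nat.exists_eq_add_of_le h
  ext i j
  simp only [CStarMatrix.mul_apply, cornerFun_apply, Fin.sum_univ_add]
  by_cases hi : (i : ℕ) < m <;> by_cases hj : (j : ℕ) < m <;> simp [hi, hj]

/-- The inclusion `M_m(A) → M_n(A)`, `m ≤ n`, as the upper left corner. -/
def cornerEmbedding (m n : ℕ) (h : m ≤ n) :
    CStarMatrix (Fin m) (Fin m) A →⋆ₙₐ[ℂ] CStarMatrix (Fin n) (Fin n) A where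
  toFun := cornerFun A n
  map_smul' c M := by
    ext i j
    by_cases h : (i : ℕ) < m ∧ (j : ℕ) < m <;> simp [h, cornerFun_apply]
  map_zero' := by
    ext i j
    by_cases h : (i : ℕ) < m ∧ (j : ℕ) < m <;> simp [cornerFun_apply]
  map_add' M N := by
    ext i j
    by_cases h : (i : ℕ) < m ∧ (j : ℕ) < m <;> simp [h, cornerFun_apply]
  map_mul' := cornerFun_mul A h
  map_star' M := by
    ext i j
    by_cases hi : (i : ℕ) < m <;> by_cases hj : (j : ℕ) < m <;>
      simp [hi, hj, CStarMatrix.star_eq_conjTranspose, cornerFun_apply]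

theorem cornerEmbedding_apply {m n : ℕ} (h : m ≤ n) (M : CStarMatrix (Fin m) (Fin m) A)
    (i j : Fin n) : cornerEmbedding A m n h M i j =
      if h : (i : ℕ) < m ∧ (j : ℕ) < m then M ⟨i, h.1⟩ ⟨j, h.2⟩ else 0 := rfl

theorem cornerEmbedding_injective (m n : ℕ) (h : m ≤ n) :
    Function.Injective (cornerEmbedding A m n h) := by
  intro M N hMN
  ext i j
  have := congrFun (congrFun hMN (Fin.castLE h i)) (Fin.castLE h j)
  simpa [cornerEmbedding_apply] using this

instance : DirectedSystem (fun n : ℕ => CStarMatrix (Fin n) (Fin n) A)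
    (fun m n h => cornerEmbedding A m n h) where
  map_self m M := by
    ext i j
    simp [cornerEmbedding_apply]
  map_map m n k hij hjk M := by
    ext i j
    simp only [cornerEmbedding_apply]
    split_ifs <;> first | rfl | omega

/-- `M_∞(A) = ⋃ₙ M_n(A)`, the algebraic direct limit of `M_1(A) ⊆ M_2(A) ⊆ ⋯` under the corner
inclusions; as a `*`-algebra this is `A ⊙ M_∞(ℂ)`. -/
def MatrixLimit : Type u :=
  DirectLimit (fun n : ℕ => CStarMatrix (Fin n) (Fin n) A) (cornerEmbedding A)

namespace MatrixLimit

instance : NonUnitalRing (MatrixLimit A) :=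
  inferInstanceAs (NonUnitalRing (DirectLimit _ (cornerEmbedding A)))

instance : SMul ℂ (MatrixLimit A) :=
  inferInstanceAs (SMul ℂ (DirectLimit _ (cornerEmbedding A)))

instance : StarMul (MatrixLimit A) :=
  inferInstanceAs (StarMul (DirectLimit _ (cornerEmbedding A)))

instance : StarAddMonoid (MatrixLimit A) :=
  inferInstanceAs (StarAddMonoid (DirectLimit _ (cornerEmbedding A)))

variable {A}

/-- The canonical inclusion of `M_n(A)`. -/
def mk (n : ℕ) (M : CStarMatrix (Fin n) (Fin n) A) : MatrixLimit A :=
  (⟦⟨n, M⟩⟧ : DirectLimit (fun n : ℕ => CStarMatrix (Fin n) (Fin n) A) (cornerEmbedding A))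

@[elab_as_elim]
theorem induction {p : MatrixLimit A → Prop} (h : ∀ n M, p (mk n M)) (x : MatrixLimit A) : p x :=
  DirectLimit.induction (cornerEmbedding A) h x

@[elab_as_elim]
theorem induction₂ {p : MatrixLimit A → MatrixLimit A → Prop}
    (h : ∀ n M N, p (mk n M) (mk n N)) (x y : MatrixLimit A) : p x y :=
  DirectLimit.induction₂ (cornerEmbedding A) h x y

theorem mk_add (n : ℕ) (M N : CStarMatrix (Fin n) (Fin n) A) :
    mk n M + mk n N = mk n (M + N) := DirectLimit.add_def
    (G := fun n : ℕ => CStarMatrix (Fin n) (Fin n) A) (f := cornerEmbedding A) n M N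

theorem mk_mul (n : ℕ) (M N : CStarMatrix (Fin n) (Fin n) A) :
    mk n M * mk n N = mk n (M * N) := DirectLimit.mul_def
    (G := fun n : ℕ => CStarMatrix (Fin n) (Fin n) A) (f := cornerEmbedding A) n M N

theorem mk_smul (n : ℕ) (c : ℂ) (M : CStarMatrix (Fin n) (Fin n) A) :
    c • mk n M = mk n (c • M) := DirectLimit.smul_def
    (G := fun n : ℕ => CStarMatrix (Fin n) (Fin n) A) (f := cornerEmbedding A) n M c

theorem mk_star (n : ℕ) (M : CStarMatrix (Fin n) (Fin n) A) :
    star (mk n M) = mk n (star M) := DirectLimit.star_def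
    (G := fun n : ℕ => CStarMatrix (Fin n) (Fin n) A) (f := cornerEmbedding A) n M

theorem mk_zero (n : ℕ) : mk n (0 : CStarMatrix (Fin n) (Fin n) A) = 0 :=
  (DirectLimit.zero_def (f := cornerEmbedding A) n).symm

theorem mk_injective (n : ℕ) :
    Function.Injective (mk n : CStarMatrix (Fin n) (Fin n) A → MatrixLimit A) :=
  DirectLimit.mk_injective _ (cornerEmbedding_injective A) n

variable (A)

instance : Module ℂ (MatrixLimit A) where
  one_smul := induction fun i _ => by
    simp_rw [mk_smul, one_smul]
  mul_smul _ _ := induction fun i _ => by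
    simp_rw [mk_smul, mul_smul]
  smul_zero _ := by rw [← mk_zero 0, mk_smul, smul_zero]
  smul_add _ := induction₂ fun i _ _ => by
    simp_rw [mk_add, mk_smul, smul_add, mk_add]
  add_smul _ _ := induction fun i _ => by
    simp_rw [mk_smul, add_smul, mk_add]
  zero_smul := induction fun i _ => by
    simp_rw [mk_smul, zero_smul, ← mk_zero i]

/-- The `C*`-norm of `M_∞(A)`, extending the `C*`-norm of every `M_n(A)`. -/
instance : Norm (MatrixLimit A) where
  norm := DirectLimit.lift (cornerEmbedding A) (fun _ M => ‖M‖) fun i j h M =>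
    (NonUnitalStarAlgHom.norm_map _ (cornerEmbedding_injective A i j h) M).symm

theorem norm_mk (n : ℕ) (M : CStarMatrix (Fin n) (Fin n) A) :
    ‖mk n M‖ = ‖M‖ := rfl

instance : NonUnitalNormedRing (MatrixLimit A) where
  __ := (NormedAddCommGroup.ofCore (𝕜 := ℂ) (E := MatrixLimit A)
    { norm_nonneg := induction fun i x => norm_nonneg x
      norm_smul := fun c => induction fun i x => by
        rw [mk_smul, norm_mk, norm_mk, norm_smul]
      norm_triangle := induction₂ fun i x y => by
        rw [mk_add, norm_mk, norm_mk, norm_mk]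
        exact norm_add_le x y
      norm_eq_zero_iff := induction fun i x => by
        rw [norm_mk, norm_eq_zero, ← mk_zero i]
        exact ⟨fun h => by rw [h], fun h =>
          mk_injective i h⟩ })
  __ := (inferInstance : NonUnitalRing (MatrixLimit A))
  norm_mul_le := induction₂ fun i x y => by
    rw [mk_mul, norm_mk, norm_mk, norm_mk]
    exact norm_mul_le x y

instance : NormedSpace ℂ (MatrixLimit A) where
  norm_smul_le c := induction fun i x => by
    rw [mk_smul, norm_mk, norm_mk, norm_smul]

instance : StarRing (MatrixLimit A) where
  star_add := star_add

instance : CStarRing (MatrixLimit A) where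
  norm_mul_self_le := induction fun i x => by
    rw [mk_star, mk_mul, norm_mk, norm_mk]
    exact (CStarRing.norm_star_mul_self (x := x)).ge

instance : IsScalarTower ℂ (MatrixLimit A) (MatrixLimit A) where
  smul_assoc c := induction₂ fun i x y => by
    simp_rw [smul_eq_mul, mk_smul, mk_mul, mk_smul,
      smul_mul_assoc]

instance : SMulCommClass ℂ (MatrixLimit A) (MatrixLimit A) where
  smul_comm c := induction₂ fun i x y => by
    simp_rw [smul_eq_mul, mk_smul, mk_mul, mk_smul,
      mul_smul_comm]

instance : StarModule ℂ (MatrixLimit A) where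
  star_smul c := induction fun i x => by
    simp_rw [mk_star, mk_smul, mk_star, star_smul]

end MatrixLimit

end Stabilization

/-! ### `C*`-algebras, subalgebras, ideals -/

/-- A (not necessarily unital) `C*`-algebra. -/
structure CStarAlg : Type (u + 1) where
  /-- The underlying type. -/
  carrier : Type u
  [inst : NonUnitalCStarAlgebra carrier]

namespace CStarAlg

instance : CoeSort CStarAlg.{u} (Type u) := ⟨carrier⟩

instance (A : CStarAlg.{u}) : NonUnitalCStarAlgebra A := A.inst

/-- `*`-isomorphism. -/
def Iso (A B : CStarAlg.{u}) : Prop := Nonempty (A ≃⋆ₐ[ℂ] B)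

/-- `B` is (`*`-isomorphic to) a quotient `A / J` by a closed two-sided ideal `J`, that is, there
is a surjective `*`-homomorphism `A → B` (with kernel `J`). -/
def IsQuotient (A B : CStarAlg.{u}) : Prop := ∃ f : A →⋆ₙₐ[ℂ] B, Function.Surjective f

/-- The direct sum `A ⊕ B` (the product with the maximum norm). -/
def directSum (A B : CStarAlg.{u}) : CStarAlg.{u} := ⟨A × B⟩

/-- `A` has a nonzero unit. -/
def IsUnital (A : CStarAlg.{u}) : Prop := ∃ e : A, e ≠ 0 ∧ ∀ a : A, e * a = a ∧ a * e = a

open Classical in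
/-- The minimal unitization: `A` itself if `A` has a unit `1 ≠ 0`, and `A + ℂ1` otherwise. In
particular the minimal unitization of the zero algebra is `ℂ`. -/
def minimalUnitization (A : CStarAlg.{u}) : CStarAlg.{u} :=
  if A.IsUnital then A else ⟨Unitization ℂ A⟩

/-- The stabilization `A ⊗ 𝕂`, where `𝕂` is the algebra of compact operators on a separable
infinite-dimensional Hilbert space: since `M_∞(ℂ)` is dense in `𝕂`, it is the completion of
`A ⊙ M_∞(ℂ) = ⋃ₙ M_n(A)` in the unique `C*`-norm. -/
def stabilization (A : CStarAlg.{u}) : CStarAlg.{u} := ⟨CStarCompletion (MatrixLimit A)⟩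

/-- Stable isomorphism: `A ⊗ 𝕂 ≅ B ⊗ 𝕂`. -/
def StablyIso (A B : CStarAlg.{u}) : Prop := A.stabilization.Iso B.stabilization

/-- Separability (as a topological space). -/
def IsSeparable (A : CStarAlg.{u}) : Prop := TopologicalSpace.SeparableSpace A

/-- `a` is a positive element, `a = c* c`. -/
def IsPos {A : CStarAlg.{u}} (a : A) : Prop := ∃ c : A, a = star c * c

/-- A sub-`C*`-algebra: a norm closed `*`-subalgebra. -/
structure Sub (A : CStarAlg.{u}) where
  /-- The underlying `*`-subalgebra. -/
  toSubalgebra : NonUnitalStarSubalgebra ℂ A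
  isClosed : IsClosed (toSubalgebra : Set A)

namespace Sub

variable {A : CStarAlg.{u}}

/-- The underlying set of a sub-`C*`-algebra. -/
def toSet (B : A.Sub) : Set A := B.toSubalgebra

/-- A sub-`C*`-algebra, seen as a `C*`-algebra. -/
def toCStarAlg (B : A.Sub) : CStarAlg.{u} :=
  letI : IsClosed (B.toSubalgebra : Set A) := B.isClosed
  ⟨B.toSubalgebra⟩

/-- `J` is a closed two-sided ideal (in a `C*`-algebra, these are closed under `*`). -/
def IsIdeal (J : A.Sub) : Prop := ∀ a : A, ∀ x ∈ J.toSet, a * x ∈ J.toSet ∧ x * a ∈ J.toSet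

/-- `B` is hereditary: `0 ≤ a ≤ b` and `b ∈ B` imply `a ∈ B`. -/
def IsHereditary (B : A.Sub) : Prop :=
  ∀ a : A, ∀ b ∈ B.toSet, IsPos a → IsPos (b - a) → a ∈ B.toSet

/-- `B` is full: the linear span of `A B A` is dense in `A`. -/
def IsFull (B : A.Sub) : Prop :=
  Dense (Submodule.span ℂ {x : A | ∃ a c : A, ∃ b ∈ B.toSet, x = a * b * c} : Set A)

end Sub

/-- The family `S` of sub-`C*`-algebras approximates `A`: for every finite `F ⊆ A` and every
`ε > 0` there is `B ∈ S` such that every element of `F` has distance `< ε` to some element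
of `B`. -/
def Approximates (A : CStarAlg.{u}) (S : Set A.Sub) : Prop :=
  ∀ F : Finset A, ∀ ε : ℝ, 0 < ε → ∃ B ∈ S, ∀ x ∈ F, ∃ y ∈ B.toSet, ‖x - y‖ < ε

/-! ### Morita equivalence -/

/-- `X` is an `A`-`B`-imprimitivity bimodule: a full left Hilbert `A`-module and a full right
Hilbert `B`-module such that the actions are compatible with the inner products and
`⟨x, y⟩_A z = x ⟨y, z⟩_B`. -/
structure ImprimitivityBimodule (A B : CStarAlg.{u}) (X : Type u) [AddCommGroup X]
    [Module ℂ X] where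
  /-- The left action `a x`. -/
  lsmul : A →ₗ[ℂ] X →ₗ[ℂ] X
  /-- The right action `x b`. -/
  rsmul : X →ₗ[ℂ] B →ₗ[ℂ] X
  /-- The `A`-valued inner product, linear in the first variable. -/
  linner : X → X → A
  /-- The `B`-valued inner product, linear in the second variable. -/
  rinner : X → X → B
  mul_lsmul : ∀ a a' x, lsmul (a * a') x = lsmul a (lsmul a' x)
  rsmul_mul : ∀ x b b', rsmul x (b * b') = rsmul (rsmul x b) b'
  lsmul_rsmul : ∀ a x b, rsmul (lsmul a x) b = lsmul a (rsmul x b)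
  linner_add : ∀ x x' y, linner (x + x') y = linner x y + linner x' y
  linner_smul : ∀ (c : ℂ) x y, linner (c • x) y = c • linner x y
  linner_lsmul : ∀ a x y, linner (lsmul a x) y = a * linner x y
  star_linner : ∀ x y, star (linner x y) = linner y x
  linner_pos : ∀ x, IsPos (linner x x)
  linner_definite : ∀ x, linner x x = 0 → x = 0
  rinner_add : ∀ x y y', rinner x (y + y') = rinner x y + rinner x y'
  rinner_smul : ∀ (c : ℂ) x y, rinner x (c • y) = c • rinner x y
  rinner_rsmul : ∀ x y b, rinner x (rsmul y b) = rinner x y * b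
  star_rinner : ∀ x y, star (rinner x y) = rinner y x
  rinner_pos : ∀ x, IsPos (rinner x x)
  rinner_definite : ∀ x, rinner x x = 0 → x = 0
  rinner_lsmul : ∀ a x y, rinner (lsmul a x) y = rinner x (lsmul (star a) y)
  linner_rsmul : ∀ x b y, linner (rsmul x b) y = linner x (rsmul y (star b))
  compat : ∀ x y z, lsmul (linner x y) z = rsmul x (rinner y z)
  linner_full : Dense (Submodule.span ℂ {a : A | ∃ x y, a = linner x y} : Set A)
  rinner_full : Dense (Submodule.span ℂ {b : B | ∃ x y, b = rinner x y} : Set B)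
  /-- Completeness for the norm `‖⟨x, x⟩_A‖ ^ (1/2)`. -/
  linner_complete : ∀ s : ℕ → X,
    (∀ ε : ℝ, 0 < ε → ∃ N, ∀ m ≥ N, ∀ n ≥ N, ‖linner (s m - s n) (s m - s n)‖ < ε) →
      ∃ x, ∀ ε : ℝ, 0 < ε → ∃ N, ∀ n ≥ N, ‖linner (s n - x) (s n - x)‖ < ε
  /-- Completeness for the norm `‖⟨x, x⟩_B‖ ^ (1/2)`. -/
  rinner_complete : ∀ s : ℕ → X,
    (∀ ε : ℝ, 0 < ε → ∃ N, ∀ m ≥ N, ∀ n ≥ N, ‖rinner (s m - s n) (s m - s n)‖ < ε) →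
      ∃ x, ∀ ε : ℝ, 0 < ε → ∃ N, ∀ n ≥ N, ‖rinner (s n - x) (s n - x)‖ < ε

/-- (Strong) Morita equivalence: existence of an imprimitivity bimodule. -/
def MoritaEquivalent (A B : CStarAlg.{u}) : Prop :=
  ∃ (X : Type u) (_ : AddCommGroup X) (_ : Module ℂ X), Nonempty (ImprimitivityBimodule A B X)

end CStarAlg

/-! ### Dimension theories -/

/-- `d` is a dimension theory for the class `C` of `C*`-algebras. Only the values of `d` on `C`
matter. -/
structure IsDimensionTheory (C : Set CStarAlg.{u}) (d : CStarAlg.{u} → ℕ∞) : Prop where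
  iso_mem : ∀ A ∈ C, ∀ B : CStarAlg.{u}, A.Iso B → B ∈ C
  ideal_mem : ∀ A ∈ C, ∀ J : A.Sub, J.IsIdeal → J.toCStarAlg ∈ C
  quotient_mem : ∀ A ∈ C, ∀ B : CStarAlg.{u}, A.IsQuotient B → B ∈ C
  directSum_mem : ∀ A ∈ C, ∀ B ∈ C, A.directSum B ∈ C
  minimalUnitization_mem : ∀ A ∈ C, A.minimalUnitization ∈ C
  iso : ∀ A ∈ C, ∀ B ∈ C, A.Iso B → d A = d B
  /-- (D1) -/
  ideal : ∀ A ∈ C, ∀ J : A.Sub, J.IsIdeal → d J.toCStarAlg ≤ d A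
  /-- (D2) -/
  quotient : ∀ A ∈ C, ∀ B : CStarAlg.{u}, A.IsQuotient B → d B ≤ d A
  /-- (D3) -/
  directSum : ∀ A ∈ C, ∀ B ∈ C, d (A.directSum B) = max (d A) (d B)
  /-- (D4) -/
  minimalUnitization : ∀ A ∈ C, d A.minimalUnitization = d A
  /-- (D5) -/
  approx : ∀ A ∈ C, ∀ n : ℕ, ∀ S : Set A.Sub,
    (∀ B ∈ S, B.toCStarAlg ∈ C ∧ d B.toCStarAlg ≤ n) → A.Approximates S → d A ≤ n
  /-- (D6) -/
  separable : ∀ A ∈ C, ∀ B : A.Sub, B.toCStarAlg.IsSeparable →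
    ∃ D : A.Sub, D.toCStarAlg ∈ C ∧ D.toCStarAlg.IsSeparable ∧ B.toSet ⊆ D.toSet ∧
      d D.toCStarAlg ≤ d A

/-- `d̃(A)`, the infimum of all `k ∈ ℕ` such that `A` is approximated by sub-`C*`-algebras
`B ∈ C` with `d(B) ≤ k` (and `∞` if there is no such `k`). -/
def approxExtension (C : Set CStarAlg.{u}) (d : CStarAlg.{u} → ℕ∞) (A : CStarAlg.{u}) : ℕ∞ :=
  ⨅ (k : ℕ) (_ : A.Approximates {B : A.Sub | B.toCStarAlg ∈ C ∧ d B.toCStarAlg ≤ k}), (k : ℕ∞)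

/-- `C` is closed under stable isomorphism. -/
def ClosedUnderStableIso (C : Set CStarAlg.{u}) : Prop :=
  ∀ A ∈ C, ∀ B : CStarAlg.{u}, A.StablyIso B → B ∈ C

/-- Morita-invariance of an assignment on all `C*`-algebras. For a dimension theory on the class
of all `C*`-algebras the three conditions are equivalent. -/
structure MoritaInvariant (d : CStarAlg.{u} → ℕ∞) : Prop where
  full_hereditary : ∀ (A : CStarAlg.{u}) (B : A.Sub), B.IsHereditary → B.IsFull →
    d A = d B.toCStarAlg
  morita : ∀ A B : CStarAlg.{u}, A.MoritaEquivalent B → d A = d B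
  stable : ∀ A : CStarAlg.{u}, d A = d A.stabilization

end

noncomputable section

/-! ### Ranges of `*`-homomorphisms -/

section ClosedRange

variable {A B : Type*} [NonUnitalCStarAlgebra A] [NonUnitalCStarAlgebra B]

/-! The argument is phrased through `ApproxBy P A`: every finite subset of `A` lies, up to `ε`, in
the image of an injective `*`-homomorphism from an algebra with `P`. The infimum defining
`approxExtension` runs over natural numbers and its condition is monotone in `k`, so
`approxExtension C d A ≤ k` means exactly `ApproxBy (HasDimLE C d k) A`. Each axiom for the
extension then becomes a permanence property of `ApproxBy`. (D5) is transitivity, and agreement with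
`d` on `C` is (D5) for `d` in one direction and self-approximation in the other. The delicate axiom
is (D1), since an approximating algebra `D` of `A` might miss an ideal `J`. The remedy is the
cut-down lemma `exists_cutDown`: if `g ≥ 0` is within `ε` of `h²`, then `c = (g - 2ε)₊` satisfies `ε
c² ≤ c h² c`, so `c` lies in the closed right ideal of `c h`. With `g ∈ D` and `h ∈ J` this puts `c`
into `D ∩ J` exactly, and the elements `c y c` of this ideal of `D` approximate `J`. For (D6), the
approximants are first made separable by (D6) for `d`; then a countable set is closed off under
passing from its finite subsets to dense parts of their approximants. Morita invariance rests on a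
version of Brown's theorem (`stablyIso_her`): separable hereditary subalgebras generating the same
ideal are stably isomorphic. A single matrix `T` over `A` is built whose closed right ideal has `p`
in the even rows and `q` in the odd rows, while that of `T*` has `q` in every row. Polar
decomposition identifies `closure (T 𝔸 T*)` with `closure (T* 𝔸 T)`, where `𝔸 = A ⊗ 𝕂`; the latter
is the stabilization of `closure (q A q)`. Exchanging `p` and `q` gives the same hereditary
subalgebra. Consequently the separable members of `C` with `d ≤ k` are closed under stabilization
and hereditary subalgebras. It remains to transfer this closure property to `ApproxBy`.
`ApproxBy.hereditary` passes to hereditary `B ⊆ A`: the cut-down elements need not lie in `B`, but a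
polar decomposition close to trivial moves them there. `ApproxBy.of_full` and
`ApproxBy.of_moritaEquivalent` go the other way: fullness provides an almost unit `u` which is a
finite sum of products (or inner products), and the elements `u a u*` lie in a subalgebra isomorphic
to a hereditary subalgebra of `B ⊗ 𝕂` (or of a matrix algebra over `B`). -/

theorem NonUnitalStarAlgHom.continuous (f : A →⋆ₙₐ[ℂ] B) : Continuous f :=
  AddMonoidHomClass.continuous_of_bound f 1 fun x => by
    simpa using NonUnitalStarAlgHom.norm_apply_le f x

theorem NonUnitalStarAlgHom.exists_preimage_norm_le_of_isSelfAdjoint (f : A →⋆ₙₐ[ℂ] B) (x : A)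
    (hx : IsSelfAdjoint (f x)) : ∃ x' : A, f x' = f x ∧ ‖x'‖ ≤ ‖f x‖ := by
  -- Truncation at `±‖f x‖` is the identity on the spectrum of `f x`, so applying it to the real
  -- part of `x` shrinks the norm without changing the image.
  let h : ℝ → ℝ := fun t => max (min t ‖f x‖) (-‖f x‖)
  have hcont : Continuous h := by fun_prop
  have h0 : h 0 = 0 := by simp [h]
  let z : A := (realPart x : A)
  have hz : IsSelfAdjoint z := (realPart x).2
  have hfz : f z = f x := by rw [map_realPart f x, hx.coe_realPart]
  refine ⟨cfcₙ h z, ?_, ?_⟩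
  · have h1 : f (cfcₙ h z) = cfcₙ h (f z) :=
      NonUnitalStarAlgHomClass.map_cfcₙ (S := ℂ) f h z hcont.continuousOn h0
        (f.continuous) hz (hz.map f)
    rw [h1, hfz]
    conv_rhs => rw [← cfcₙ_id ℝ (f x)]
    refine cfcₙ_congr fun t ht => ?_
    have : ‖t‖ ≤ ‖f x‖ := by
      have := norm_apply_le_norm_cfcₙ (fun t : ℝ => t) (f x) ht
      rwa [cfcₙ_id' ℝ (f x)] at this
    rw [Real.norm_eq_abs, abs_le] at this
    simp [h, this.1, this.2]
  · refine norm_cfcₙ_le fun t _ => ?_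
    rw [Real.norm_eq_abs, abs_le]
    refine ⟨le_max_right _ _, max_le (min_le_right _ _) ?_⟩
    linarith [norm_nonneg (f x)]

theorem NonUnitalStarAlgHom.exists_preimage_norm_le (f : A →⋆ₙₐ[ℂ] B) (x : A) :
    ∃ x' : A, f x' = f x ∧ ‖x'‖ ≤ 2 * ‖f x‖ := by
  have hre : f (realPart x : A) = (realPart (f x) : B) := map_realPart f x
  have him : f (imaginaryPart x : A) = (imaginaryPart (f x) : B) := map_imaginaryPart f x
  obtain ⟨u, hu, hu'⟩ := f.exists_preimage_norm_le_of_isSelfAdjoint (realPart x : A)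
    ((realPart x).2.map f)
  obtain ⟨v, hv, hv'⟩ := f.exists_preimage_norm_le_of_isSelfAdjoint (imaginaryPart x : A)
    ((imaginaryPart x).2.map f)
  refine ⟨u + Complex.I • v, ?_, ?_⟩
  · rw [map_add, map_smul, hu, hv, hre, him, realPart_add_I_smul_imaginaryPart]
  · have h1 : ‖u‖ ≤ ‖f x‖ := hu'.trans (by rw [hre]; exact realPart.norm_le (f x))
    have h2 : ‖v‖ ≤ ‖f x‖ := hv'.trans (by rw [him]; exact imaginaryPart.norm_le (f x))
    refine (norm_add_le _ _).trans ?_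
    rw [norm_smul, Complex.norm_I, one_mul]
    linarith

/-- Preimages with norm at most twice that of the image make the usual summation argument of the
open mapping theorem work on the closure of the range. -/
theorem NonUnitalStarAlgHom.isClosed_range (f : A →⋆ₙₐ[ℂ] B) :
    IsClosed (NonUnitalStarAlgHom.range f : Set B) := by
  let g : NormedAddGroupHom A B :=
    { toFun := f
      map_add' := map_add f
      bound' := ⟨1, fun x => by simpa using NonUnitalStarAlgHom.norm_apply_le f x⟩ }
  have hg : g.SurjectiveOnWith g.range 2 := by
    rintro _ ⟨x, rfl⟩
    exact f.exists_preimage_norm_le x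
  have h := controlled_closure_of_complete (by norm_num) one_pos hg
  refine isClosed_of_closure_subset fun y hy => ?_
  have hy' : y ∈ g.range.topologicalClosure := by
    change y ∈ closure (g.range : Set B)
    convert hy using 2
    ext z
    rfl
  obtain ⟨x, hx, -⟩ := h y hy'
  exact ⟨x, hx⟩

end ClosedRange

namespace CStarAlg

/-! ### Sub-`C*`-algebras and `*`-homomorphisms -/

namespace Sub

variable {A B : CStarAlg.{u}}

/-- The inclusion of a sub-`C*`-algebra. -/
def incl (S : A.Sub) : S.toCStarAlg →⋆ₙₐ[ℂ] A :=
  NonUnitalStarSubalgebraClass.subtype S.toSubalgebra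

theorem incl_injective (S : A.Sub) : Function.Injective S.incl := Subtype.val_injective

theorem incl_mem (S : A.Sub) (x : S.toCStarAlg) : S.incl x ∈ S.toSet := x.2

theorem exists_incl_eq (S : A.Sub) {x : A} (hx : x ∈ S.toSet) : ∃ y, S.incl y = x := ⟨⟨x, hx⟩, rfl⟩

theorem norm_incl (S : A.Sub) (x : S.toCStarAlg) : ‖S.incl x‖ = ‖x‖ := rfl

/-- The image of a `*`-homomorphism. -/
def range (f : B →⋆ₙₐ[ℂ] A) : A.Sub := ⟨NonUnitalStarAlgHom.range f, f.isClosed_range⟩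

theorem mem_range {f : B →⋆ₙₐ[ℂ] A} {y : A} : y ∈ (range f).toSet ↔ ∃ x, f x = y := Iff.rfl

/-- A `*`-homomorphism, corestricted to a sub-`C*`-algebra that contains its image. -/
def codRestrict (S : A.Sub) (f : B →⋆ₙₐ[ℂ] A) (h : ∀ x, f x ∈ S.toSet) :
    B →⋆ₙₐ[ℂ] S.toCStarAlg :=
  NonUnitalStarAlgHom.codRestrict f S.toSubalgebra h

theorem isQuotient_range (f : B →⋆ₙₐ[ℂ] A) : B.IsQuotient (range f).toCStarAlg := by
  refine ⟨(range f).codRestrict f fun x => ⟨x, rfl⟩, fun y => ?_⟩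
  obtain ⟨x, hx⟩ := y.2
  exact ⟨x, Subtype.ext hx⟩

theorem iso_of_injective_of_range (S : A.Sub) (f : B →⋆ₙₐ[ℂ] A) (hf : Function.Injective f)
    (h : ∀ y, y ∈ S.toSet ↔ ∃ x, f x = y) : B.Iso S.toCStarAlg := by
  refine ⟨StarAlgEquiv.ofBijective (S.codRestrict f fun x => (h _).2 ⟨x, rfl⟩) ⟨?_, ?_⟩⟩
  · intro x y hxy
    exact hf (congrArg S.incl hxy)
  · intro y
    obtain ⟨x, hx⟩ := (h _).1 y.2
    exact ⟨x, Subtype.ext hx⟩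

theorem iso_range (f : B →⋆ₙₐ[ℂ] A) (hf : Function.Injective f) : B.Iso (range f).toCStarAlg :=
  iso_of_injective_of_range _ f hf fun _ => mem_range

/-- The preimage of a sub-`C*`-algebra. -/
def comap (S : A.Sub) (f : B →⋆ₙₐ[ℂ] A) : B.Sub :=
  ⟨NonUnitalStarSubalgebra.comap f S.toSubalgebra,
    S.isClosed.preimage (f.continuous)⟩

theorem mem_comap {S : A.Sub} {f : B →⋆ₙₐ[ℂ] A} {x : B} :
    x ∈ (S.comap f).toSet ↔ f x ∈ S.toSet := Iff.rfl

end Sub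

theorem Iso.symm {A B : CStarAlg.{u}} : A.Iso B → B.Iso A := fun ⟨e⟩ => ⟨e.symm⟩

theorem Iso.trans {A B D : CStarAlg.{u}} : A.Iso B → B.Iso D → A.Iso D :=
  fun ⟨e⟩ ⟨f⟩ => ⟨e.trans f⟩

theorem isSeparable_of_injective {A B : CStarAlg.{u}} (hA : A.IsSeparable)
    (f : B →⋆ₙₐ[ℂ] A) (hf : Function.Injective f) : B.IsSeparable := by
  have : TopologicalSpace.SeparableSpace A := hA
  have : SecondCountableTopology A := UniformSpace.secondCountable_of_separable A
  have : SecondCountableTopology B :=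
    (NonUnitalStarAlgHom.isometry f hf).isEmbedding.isInducing.secondCountableTopology
  exact inferInstanceAs (TopologicalSpace.SeparableSpace B)

/-! ### Approximation by algebras with a given property -/

/-- Every finite subset of `A` is, up to `ε`, contained in a subalgebra isomorphic to an algebra
with the property `P`. -/
def ApproxBy (P : CStarAlg.{u} → Prop) (A : CStarAlg.{u}) : Prop :=
  ∀ F : Finset A, ∀ ε : ℝ, 0 < ε → ∃ (D : CStarAlg.{u}) (f : D →⋆ₙₐ[ℂ] A),
    Function.Injective f ∧ P D ∧ ∀ x ∈ F, ∃ y, ‖x - f y‖ < ε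

theorem Approximates.approxBy {A : CStarAlg.{u}} {P : CStarAlg.{u} → Prop} {S : Set A.Sub}
    (h : A.Approximates S) (hS : ∀ B ∈ S, P B.toCStarAlg) : ApproxBy P A := by
  intro F ε hε
  obtain ⟨B, hB, hF⟩ := h F ε hε
  exact ⟨B.toCStarAlg, B.incl, B.incl_injective, hS B hB, fun x hx =>
    let ⟨y, hy, hxy⟩ := hF x hx
    ⟨⟨y, hy⟩, hxy⟩⟩

theorem ApproxBy.approximates {A : CStarAlg.{u}} {P : CStarAlg.{u} → Prop}
    (hP : ∀ D E : CStarAlg.{u}, D.Iso E → P D → P E) (h : ApproxBy P A) :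
    A.Approximates {B : A.Sub | P B.toCStarAlg} := by
  intro F ε hε
  obtain ⟨D, f, hf, hD, hF⟩ := h F ε hε
  exact ⟨Sub.range f, hP _ _ (Sub.iso_range f hf) hD, fun x hx =>
    let ⟨y, hxy⟩ := hF x hx
    ⟨f y, ⟨y, rfl⟩, hxy⟩⟩

theorem ApproxBy.of_self {A : CStarAlg.{u}} {P : CStarAlg.{u} → Prop} (h : P A) : ApproxBy P A :=
  fun _ _ hε => ⟨A, NonUnitalStarAlgHom.id ℂ A, Function.injective_id, h,
    fun x _ => ⟨x, by simpa using hε⟩⟩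

theorem ApproxBy.mono {A : CStarAlg.{u}} {P Q : CStarAlg.{u} → Prop} (hPQ : ∀ D, P D → Q D)
    (h : ApproxBy P A) : ApproxBy Q A := fun F ε hε =>
  let ⟨D, f, hf, hD, hF⟩ := h F ε hε
  ⟨D, f, hf, hPQ D hD, hF⟩

/-- Spend `ε / 2` on each approximation; the second error is carried over unchanged because
injective `*`-homomorphisms are isometric. -/
theorem ApproxBy.trans {A : CStarAlg.{u}} {P : CStarAlg.{u} → Prop}
    (h : ApproxBy (ApproxBy P) A) : ApproxBy P A := by
  classical
  intro F ε hε
  obtain ⟨D, f, hf, hD, hF⟩ := h F (ε / 2) (half_pos hε)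
  choose! y hy using hF
  obtain ⟨E, g, hg, hE, hG⟩ := hD (F.image y) (ε / 2) (half_pos hε)
  refine ⟨E, f.comp g, hf.comp hg, hE, fun x hx => ?_⟩
  obtain ⟨z, hz⟩ := hG (y x) (Finset.mem_image_of_mem y hx)
  refine ⟨z, ?_⟩
  have h1 : ‖f (y x) - f (g z)‖ < ε / 2 := by
    rw [← map_sub, NonUnitalStarAlgHom.norm_map f hf]; exact hz
  calc ‖x - f (g z)‖ = ‖(x - f (y x)) + (f (y x) - f (g z))‖ := by abel_nf
    _ ≤ ‖x - f (y x)‖ + ‖f (y x) - f (g z)‖ := norm_add_le _ _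
    _ < ε := by linarith [hy x hx]

theorem ApproxBy.iso {A B : CStarAlg.{u}} {P : CStarAlg.{u} → Prop} (h : ApproxBy P A)
    (e : A.Iso B) : ApproxBy P B := by
  obtain ⟨e⟩ := e
  refine ApproxBy.trans fun F ε hε => ⟨A, (e : A →⋆ₙₐ[ℂ] B), e.injective, h, fun x _ =>
    ⟨e.symm x, ?_⟩⟩
  simpa using hε

open Filter Topology in
theorem ApproxBy.exists_seq {A : CStarAlg.{u}} {P : CStarAlg.{u} → Prop} (h : ApproxBy P A)
    (F : Finset A) : ∃ (D : ℕ → CStarAlg.{u}) (f : ∀ n, D n →⋆ₙₐ[ℂ] A) (y : ∀ n, A → D n),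
      ∀ n, Function.Injective (f n) ∧ P (D n) ∧ ∀ x ∈ F, ‖x - f n (y n x)‖ < 1 / (n + 1 : ℝ) := by
  have := fun n : ℕ => h F (1 / (n + 1 : ℝ)) Nat.one_div_pos_of_nat
  choose D f hf hD hF using this
  choose! y hy using hF
  exact ⟨D, f, y, fun n => ⟨hf n, hD n, hy n⟩⟩

end CStarAlg

end

noncomputable section

section CStarLemmas

attribute [local instance] CStarAlgebra.spectralOrder CStarAlgebra.spectralOrderedRing

open Filter Topology

variable {A : Type*} [NonUnitalCStarAlgebra A]

/-! ### Closed linear spans and approximate units -/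

/-- The closed linear span. -/
def cspan (X : Set A) : Submodule ℂ A := (Submodule.span ℂ X).topologicalClosure

theorem subset_cspan {X : Set A} {x : A} (hx : x ∈ X) : x ∈ cspan X :=
  Submodule.le_topologicalClosure _ (Submodule.subset_span hx)

theorem isClosed_cspan (X : Set A) : IsClosed (cspan X : Set A) :=
  Submodule.isClosed_topologicalClosure _

theorem cspan_le {X : Set A} {M : Submodule ℂ A} (hM : IsClosed (M : Set A))
    (h : ∀ x ∈ X, x ∈ M) : cspan X ≤ M :=
  Submodule.topologicalClosure_minimal _ (Submodule.span_le.2 h) hM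

theorem map_mem_of_mem_cspan {B : Type*} [NonUnitalCStarAlgebra B] {X : Set A}
    {M : Submodule ℂ B} (hM : IsClosed (M : Set B)) (f : A →ₗ[ℂ] B) (hf : Continuous f)
    (h : ∀ x ∈ X, f x ∈ M) {x : A} (hx : x ∈ cspan X) : f x ∈ M :=
  cspan_le (M := M.comap f) (hM.preimage hf) h hx

theorem mul_mem_of_mem_cspan {X Y : Set A} {M : Submodule ℂ A} (hM : IsClosed (M : Set A))
    (h : ∀ x ∈ X, ∀ y ∈ Y, x * y ∈ M) {x y : A} (hx : x ∈ cspan X) (hy : y ∈ cspan Y) :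
    x * y ∈ M := by
  have h1 : ∀ x ∈ X, x * y ∈ M := fun x hx =>
    map_mem_of_mem_cspan hM (LinearMap.mulLeft ℂ x) (continuous_const.mul continuous_id) (h x hx) hy
  exact map_mem_of_mem_cspan hM (LinearMap.mulRight ℂ y) (continuous_id.mul continuous_const) h1 hx

theorem star_mem_cspan {X Y : Set A} (h : ∀ x ∈ X, star x ∈ Y) {x : A} (hx : x ∈ cspan X) :
    star x ∈ cspan Y := by
  have hx' : x ∈ closure (Submodule.span ℂ X : Set A) := hx
  have : star x ∈ closure (Submodule.span ℂ Y : Set A) := by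
    refine map_mem_closure continuous_star hx' fun y hy => ?_
    refine Submodule.span_induction (p := fun y _ => star y ∈ Submodule.span ℂ Y)
      (fun y hy => Submodule.subset_span (h y hy)) (by simp) (fun a b _ _ ha hb => ?_)
      (fun c a _ ha => ?_) hy
    · rw [star_add]; exact add_mem ha hb
    · rw [star_smul]; exact Submodule.smul_mem _ _ ha
  exact this

/-- For finitely many elements there is a positive contraction which is almost a unit. -/
theorem exists_approx_unit (F : Finset A) {ε : ℝ} (hε : 0 < ε) :
    ∃ h : A, 0 ≤ h ∧ ‖h‖ ≤ 1 ∧ ∀ x ∈ F, ‖h * x - x‖ < ε ∧ ‖x * h - x‖ < ε := by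
  have hu := CStarAlgebra.increasingApproximateUnit A
  have := hu.neBot
  have h1 : ∀ᶠ h in CStarAlgebra.approximateUnit A, ∀ x ∈ F,
      ‖h * x - x‖ < ε ∧ ‖x * h - x‖ < ε := by
    rw [eventually_all_finset]
    intro x _
    filter_upwards [(Metric.tendsto_nhds.1 (hu.tendsto_mul_left x)) ε hε,
      (Metric.tendsto_nhds.1 (hu.tendsto_mul_right x)) ε hε] with h h2 h3
    rw [dist_eq_norm] at h2 h3
    exact ⟨by assumption, by assumption⟩
  obtain ⟨h, h2, h3, h4⟩ := (hu.eventually_nonneg.and (hu.eventually_norm.and h1)).exists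
  exact ⟨h, h2, h3, h4⟩

theorem mem_of_forall_approx {S : Set A} (hS : IsClosed S) {x : A}
    (h : ∀ ε : ℝ, 0 < ε → ∃ y ∈ S, ‖y - x‖ < ε) : x ∈ S := by
  rw [← hS.closure_eq, Metric.mem_closure_iff]
  intro ε hε
  obtain ⟨y, hy, hxy⟩ := h ε hε
  exact ⟨y, hy, by rwa [dist_comm, dist_eq_norm]⟩

/-! ### Factorization -/

/-- Writing `b - x x* = z z*`, the difference of the two sides is `(1 - k) z z* (1 - k)*`, computed
without a unit. -/
theorem sub_mul_sub_star_le {b x : A} (k : A) (hx : x * star x ≤ b) :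
    (x - k * x) * star (x - k * x) ≤ b - k * b - b * star k + k * b * star k := by
  have h0 : 0 ≤ b - x * star x := sub_nonneg.2 hx
  obtain ⟨z, hz⟩ := CStarAlgebra.nonneg_iff_eq_mul_star_self.1 h0
  have h1 : 0 ≤ (z - k * z) * star (z - k * z) := mul_star_self_nonneg _
  rw [← sub_nonneg]
  convert h1 using 1
  have hb : b = z * star z + x * star x := by rw [← hz]; abel
  rw [hb]
  simp only [star_sub, star_mul]
  noncomm_ring

/-- If `x x* ≤ b`, then `x` lies in the closed right ideal generated by `b`. -/
theorem mem_closure_mul_of_mul_star_le {b x : A} (hx : x * star x ≤ b) :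
    x ∈ closure (Set.range (b * ·)) := by
  have hb : 0 ≤ b := (mul_star_self_nonneg x).trans hx
  have hbs : IsSelfAdjoint b := .of_nonneg hb
  rw [Metric.mem_closure_range_iff]
  intro ε hε
  obtain ⟨δ, hδ, hδε⟩ : ∃ δ : ℝ, 0 < δ ∧ δ < ε ^ 2 := exists_between (by positivity)
  -- With `f(t) = t g(t) = t² / (t² + δ²)`, the element `k = f(b)` equals `b g(b)`, so `k x` lies in
  -- `b A`, while `t (1 - f(t))² = t δ⁴ / (t² + δ²)² ≤ δ` bounds `‖x - k x‖²`.
  let g : ℝ → ℝ := fun t => t / (t ^ 2 + δ ^ 2)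
  let f : ℝ → ℝ := fun t => t * g t
  have hpos : ∀ t : ℝ, 0 < t ^ 2 + δ ^ 2 := fun t => by positivity
  have hg : Continuous g := continuous_id.div (by fun_prop) fun t => (hpos t).ne'
  have hf : Continuous f := continuous_id.mul hg
  have hg0 : g 0 = 0 := by simp [g]
  have hf0 : f 0 = 0 := by simp [f]
  have hk : cfcₙ f b = b * cfcₙ g b := by
    have : cfcₙ f b = cfcₙ (fun t : ℝ => t) b * cfcₙ g b :=
      cfcₙ_mul (fun t : ℝ => t) g b continuousOn_id rfl hg.continuousOn hg0
    rw [this, cfcₙ_id' ℝ b]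
  set k := cfcₙ f b with hkdef
  have hks : star k = k := (cfcₙ_predicate f b : IsSelfAdjoint (cfcₙ f b)).star_eq
  refine ⟨cfcₙ g b * x, ?_⟩
  have h1 := sub_mul_sub_star_le k hx
  have h2 : b - k * b - b * star k + k * b * star k =
      cfcₙ (fun t : ℝ => (t - f t * t) - (t - f t * t) * f t) b := by
    have c1 : Continuous fun t : ℝ => f t * t := hf.mul continuous_id
    have c2 : Continuous fun t : ℝ => t - f t * t := continuous_id.sub c1
    have z1 : (fun t : ℝ => f t * t) 0 = 0 := by simp
    have z2 : (fun t : ℝ => t - f t * t) 0 = 0 := by simp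
    have e1 : cfcₙ (fun t : ℝ => f t * t) b = k * b := by
      rw [cfcₙ_mul f (fun t : ℝ => t) b hf.continuousOn hf0 continuousOn_id rfl, cfcₙ_id' ℝ b]
    have e2 : cfcₙ (fun t : ℝ => t - f t * t) b = b - k * b := by
      rw [cfcₙ_sub (fun t : ℝ => t) (fun t : ℝ => f t * t) b continuousOn_id rfl
        c1.continuousOn z1, e1, cfcₙ_id' ℝ b]
    rw [cfcₙ_sub (fun t : ℝ => t - f t * t) (fun t : ℝ => (t - f t * t) * f t) b c2.continuousOn z2
      (c2.mul hf).continuousOn (by simp), cfcₙ_mul (fun t : ℝ => t - f t * t) f b c2.continuousOn z2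
      hf.continuousOn hf0, e2, hks]
    noncomm_ring
  have h3 : ‖cfcₙ (fun t : ℝ => (t - f t * t) - (t - f t * t) * f t) b‖ ≤ δ := by
    refine norm_cfcₙ_le fun t ht => ?_
    have ht0 : 0 ≤ t := quasispectrum_nonneg_of_nonneg b hb t ht
    have e : (t - f t * t) - (t - f t * t) * f t = t * δ ^ 4 / (t ^ 2 + δ ^ 2) ^ 2 := by
      simp only [f, g]
      field_simp
      ring
    rw [e, Real.norm_of_nonneg (by positivity), div_le_iff₀ (by positivity)]
    have : t * δ ≤ t ^ 2 + δ ^ 2 := by nlinarith [sq_nonneg (t - δ), mul_nonneg ht0 hδ.le]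
    have h4 : δ ^ 2 ≤ t ^ 2 + δ ^ 2 := by nlinarith [sq_nonneg t]
    calc t * δ ^ 4 = δ * ((t * δ) * δ ^ 2) := by ring
      _ ≤ δ * ((t ^ 2 + δ ^ 2) * (t ^ 2 + δ ^ 2)) := by gcongr
      _ = _ := by ring
  have h5 : ‖x - k * x‖ ^ 2 ≤ δ := by
    rw [sq, ← CStarRing.norm_self_mul_star]
    rw [h2] at h1
    exact (CStarAlgebra.norm_le_norm_of_nonneg_of_le (mul_star_self_nonneg _) h1).trans h3
  rw [dist_eq_norm, ← mul_assoc, ← hk]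
  exact lt_of_pow_lt_pow_left₀ 2 hε.le (h5.trans_lt hδε)

theorem mem_closure_mul_of_mul_star_le_smul {b x : A} {c : ℝ}
    (hx : x * star x ≤ c • b) : x ∈ closure (Set.range (b * ·)) := by
  have h := mem_closure_mul_of_mul_star_le hx
  refine closure_mono ?_ h
  rintro _ ⟨y, rfl⟩
  exact ⟨c • y, by simp [mul_smul_comm, smul_mul_assoc]⟩

/-- The part of `g` above `2ε` is controlled by every `m` with `‖g - m‖ ≤ ε`. -/
theorem exists_cutDown {g h : A} (hg : 0 ≤ g) (hh : IsSelfAdjoint h) {ε : ℝ} (hε : 0 < ε)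
    (hgm : ‖g - h * h‖ ≤ ε) :
    ∃ c : A, 0 ≤ c ∧ ‖c - g‖ ≤ 2 * ε ∧ c ∈ closure (Set.range ((c * h) * ·)) ∧
      c = cfcₙ (fun t : ℝ => max (t - 2 * ε) 0) g := by
  let f : ℝ → ℝ := fun t => max (t - 2 * ε) 0
  have hf : Continuous f := by fun_prop
  have hf0 : f 0 = 0 := by simp [f, hε.le]
  have hgs : IsSelfAdjoint g := .of_nonneg hg
  set c := cfcₙ f g with hc
  have hc0 : 0 ≤ c := cfcₙ_nonneg fun t _ => le_max_right _ _
  have hcs : star c = c := (IsSelfAdjoint.of_nonneg hc0).star_eq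
  refine ⟨c, hc0, ?_, ?_, rfl⟩
  · have : c - g = cfcₙ (fun t : ℝ => f t - t) g := by
      rw [cfcₙ_sub .., cfcₙ_id' ℝ g]
    rw [this]
    refine norm_cfcₙ_le fun t ht => ?_
    have ht0 : 0 ≤ t := quasispectrum_nonneg_of_nonneg g hg t ht
    rw [Real.norm_eq_abs, abs_le]
    simp only [f]
    constructor
    · linarith [le_max_left (t - 2 * ε) 0]
    · have : max (t - 2 * ε) 0 ≤ t := max_le (by linarith) ht0
      linarith
  · have h1 : (2 * ε) • (c * c) ≤ c * g * c := by
      have e1 : (2 * ε) • (c * c) = cfcₙ (fun t : ℝ => (2 * ε) • (f t * f t)) g := by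
        rw [cfcₙ_smul .., cfcₙ_mul ..]
      have e2 : c * g * c = cfcₙ (fun t : ℝ => f t * t * f t) g := by
        rw [cfcₙ_mul .., cfcₙ_mul .., cfcₙ_id' ℝ g]
      rw [e1, e2]
      refine cfcₙ_mono fun t _ => ?_
      simp only [f, smul_eq_mul]
      rcases le_total (t - 2 * ε) 0 with h | h
      · rw [max_eq_right h]; simp
      · rw [max_eq_left h]; nlinarith [mul_nonneg h (mul_nonneg h h)]
    have h2 : c * (g - h * h) * c ≤ ε • (c * c) := by
      have h3 : IsSelfAdjoint (g - h * h) := hgs.sub (by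
        rw [isSelfAdjoint_iff, star_mul, hh.star_eq])
      have := CStarAlgebra.star_left_conjugate_le_norm_smul (a := c) (b := g - h * h)
      rw [hcs] at this
      refine this.trans (smul_le_smul_of_nonneg_right hgm ?_)
      have := star_mul_self_nonneg c
      rwa [hcs] at this
    have h4 : ε • (c * c) ≤ (c * h) * star (c * h) := by
      have e : (c * h) * star (c * h) = c * g * c - c * (g - h * h) * c := by
        rw [star_mul, hcs, hh.star_eq]; noncomm_ring
      rw [e, le_sub_iff_add_le]
      calc ε • (c * c) + c * (g - h * h) * c ≤ ε • (c * c) + ε • (c * c) := by gcongr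
        _ = (2 * ε) • (c * c) := by rw [← add_smul, two_mul]
        _ ≤ _ := h1
    have h5 : c * star c ≤ ε⁻¹ • ((c * h) * star (c * h)) := by
      rw [hcs]
      have := smul_le_smul_of_nonneg_left h4 (inv_nonneg.2 hε.le)
      rwa [smul_smul, inv_mul_cancel₀ hε.ne', one_smul] at this
    refine closure_mono ?_ (mem_closure_mul_of_mul_star_le_smul h5)
    rintro _ ⟨y, rfl⟩
    exact ⟨star (c * h) * y, by simp [mul_assoc]⟩

end CStarLemmas

end

noncomputable section

section Hereditary

attribute [local instance] CStarAlgebra.spectralOrder CStarAlgebra.spectralOrderedRing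

open Filter Topology

variable {A : Type*} [NonUnitalCStarAlgebra A]

/-! ### Hereditary subalgebras generated by one element -/

/-- The linear map `w ↦ z w z*`. -/
def conjMap (z : A) : A →ₗ[ℂ] A :=
  LinearMap.mulRight ℂ (star z) ∘ₗ LinearMap.mulLeft ℂ z

theorem conjMap_apply (z w : A) : conjMap z w = z * w * star z := rfl

/-- The hereditary subalgebra `closure (z A z*)`. -/
def her (z : A) : NonUnitalStarSubalgebra ℂ A where
  __ := (LinearMap.range (conjMap z)).topologicalClosure
  mul_mem' {x y} hx hy := by
    refine map_mem_closure₂ continuous_mul hx hy ?_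
    rintro _ ⟨v, rfl⟩ _ ⟨w, rfl⟩
    exact ⟨v * star z * z * w, by simp only [conjMap_apply, mul_assoc]⟩
  star_mem' {x} hx := by
    refine map_mem_closure continuous_star hx ?_
    rintro _ ⟨v, rfl⟩
    exact ⟨star v, by simp only [conjMap_apply, mul_assoc, star_mul, star_star]⟩

theorem isClosed_her (z : A) : IsClosed (her z : Set A) := isClosed_closure

theorem conj_mem_her (z w : A) : z * w * star z ∈ her z := subset_closure ⟨w, rfl⟩

theorem her_subset {z : A} {S : Set A} (hS : IsClosed S) (h : ∀ w, z * w * star z ∈ S) :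
    (her z : Set A) ⊆ S := by
  refine closure_minimal ?_ hS
  rintro _ ⟨w, rfl⟩
  exact h w

/-- If `x` and `y` lie in the closed right ideal of `z`, then `x w y* ∈ her z`. -/
theorem mul_mul_star_mem_her {z x y : A} (hx : x ∈ closure (Set.range (z * ·)))
    (hy : y ∈ closure (Set.range (z * ·))) (w : A) : x * w * star y ∈ her z := by
  refine map_mem_closure₂ (f := fun x y : A => x * w * star y) (by fun_prop) hx hy ?_
  rintro _ ⟨s, rfl⟩ _ ⟨t, rfl⟩
  exact ⟨s * w * star t, by simp only [conjMap_apply, mul_assoc, star_mul]⟩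

theorem her_le {z x : A} (hx : x ∈ closure (Set.range (z * ·))) : her x ≤ her z :=
  her_subset (isClosed_her z) fun w => mul_mul_star_mem_her hx hx w

/-- By the `C*`-identity, `‖z v‖ = ‖a v‖` for all `v`; taking adjoints in between allows both outer
factors to be exchanged. -/
theorem norm_conj_eq {z a : A} (h : star a * a = star z * z) (w : A) :
    ‖z * w * star z‖ = ‖a * w * star a‖ := by
  have key : ∀ v : A, ‖z * v‖ = ‖a * v‖ := fun v => by
    have : ‖z * v‖ * ‖z * v‖ = ‖a * v‖ * ‖a * v‖ := by
      rw [← CStarRing.norm_star_mul_self, ← CStarRing.norm_star_mul_self]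
      congr 1
      calc star (z * v) * (z * v) = star v * (star z * z) * v := by
            simp only [star_mul, mul_assoc]
        _ = star (a * v) * (a * v) := by rw [← h]; simp only [star_mul, mul_assoc]
    exact (mul_self_inj (norm_nonneg _) (norm_nonneg _)).1 this
  calc ‖z * w * star z‖ = ‖a * (w * star z)‖ := by rw [mul_assoc, key]
    _ = ‖star (a * (w * star z))‖ := (norm_star _).symm
    _ = ‖z * (star w * star a)‖ := by simp only [star_mul, star_star, mul_assoc]
    _ = ‖a * (star w * star a)‖ := key _
    _ = ‖star (a * (star w * star a))‖ := (norm_star _).symm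
    _ = ‖a * w * star a‖ := by simp only [star_mul, star_star, mul_assoc]

/-- `w ↦ z w z*` as a map into `her z`. -/
def conjHer (z : A) : A →ₗ[ℂ] her z where
  toFun w := ⟨z * w * star z, conj_mem_her z w⟩
  map_add' v w := Subtype.ext (map_add (conjMap z) v w)
  map_smul' c w := Subtype.ext (map_smul (conjMap z) c w)

theorem coe_conjHer (z w : A) : (conjHer z w : A) = z * w * star z := rfl

theorem denseRange_conjHer (z : A) : DenseRange (conjHer z) := by
  intro x
  rw [Topology.IsInducing.subtypeVal.closure_eq_preimage_closure_image]
  have hx : (x : A) ∈ closure (Set.range (conjMap z)) := x.2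
  have : Set.range (conjMap z) ⊆ (fun y : her z => (y : A)) '' Set.range (conjHer z) := by
    rintro _ ⟨w, rfl⟩
    exact ⟨conjHer z w, ⟨w, rfl⟩, rfl⟩
  exact closure_mono this hx

theorem conjHer_mul (z v w : A) :
    conjHer z v * conjHer z w = conjHer z (v * (star z * z) * w) :=
  Subtype.ext (by simp [coe_conjHer, mul_assoc])

theorem star_conjHer (z v : A) : star (conjHer z v) = conjHer z (star v) :=
  Subtype.ext (by simp [coe_conjHer, mul_assoc])

/-- If `a* a = z* z`, then `z w z* ↦ a w a*` extends to an isomorphism `her z ≅ her a`. -/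
theorem exists_her_equiv {z a : A} (h : star a * a = star z * z) :
    ∃ e : her z ≃⋆ₐ[ℂ] her a, ∀ w, e (conjHer z w) = conjHer a w := by
  have : CompleteSpace (her z) := (isClosed_her z).completeSpace_coe
  have : CompleteSpace (her a) := (isClosed_her a).completeSpace_coe
  let L := (LinearEquiv.refl ℂ A).extendOfIsometry (conjHer z) (conjHer a)
    (denseRange_conjHer z) (denseRange_conjHer a) fun w => (norm_conj_eq h w).symm
  have hL : ∀ w, L (conjHer z w) = conjHer a w := fun w =>
    LinearEquiv.extendOfIsometry_eq _ _ _ _ _ _ w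
  have hLc : Continuous L := L.continuous
  have hsc : Continuous (star : her z → her z) :=
    (continuous_star.comp continuous_subtype_val).subtype_mk _
  have hsc' : Continuous (star : her a → her a) :=
    (continuous_star.comp continuous_subtype_val).subtype_mk _
  refine ⟨{ toFun := L, invFun := L.symm, left_inv := L.left_inv, right_inv := L.right_inv,
            map_add' := map_add L, map_smul' := map_smul L, map_mul' := ?_, map_star' := ?_ }, hL⟩
  · intro x y
    refine (denseRange_conjHer z).induction_on₂ (p := fun x y => L (x * y) = L x * L y)
      (isClosed_eq (by fun_prop) (by fun_prop)) (fun v w => ?_) x y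
    simp only [conjHer_mul, hL, h]
  · intro x
    refine (denseRange_conjHer z).induction_on (p := fun x => L (star x) = star (L x)) x
      (isClosed_eq (hLc.comp hsc) (hsc'.comp hLc)) (fun v => ?_)
    simp only [star_conjHer, hL]

theorem star_mul_self_abs (z : A) : star (CFC.abs z) * CFC.abs z = star z * z := by
  rw [(IsSelfAdjoint.of_nonneg (CFC.abs_nonneg z)).star_eq, CFC.abs_mul_abs]

/-- `|z|` generates the same closed right ideal as `z*`. -/
theorem abs_mem_closure (z : A) : CFC.abs z ∈ closure (Set.range (star z * ·)) := by
  have h : CFC.abs z * star (CFC.abs z) ≤ star z * z := by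
    rw [(IsSelfAdjoint.of_nonneg (CFC.abs_nonneg z)).star_eq, CFC.abs_mul_abs]
  refine closure_mono ?_ (mem_closure_mul_of_mul_star_le h)
  rintro _ ⟨y, rfl⟩
  exact ⟨z * y, by simp [mul_assoc]⟩

theorem star_mem_closure_abs (z : A) : star z ∈ closure (Set.range (CFC.abs z * ·)) := by
  have h : star z * star (star z) ≤ CFC.abs z * CFC.abs z := by
    rw [star_star, CFC.abs_mul_abs]
  refine closure_mono ?_ (mem_closure_mul_of_mul_star_le h)
  rintro _ ⟨y, rfl⟩
  exact ⟨CFC.abs z * y, by simp [mul_assoc]⟩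

theorem her_abs (z : A) : her (CFC.abs z) = her (star z) :=
  le_antisymm (her_le (abs_mem_closure z)) (her_le (star_mem_closure_abs z))

/-! ### Strictly positive elements -/

/-- Every element `x` of a `C*`-algebra is a limit of products `a x b`. -/
theorem mem_closure_mul_self (x : A) : x ∈ closure (Set.range fun p : A × A => p.1 * x * p.2) := by
  refine mem_of_forall_approx isClosed_closure fun ε hε => ?_
  obtain ⟨h, -, h1, h2⟩ := exists_approx_unit {x} (half_pos hε)
  obtain ⟨h3, h4⟩ := h2 x (Finset.mem_singleton_self x)
  refine ⟨h * x * h, subset_closure ⟨(h, h), rfl⟩, ?_⟩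
  calc ‖h * x * h - x‖ = ‖(h * x - x) * h + (x * h - x)‖ := by congr 1; noncomm_ring
    _ ≤ ‖h * x - x‖ * ‖h‖ + ‖x * h - x‖ := (norm_add_le _ _).trans (by gcongr; exact norm_mul_le _ _)
    _ ≤ ‖h * x - x‖ * 1 + ‖x * h - x‖ := by gcongr
    _ < ε := by linarith

/-- A separable `C*`-algebra has a positive element which generates it as a right ideal. -/
theorem exists_strictly_positive [TopologicalSpace.SeparableSpace A] :
    ∃ q : A, 0 ≤ q ∧ ∀ x : A, x ∈ closure (Set.range (q * ·)) := by
  obtain ⟨x, hx⟩ := TopologicalSpace.exists_dense_seq A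
  -- The weights make `∑ c_n x_n x_n*` converge. Every term is dominated by the sum, so each `x_n`,
  -- and by density every element, lies in the closed right ideal of the sum.
  let c : ℕ → ℝ := fun n => (1 / 2) ^ n / (1 + ‖x n * star (x n)‖)
  have hc : ∀ n, 0 < c n := fun n => by positivity
  have hs : Summable fun n => c n • (x n * star (x n)) := by
    refine Summable.of_norm_bounded summable_geometric_two fun n => ?_
    rw [norm_smul, Real.norm_of_nonneg (hc n).le, div_mul_eq_mul_div, div_le_iff₀ (by positivity)]
    gcongr
    linarith
  have hpos : ∀ n, 0 ≤ c n • (x n * star (x n)) := fun n =>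
    smul_nonneg (hc n).le (mul_star_self_nonneg _)
  have hclosed : ∀ n, c n • (x n * star (x n)) ≤ ∑' n, c n • (x n * star (x n)) := fun n => by
    have h1 : Tendsto (fun F : Finset ℕ => ∑ i ∈ F, c i • (x i * star (x i)) -
        c n • (x n * star (x n))) atTop
        (𝓝 (∑' n, c n • (x n * star (x n)) - c n • (x n * star (x n)))) :=
      hs.hasSum.sub_const _
    rw [← sub_nonneg]
    refine CStarAlgebra.isClosed_nonneg.mem_of_tendsto h1 ?_
    filter_upwards [eventually_ge_atTop {n}] with F hF
    refine sub_nonneg.2 ?_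
    exact Finset.single_le_sum (fun i _ => hpos i) (Finset.singleton_subset_iff.1 hF)
  refine ⟨∑' n, c n • (x n * star (x n)), (hpos 0).trans (hclosed 0), fun y => ?_⟩
  refine closure_minimal (Set.range_subset_iff.2 fun n => ?_) isClosed_closure (hx y)
  refine mem_closure_mul_of_mul_star_le_smul (c := (c n)⁻¹) ?_
  have := smul_le_smul_of_nonneg_left (hclosed n) (inv_nonneg.2 (hc n).le)
  rwa [smul_smul, inv_mul_cancel₀ (hc n).ne', one_smul] at this

end Hereditary

end

noncomputable section

/-! ### Unitizations of `*`-homomorphisms and of unital algebras -/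

section Unitization

theorem Unitization.exists_norm_sub_starMap_lt {A D : Type*} [NonUnitalCStarAlgebra A]
    [NonUnitalCStarAlgebra D] (f : D →⋆ₙₐ[ℂ] A) (x : Unitization ℂ A) {ε : ℝ}
    (h : ∃ y, ‖x.snd - f y‖ < ε) : ∃ y, ‖x - Unitization.starMap f y‖ < ε := by
  obtain ⟨y, hy⟩ := h
  refine ⟨Unitization.inl x.fst + (y : Unitization ℂ D), ?_⟩
  have h1 : x - Unitization.starMap f (Unitization.inl x.fst + (y : Unitization ℂ D)) =
      ((x.snd - f y : A) : Unitization ℂ A) := by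
    rw [map_add, ← Unitization.algebraMap_eq_inl, AlgHomClass.commutes, Unitization.starMap_inr,
      Unitization.algebraMap_eq_inl]
    conv_lhs => rw [← Unitization.inl_fst_add_inr_snd_eq x]
    rw [Unitization.inr_sub]
    simp
  rwa [h1, Unitization.norm_inr]

/-- If `e` is a unit of `A`, then `A⁺¹ ≅ A ⊕ ℂ`; the second summand is written as the unitization
of a zero algebra. -/
def Unitization.equivProdOfUnit {A Z : Type*} [NonUnitalCStarAlgebra A] [NonUnitalCStarAlgebra Z]
    [Subsingleton Z] (e : A) (hes : star e = e) (he : ∀ a, e * a = a ∧ a * e = a) :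
    Unitization ℂ A ≃⋆ₐ[ℂ] A × Unitization ℂ Z where
  toFun x := (x.fst • e + x.snd, Unitization.inl x.fst)
  invFun p := Unitization.inl p.2.fst + ((p.1 - p.2.fst • e : A) : Unitization ℂ A)
  left_inv x := by
    refine Unitization.ext ?_ ?_
    · rw [Unitization.fst_add, Unitization.fst_inr, add_zero]; rfl
    · rw [Unitization.snd_add, Unitization.snd_inl, Unitization.snd_inr]
      simp
  right_inv p := by
    have h1 : (Unitization.inl p.2.fst + ((p.1 - p.2.fst • e : A) : Unitization ℂ A)).fst =
        p.2.fst := by rw [Unitization.fst_add, Unitization.fst_inr, add_zero]; rfl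
    have h2 : (Unitization.inl p.2.fst + ((p.1 - p.2.fst • e : A) : Unitization ℂ A)).snd =
        p.1 - p.2.fst • e := by
      rw [Unitization.snd_add, Unitization.snd_inl, Unitization.snd_inr, zero_add]
    refine Prod.ext ?_ (Unitization.ext ?_ (Subsingleton.elim _ _))
    · simp only [h1, h2]; abel
    · simp only [h1]; rfl
  map_mul' x y := by
    refine Prod.ext ?_ (Unitization.ext ?_ (Subsingleton.elim _ _))
    · simp only [Unitization.fst_mul, Unitization.snd_mul, Prod.fst_mul, mul_add, add_mul,
        smul_mul_assoc, mul_smul_comm, (he _).1, (he _).2, mul_smul]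
      rw [smul_add, smul_comm y.fst x.fst e]
      abel
    · simp
  map_add' x y := by
    refine Prod.ext ?_ (Unitization.ext ?_ (Subsingleton.elim _ _))
    · simp only [Unitization.fst_add, Unitization.snd_add, Prod.fst_add, add_smul]
      abel
    · simp
  map_star' x := by
    refine Prod.ext ?_ (Unitization.ext ?_ (Subsingleton.elim _ _))
    · simp [hes]
    · simp
  map_smul' c x := by
    refine Prod.ext ?_ (Unitization.ext ?_ (Subsingleton.elim _ _))
    · simp [smul_add, mul_smul]
    · simp

end Unitization

namespace CStarAlg

open Filter Topology

/-! ### Approximation passes to ideals -/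

section Ideals

attribute [local instance] CStarAlgebra.spectralOrder CStarAlgebra.spectralOrderedRing

theorem norm_mul_mul_sub_le {A : Type*} [NonUnitalCStarAlgebra A] {a b x : A} (ha : ‖a‖ ≤ 1) :
    ‖a * x * b - x‖ ≤ ‖a * x - x‖ + ‖x * b - x‖ := by
  calc ‖a * x * b - x‖ = ‖(a * x - x) + a * (x * b - x)‖ := by congr 1; noncomm_ring
    _ ≤ ‖a * x - x‖ + ‖a‖ * ‖x * b - x‖ := (norm_add_le _ _).trans (by gcongr; exact norm_mul_le _ _)
    _ ≤ ‖a * x - x‖ + 1 * ‖x * b - x‖ := by gcongr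
    _ = _ := by rw [one_mul]

theorem norm_conj_sub_le {A : Type*} [NonUnitalCStarAlgebra A] {h x : A} {δ : ℝ} (hh : ‖h‖ ≤ 1)
    (h1 : ‖h * x - x‖ ≤ δ) (h2 : ‖x * h - x‖ ≤ δ) (y : A) :
    ‖h * y * h - x‖ ≤ ‖y - x‖ + 2 * δ := by
  calc ‖h * y * h - x‖ = ‖h * (y - x) * h + (h * x * h - x)‖ := by congr 1; noncomm_ring
    _ ≤ ‖h‖ * ‖y - x‖ * ‖h‖ + ‖h * x * h - x‖ := (norm_add_le _ _).trans (by
        gcongr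
        exact (norm_mul_le _ _).trans (by gcongr; exact norm_mul_le _ _))
    _ ≤ 1 * ‖y - x‖ * 1 + (δ + δ) := by
        gcongr
        exact (norm_mul_mul_sub_le hh).trans (add_le_add h1 h2)
    _ = _ := by ring

/-- In the situation of an approximation of `A`, elements of the approximating algebras near
`h * h`, which lie in the hereditary subalgebra generated by `h`. -/
theorem ApproxBy.exists_cutDown {A : CStarAlg.{u}} {P : CStarAlg.{u} → Prop} (hA : ApproxBy P A)
    (F : Finset A) {h : A} (hh : IsSelfAdjoint h) :
    ∃ (D : ℕ → CStarAlg.{u}) (f : ∀ n, D n →⋆ₙₐ[ℂ] A) (y : ∀ n, A → D n) (c : ∀ n, D n),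
      (∀ n, Function.Injective (f n) ∧ P (D n) ∧ IsSelfAdjoint (c n) ∧
        f n (c n) ∈ closure (Set.range (f n (c n) * h * ·))) ∧
      Tendsto (fun n => f n (c n)) atTop (𝓝 (h * h)) ∧
      ∀ x ∈ F, Tendsto (fun n => f n (y n x)) atTop (𝓝 x) := by
  classical
  obtain ⟨D, f, y, hD⟩ := hA.exists_seq (insert h F)
  have hlim : ∀ x ∈ insert h F, Tendsto (fun n => f n (y n x)) atTop (𝓝 x) := fun x hx => by
    rw [tendsto_iff_norm_sub_tendsto_zero]
    refine squeeze_zero (fun n => norm_nonneg _) (fun n => ?_)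
      (tendsto_one_div_add_atTop_nhds_zero_nat (𝕜 := ℝ))
    rw [norm_sub_rev]
    exact ((hD n).2.2 x hx).le
  let g : ∀ n, D n := fun n => star (y n h) * y n h
  have hg : Tendsto (fun n => f n (g n)) atTop (𝓝 (h * h)) := by
    have h1 := hlim h (Finset.mem_insert_self h F)
    have h2 := h1.star.mul h1
    rw [hh.star_eq] at h2
    refine h2.congr fun n => ?_
    simp only [g, map_mul, map_star]
  -- The summand `1 / (n + 1)` keeps the cut-down level positive even when the approximation of `h *
  -- h` is exact.
  let e : ℕ → ℝ := fun n => ‖f n (g n) - h * h‖ + 1 / ((n : ℝ) + 1)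
  have he : Tendsto e atTop (𝓝 0) := by
    have := (tendsto_iff_norm_sub_tendsto_zero.1 hg).add
      (tendsto_one_div_add_atTop_nhds_zero_nat (𝕜 := ℝ))
    rwa [add_zero] at this
  have he0 : ∀ n, 0 < e n := fun n => add_pos_of_nonneg_of_pos (norm_nonneg _) Nat.one_div_pos_of_nat
  have hg0 : ∀ n, 0 ≤ g n := fun n => star_mul_self_nonneg _
  have hfg0 : ∀ n, 0 ≤ f n (g n) := fun n => by
    simp only [g, map_mul, map_star]; exact star_mul_self_nonneg _
  have key := fun n => _root_.exists_cutDown (hfg0 n) hh (he0 n)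
    (le_add_of_nonneg_right Nat.one_div_pos_of_nat.le)
  choose c' hc'0 hc'1 hc'2 hc'3 using key
  -- The cut-down is a function of `g n`, so it can be formed inside `D n`; functional calculus
  -- commutes with `f n`.
  let c : ∀ n, D n := fun n => cfcₙ (fun t : ℝ => max (t - 2 * e n) 0) (g n)
  have hc : ∀ n, f n (c n) = c' n := fun n => by
    rw [hc'3]
    exact NonUnitalStarAlgHomClass.map_cfcₙ (S := ℂ) (f n) _ (g n)
      (by fun_prop) (by simp [(he0 n).le]) (f n).continuous
      (IsSelfAdjoint.of_nonneg (hg0 n)) (IsSelfAdjoint.of_nonneg (hfg0 n))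
  refine ⟨D, f, y, c, fun n => ⟨(hD n).1, (hD n).2.1, cfcₙ_predicate _ _, ?_⟩, ?_,
    fun x hx => hlim x (Finset.mem_insert_of_mem hx)⟩
  · rw [hc]; exact hc'2 n
  · have h1 : Tendsto (fun n => c' n - f n (g n)) atTop (𝓝 0) := by
      refine squeeze_zero_norm hc'1 ?_
      simpa using he.const_mul 2
    have h2 := h1.add hg
    simp only [sub_add_cancel, zero_add] at h2
    exact h2.congr fun n => (hc n).symm

/-- With `h` an almost unit of `J`, the cut-down elements `f n (c n)` lie in the closure of `f n (c
n) * h * A`, hence in `J` itself. So `c n` belongs to the ideal `(f n)⁻¹(J)` of `D n`, and `c n * y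
* c n` tends to `h² x h²`, which is close to `x`. -/
theorem ApproxBy.ideal {A : CStarAlg.{u}} {P : CStarAlg.{u} → Prop}
    (hP : ∀ D, P D → ∀ J : D.Sub, J.IsIdeal → P J.toCStarAlg) (hA : ApproxBy P A)
    {J : A.Sub} (hJ : J.IsIdeal) : ApproxBy P J.toCStarAlg := by
  classical
  intro F ε hε
  -- Passing from `x` to `h² x h²` takes two conjugations by `h`, each costing `2 * (ε / 8)`; the
  -- total `ε / 2` leaves room for the limit.
  obtain ⟨h, h0, h1, hF⟩ := exists_approx_unit F (show 0 < ε / 8 by positivity)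
  have hh : IsSelfAdjoint (J.incl h) := (IsSelfAdjoint.of_nonneg h0).map J.incl
  obtain ⟨D, f, y, c, hD, hc, hy⟩ := hA.exists_cutDown (F.image J.incl) hh
  have hcJ : ∀ n, f n (c n) ∈ J.toSet := fun n => by
    refine closure_minimal ?_ J.isClosed (hD n).2.2.2
    rintro _ ⟨s, rfl⟩
    exact (hJ s _ ((hJ (f n (c n)) _ (J.incl_mem h)).1)).2
  have hev : ∀ᶠ n in atTop, ∀ x ∈ F,
      ‖J.incl x - f n (c n) * f n (y n (J.incl x)) * f n (c n)‖ < ε := by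
    rw [eventually_all_finset]
    intro x hx
    have hlim : Tendsto (fun n => f n (c n) * f n (y n (J.incl x)) * f n (c n)) atTop
        (𝓝 (J.incl (h * h * x * (h * h)))) := by
      simp only [map_mul]
      exact (hc.mul (hy _ (Finset.mem_image_of_mem _ hx))).mul hc
    have hlt : ‖J.incl x - J.incl (h * h * x * (h * h))‖ < ε := by
      rw [← map_sub, J.norm_incl, norm_sub_rev]
      obtain ⟨h2, h3⟩ := hF x hx
      have e1 := norm_conj_sub_le h1 h2.le h3.le x
      have e2 := norm_conj_sub_le h1 h2.le h3.le (h * x * h)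
      rw [sub_self, norm_zero, zero_add] at e1
      have e3 : h * (h * x * h) * h = h * h * x * (h * h) := by noncomm_ring
      rw [e3] at e2
      linarith
    exact (tendsto_const_nhds.sub hlim).norm.eventually_lt_const hlt
  obtain ⟨n, hn⟩ := hev.exists
  let I : (D n).Sub := J.comap (f n)
  have hI : I.IsIdeal := fun a x hx => by
    refine ⟨?_, ?_⟩
    · rw [Sub.mem_comap, map_mul]; exact (hJ (f n a) _ hx).1
    · rw [Sub.mem_comap, map_mul]; exact (hJ (f n a) _ hx).2
  have hcI : c n ∈ I.toSet := hcJ n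
  refine ⟨I.toCStarAlg, J.codRestrict ((f n).comp I.incl) fun x => I.incl_mem x, ?_, hP _ (hD n).2.1 I hI,
    fun x hx => ?_⟩
  · intro v w hvw
    exact I.incl_injective ((hD n).1 (congrArg J.incl hvw))
  · refine ⟨⟨c n * y n (J.incl x) * c n, (hI (c n * y n (J.incl x)) _ hcI).1⟩, ?_⟩
    have := hn x hx
    rw [← map_mul, ← map_mul] at this
    exact this

end Ideals

/-- Approximate lifts of the given elements; the image in `B` of the algebra used is one of its
quotients and is closed. -/
theorem ApproxBy.quotient {A B : CStarAlg.{u}} {P : CStarAlg.{u} → Prop}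
    (hP : ∀ D E : CStarAlg.{u}, D.IsQuotient E → P D → P E) (hA : ApproxBy P A)
    (h : A.IsQuotient B) : ApproxBy P B := by
  classical
  obtain ⟨q, hq⟩ := h
  choose s hs using hq
  intro F ε hε
  obtain ⟨D, f, -, hD, hF⟩ := hA (F.image s) ε hε
  let S := Sub.range (q.comp f)
  refine ⟨S.toCStarAlg, S.incl, S.incl_injective,
    hP _ _ (Sub.isQuotient_range _) hD, fun x hx => ?_⟩
  obtain ⟨y, hy⟩ := hF (s x) (Finset.mem_image_of_mem s hx)
  refine ⟨⟨q (f y), ⟨y, rfl⟩⟩, ?_⟩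
  change ‖x - q (f y)‖ < ε
  rw [← hs x, ← map_sub]
  exact (NonUnitalStarAlgHom.norm_apply_le q _).trans_lt hy

theorem ApproxBy.directSum {A B : CStarAlg.{u}} {P : CStarAlg.{u} → Prop}
    (hP : ∀ D E : CStarAlg.{u}, P D → P E → P (D.directSum E)) (hA : ApproxBy P A)
    (hB : ApproxBy P B) : ApproxBy P (A.directSum B) := by
  classical
  intro F ε hε
  obtain ⟨D, f, hf, hD, hF⟩ := hA (F.image fun x : A × B => x.1) ε hε
  obtain ⟨E, g, hg, hE, hG⟩ := hB (F.image fun x : A × B => x.2) ε hε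
  refine ⟨D.directSum E, ((f.comp (NonUnitalStarAlgHom.fst ℂ D E)).prod
    (g.comp (NonUnitalStarAlgHom.snd ℂ D E)) : D × E →⋆ₙₐ[ℂ] A × B), ?_, hP _ _ hD hE,
    fun x hx => ?_⟩
  · rintro ⟨v, w⟩ ⟨v', w'⟩ h
    have h1 := congrArg Prod.fst h
    have h2 := congrArg Prod.snd h
    exact Prod.ext (hf h1) (hg h2)
  · obtain ⟨y, hy⟩ := hF x.1 (Finset.mem_image_of_mem (fun x : A × B => x.1) hx)
    obtain ⟨z, hz⟩ := hG x.2 (Finset.mem_image_of_mem (fun x : A × B => x.2) hx)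
    exact ⟨(y, z), (max_lt hy hz : max ‖x.1 - f y‖ ‖x.2 - g z‖ < ε)⟩

/-! ### Unitizations -/

/-- The unitization, as a `C*`-algebra. -/
def unitization (A : CStarAlg.{u}) : CStarAlg.{u} := ⟨Unitization ℂ A⟩

/-- The map induced on unitizations. -/
def unitizationMap {A B : CStarAlg.{u}} (f : A →⋆ₙₐ[ℂ] B) : A.unitization →⋆ₙₐ[ℂ] B.unitization :=
  (Unitization.starMap f : Unitization ℂ A →⋆ₙₐ[ℂ] Unitization ℂ B)

theorem minimalUnitization_of_not_isUnital {A : CStarAlg.{u}} (h : ¬ A.IsUnital) :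
    A.minimalUnitization = A.unitization := if_neg h

theorem minimalUnitization_of_isUnital {A : CStarAlg.{u}} (h : A.IsUnital) :
    A.minimalUnitization = A := if_pos h

theorem ApproxBy.unitization {A : CStarAlg.{u}} {P : CStarAlg.{u} → Prop}
    (hP : ∀ D : CStarAlg.{u}, P D → P D.unitization) (hA : ApproxBy P A) :
    ApproxBy P A.unitization := by
  classical
  intro F ε hε
  obtain ⟨D, f, hf, hD, hF⟩ := hA (F.image fun x : Unitization ℂ A => x.snd) ε hε
  refine ⟨D.unitization, unitizationMap f, Unitization.starMap_injective hf, hP _ hD,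
    fun x hx => ?_⟩
  exact Unitization.exists_norm_sub_starMap_lt f x
    (hF _ (Finset.mem_image_of_mem (fun x : Unitization ℂ A => x.snd) hx))

/-- A unital algebra splits off from its unitization. -/
theorem unitization_iso_directSum {A Z : CStarAlg.{u}} (hA : A.IsUnital) (hZ : Subsingleton Z) :
    A.unitization.Iso (A.directSum Z.unitization) := by
  obtain ⟨e, -, he⟩ := hA
  have hes : star e = e := by
    have := (he (star e)).2
    rw [← (he (star e)).1]
    conv_rhs => rw [← star_star e, ← (he (star e)).1]
    simp
  exact ⟨Unitization.equivProdOfUnit e hes he⟩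

end CStarAlg

end

noncomputable section

open Filter Topology

/-! ### Separable subalgebras -/

/-- A countable set is contained in a countable set which is closed under a given operation on
finite subsets with countable values. -/
theorem exists_countable_closed {α : Type*} {S : Set α} (hS : S.Countable)
    (G : Finset α → Set α) (hG : ∀ F, (G F).Countable) :
    ∃ T : Set α, T.Countable ∧ S ⊆ T ∧ ∀ F : Finset α, (F : Set α) ⊆ T → G F ⊆ T := by
  let next : Set α → Set α := fun T =>
    T ∪ ⋃ F : Finset T, G (F.map (Function.Embedding.subtype _))
  let T : ℕ → Set α := fun n => next^[n] S
  have hsucc : ∀ n, T (n + 1) = next (T n) := fun n => Function.iterate_succ_apply' next n S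
  have hT : ∀ n, (T n).Countable := by
    intro n
    induction n with
    | zero => exact hS
    | succ n ih =>
      rw [hsucc]
      have := ih.to_subtype
      exact ih.union (Set.countable_iUnion fun F => hG _)
  have hmono : Monotone T := monotone_nat_of_le_succ fun n => by
    rw [hsucc]; exact Set.subset_union_left
  refine ⟨⋃ n, T n, Set.countable_iUnion hT, Set.subset_iUnion T 0, fun F hF => ?_⟩
  have : ∃ n, (F : Set α) ⊆ T n := by
    have := DirectedOn.exists_mem_subset_of_finset_subset_biUnion (α := α) (c := Set.univ) (f := T)
      (s := F) Set.univ_nonempty (fun i _ j _ => ⟨max i j, trivial, hmono (le_max_left _ _),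
        hmono (le_max_right _ _)⟩) (by simpa using hF)
    obtain ⟨n, -, hn⟩ := this
    exact ⟨n, hn⟩
  obtain ⟨n, hn⟩ := this
  refine Set.Subset.trans ?_ (Set.subset_iUnion T (n + 1))
  rw [hsucc]
  refine Set.Subset.trans ?_ Set.subset_union_right
  classical
  have hF' : (F.subtype (· ∈ T n)).map (Function.Embedding.subtype _) = F := by
    rw [Finset.subtype_map_of_mem fun x hx => hn hx]
  intro x hx
  rw [Set.mem_iUnion]
  exact ⟨F.subtype (· ∈ T n), by rwa [hF']⟩

namespace CStarAlg

theorem Sub.isSeparable_of_countable {A : CStarAlg.{u}} (B : A.Sub) {S : Set A} (hS : S.Countable)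
    (h : B.toSet ⊆ closure S) : B.toCStarAlg.IsSeparable :=
  (TopologicalSpace.IsSeparable.mono hS.isSeparable.closure h).separableSpace

/-- Close `F` off to a countable set stable under products and adjoints, then take the closed linear
span. -/
theorem exists_separable_sub {A : CStarAlg.{u}} (F : Finset A) :
    ∃ B : A.Sub, (F : Set A) ⊆ B.toSet ∧ B.toCStarAlg.IsSeparable := by
  classical
  obtain ⟨T, hT, hFT, hcl⟩ := exists_countable_closed F.countable_toSet
    (fun G => {x | ∃ a ∈ G, ∃ b ∈ G, x = a * b ∨ x = star a}) (fun G => by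
      refine ((G ×ˢ G).image (fun p => p.1 * p.2) ∪ G.image star).countable_toSet.mono ?_
      rintro x ⟨a, ha, b, hb, rfl | rfl⟩
      · exact Finset.mem_coe.2 (Finset.mem_union_left _
          (Finset.mem_image.2 ⟨(a, b), Finset.mk_mem_product ha hb, rfl⟩))
      · exact Finset.mem_coe.2 (Finset.mem_union_right _ (Finset.mem_image_of_mem _ ha)))
  have hmul : ∀ a ∈ T, ∀ b ∈ T, a * b ∈ T := fun a ha b hb =>
    hcl {a, b} (by simp [Set.insert_subset_iff, ha, hb]) ⟨a, by simp, b, by simp, Or.inl rfl⟩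
  have hstar : ∀ a ∈ T, star a ∈ T := fun a ha =>
    hcl {a} (by simpa using ha) ⟨a, by simp, a, by simp, Or.inr rfl⟩
  refine ⟨⟨{ (Submodule.span ℂ T).topologicalClosure with
      mul_mem' := fun {x y} hx hy => mul_mem_of_mem_cspan (X := T) (Y := T) (isClosed_cspan T)
        (fun a ha b hb => subset_cspan (hmul a ha b hb)) hx hy
      star_mem' := fun {x} hx => star_mem_cspan (X := T) hstar hx }, isClosed_cspan T⟩,
    fun x hx => subset_cspan (hFT hx), ?_⟩
  exact (TopologicalSpace.IsSeparable.mono hT.isSeparable.span.closure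
    (fun x hx => hx)).separableSpace

/-- If `A` is approximated by separable algebras with `P`, then so are sufficiently many of its
separable subalgebras. -/
theorem ApproxBy.exists_separable {A : CStarAlg.{u}} {P : CStarAlg.{u} → Prop}
    (hP : ∀ D, P D → D.IsSeparable) (hA : ApproxBy P A) (B : A.Sub)
    (hB : B.toCStarAlg.IsSeparable) :
    ∃ D : A.Sub, D.toCStarAlg.IsSeparable ∧ B.toSet ⊆ D.toSet ∧ ApproxBy P D.toCStarAlg := by
  classical
  have key := fun F : Finset A => hA.exists_seq F
  choose E f y hE using key
  have hsep : ∀ F n, TopologicalSpace.SeparableSpace (E F n) := fun F n => hP _ (hE F n).2.1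
  have hcount : ∀ F n, ∃ Q : Set (E F n), Q.Countable ∧ Dense Q := fun F n =>
    TopologicalSpace.exists_countable_dense (E F n)
  choose Q hQc hQd using hcount
  have : TopologicalSpace.SeparableSpace B.toCStarAlg := hB
  obtain ⟨S₀, hS₀, hS₀d⟩ := TopologicalSpace.exists_countable_dense B.toCStarAlg
  -- `S` is countable and contains, with each finite subset, a dense part of every algebra of its
  -- approximating sequence. Thus `closure S` contains these algebras entirely.
  obtain ⟨S, hS, hS₀S, hcl⟩ := exists_countable_closed (hS₀.image B.incl)
    (fun F => ⋃ n, f F n '' Q F n) fun F => Set.countable_iUnion fun n => (hQc F n).image _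
  have hmem : ∀ F : Finset A, (F : Set A) ⊆ S → ∀ n v, f F n v ∈ closure S := fun F hF n v => by
    have h1 : f F n v ∈ closure (f F n '' Q F n) :=
      image_closure_subset_closure_image (f F n).continuous ⟨v, hQd F n v, rfl⟩
    exact closure_mono ((Set.subset_iUnion (fun n => f F n '' Q F n) n).trans (hcl F hF)) h1
  have hlim : ∀ F : Finset A, ∀ x ∈ F, Tendsto (fun n => f F n (y F n x)) atTop (𝓝 x) :=
    fun F x hx => by
      rw [tendsto_iff_norm_sub_tendsto_zero]
      refine squeeze_zero (fun n => norm_nonneg _) (fun n => ?_)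
        (tendsto_one_div_add_atTop_nhds_zero_nat (𝕜 := ℝ))
      rw [norm_sub_rev]
      exact ((hE F n).2.2 x hx).le
  have hsub : ∀ {a b : A}, a ∈ S → b ∈ S → ((({a, b} : Finset A) : Set A) ⊆ S) := fun ha hb => by
    simp [Set.insert_subset_iff, ha, hb]
  -- `S` need not be closed under any operation. But `a` and `b` are limits of elements of the
  -- algebras attached to `{a, b}`, whose sums stay in those algebras and hence in `closure S`; the
  -- other operations are handled alike.
  have hadd : ∀ a ∈ S, ∀ b ∈ S, a + b ∈ closure S := fun a ha b hb =>
    isClosed_closure.mem_of_tendsto ((hlim {a, b} a (by simp)).add (hlim {a, b} b (by simp)))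
      (Eventually.of_forall fun n => by rw [← map_add]; exact hmem _ (hsub ha hb) n _)
  have hmul : ∀ a ∈ S, ∀ b ∈ S, a * b ∈ closure S := fun a ha b hb =>
    isClosed_closure.mem_of_tendsto ((hlim {a, b} a (by simp)).mul (hlim {a, b} b (by simp)))
      (Eventually.of_forall fun n => by rw [← map_mul]; exact hmem _ (hsub ha hb) n _)
  have hsmul : ∀ (c : ℂ), ∀ a ∈ S, c • a ∈ closure S := fun c a ha =>
    isClosed_closure.mem_of_tendsto ((hlim {a, a} a (by simp)).const_smul c)
      (Eventually.of_forall fun n => by rw [← map_smul]; exact hmem _ (hsub ha ha) n _)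
  have hstar : ∀ a ∈ S, star a ∈ closure S := fun a ha =>
    isClosed_closure.mem_of_tendsto (hlim {a, a} a (by simp)).star
      (Eventually.of_forall fun n => by rw [← map_star]; exact hmem _ (hsub ha ha) n _)
  -- The set `∅` also has approximating algebras, and these contain `0`.
  have hzero : (0 : A) ∈ closure S := by
    have := hmem ∅ (by simp) 0 0
    rwa [map_zero] at this
  let D : A.Sub :=
    ⟨{ carrier := closure S
       add_mem' := fun {x y} hx hy => by
        simpa only [closure_closure] using map_mem_closure₂ continuous_add hx hy hadd
       mul_mem' := fun {x y} hx hy => by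
        simpa only [closure_closure] using map_mem_closure₂ continuous_mul hx hy hmul
       zero_mem' := hzero
       smul_mem' := fun c x hx => by
        simpa only [closure_closure] using map_mem_closure (continuous_const_smul c) hx (hsmul c)
       star_mem' := fun {x} hx => by
        simpa only [closure_closure] using map_mem_closure continuous_star hx hstar },
      isClosed_closure⟩
  refine ⟨D, D.isSeparable_of_countable hS subset_rfl, ?_, ?_⟩
  · intro x hx
    have h1 : B.incl ⟨x, hx⟩ ∈ closure (B.incl '' S₀) :=
      image_closure_subset_closure_image B.incl.continuous ⟨_, hS₀d _, rfl⟩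
    exact closure_mono hS₀S h1
  · intro F ε hε
    have h1 : ∀ x : D.toCStarAlg, ∃ s ∈ S, ‖D.incl x - s‖ < ε / 2 := fun x => by
      obtain ⟨s, hs, hxs⟩ := Metric.mem_closure_iff.1 (D.incl_mem x) (ε / 2) (half_pos hε)
      exact ⟨s, hs, by rwa [← dist_eq_norm]⟩
    choose s hs hxs using h1
    let F' := F.image s
    have hF' : (F' : Set A) ⊆ S := by
      intro a ha
      obtain ⟨x, -, rfl⟩ := Finset.mem_image.1 (Finset.mem_coe.1 ha)
      exact hs x
    obtain ⟨n, hn⟩ := exists_nat_one_div_lt (half_pos hε)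
    refine ⟨E F' n, D.codRestrict (f F' n) (hmem F' hF' n), fun v w hvw =>
      (hE F' n).1 (congrArg D.incl hvw), (hE F' n).2.1, fun x hx => ⟨y F' n (s x), ?_⟩⟩
    change ‖D.incl x - f F' n (y F' n (s x))‖ < ε
    have h2 := (hE F' n).2.2 (s x) (Finset.mem_image_of_mem s hx)
    calc ‖D.incl x - f F' n (y F' n (s x))‖
        = ‖(D.incl x - s x) + (s x - f F' n (y F' n (s x)))‖ := by congr 1; abel
      _ ≤ ‖D.incl x - s x‖ + ‖s x - f F' n (y F' n (s x))‖ := norm_add_le _ _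
      _ < ε := by linarith [hxs x]

end CStarAlg

/-! ### The extension of a dimension theory -/

section Extension

open CStarAlg

/-- Membership in `C` together with `d ≤ k`. -/
def HasDimLE (C : Set CStarAlg.{u}) (d : CStarAlg.{u} → ℕ∞) (k : ℕ) (A : CStarAlg.{u}) : Prop :=
  A ∈ C ∧ d A ≤ k

variable {C : Set CStarAlg.{u}} {d : CStarAlg.{u} → ℕ∞}

namespace IsDimensionTheory

variable (hd : IsDimensionTheory C d)
include hd

theorem hasDimLE_iso {k : ℕ} (D E : CStarAlg.{u}) (h : D.Iso E) (hD : HasDimLE C d k D) :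
    HasDimLE C d k E :=
  have hE := hd.iso_mem D hD.1 E h
  ⟨hE, (hd.iso D hD.1 E hE h) ▸ hD.2⟩

theorem hasDimLE_quotient {k : ℕ} (D E : CStarAlg.{u}) (h : D.IsQuotient E)
    (hD : HasDimLE C d k D) : HasDimLE C d k E :=
  ⟨hd.quotient_mem D hD.1 E h, (hd.quotient D hD.1 E h).trans hD.2⟩

theorem hasDimLE_ideal {k : ℕ} (D : CStarAlg.{u}) (hD : HasDimLE C d k D) (J : D.Sub)
    (hJ : J.IsIdeal) : HasDimLE C d k J.toCStarAlg :=
  ⟨hd.ideal_mem D hD.1 J hJ, (hd.ideal D hD.1 J hJ).trans hD.2⟩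

theorem hasDimLE_directSum {k : ℕ} (D E : CStarAlg.{u}) (hD : HasDimLE C d k D)
    (hE : HasDimLE C d k E) : HasDimLE C d k (D.directSum E) :=
  ⟨hd.directSum_mem D hD.1 E hE.1, by
    rw [hd.directSum D hD.1 E hE.1]; exact max_le hD.2 hE.2⟩

theorem hasDimLE_minimalUnitization {k : ℕ} (D : CStarAlg.{u}) (hD : HasDimLE C d k D) :
    HasDimLE C d k D.minimalUnitization :=
  ⟨hd.minimalUnitization_mem D hD.1, (hd.minimalUnitization D hD.1).trans_le hD.2⟩

/-- The full unitization differs from the minimal one only for unital `D`, where it is `D ⊕ ℂ`. Here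
`ℂ` is the minimal unitization of the zero quotient of `D`, so (D2), (D4) and (D3) give the bound.
-/
theorem hasDimLE_unitization {k : ℕ} (D : CStarAlg.{u}) (hD : HasDimLE C d k D) :
    HasDimLE C d k D.unitization := by
  by_cases h : D.IsUnital
  · let Z := (Sub.range (0 : D →⋆ₙₐ[ℂ] D)).toCStarAlg
    have hZs : Subsingleton Z := ⟨fun x y => by
      obtain ⟨v, hv⟩ := x.2
      obtain ⟨w, hw⟩ := y.2
      exact Subtype.ext (hv.symm.trans hw)⟩
    have hZ : HasDimLE C d k Z := hd.hasDimLE_quotient D Z (Sub.isQuotient_range _) hD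
    have hZu : ¬ Z.IsUnital := fun ⟨e, he, _⟩ => he (Subsingleton.elim _ _)
    have hZ' := hd.hasDimLE_minimalUnitization Z hZ
    rw [minimalUnitization_of_not_isUnital hZu] at hZ'
    exact hd.hasDimLE_iso _ _ (unitization_iso_directSum h hZs).symm
      (hd.hasDimLE_directSum _ _ hD hZ')
  · rw [← minimalUnitization_of_not_isUnital h]
    exact hd.hasDimLE_minimalUnitization D hD

/-- The infimum is attained: if `k` is not admissible, then by monotonicity no `j ≤ k` is, and the
infimum is at least `k + 1`. -/
theorem approxExtension_le_iff {k : ℕ} {A : CStarAlg.{u}} :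
    approxExtension C d A ≤ k ↔ ApproxBy (HasDimLE C d k) A := by
  constructor
  · intro h
    by_contra hk
    have : ((k + 1 : ℕ) : ℕ∞) ≤ approxExtension C d A := by
      refine le_iInf₂ fun j hj => ?_
      by_contra hjk
      have hjk : j ≤ k := by
        rw [Nat.cast_le] at hjk; omega
      refine hk (ApproxBy.mono (P := HasDimLE C d j) (fun D hD => ⟨hD.1, hD.2.trans ?_⟩)
        (Approximates.approxBy hj fun B hB => hB))
      exact_mod_cast hjk
    have := this.trans h
    rw [Nat.cast_le] at this
    omega
  · intro h
    exact iInf₂_le k (h.approximates hd.hasDimLE_iso)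

theorem approxExtension_le_of {A B : CStarAlg.{u}}
    (h : ∀ k, ApproxBy (HasDimLE C d k) B → ApproxBy (HasDimLE C d k) A) :
    approxExtension C d A ≤ approxExtension C d B := by
  by_cases hB : approxExtension C d B = ⊤
  · rw [hB]; exact le_top
  · obtain ⟨k, hk⟩ := ENat.ne_top_iff_exists.1 hB
    rw [← hk, hd.approxExtension_le_iff]
    exact h k (hd.approxExtension_le_iff.1 hk.ge)

/-- A finite subset of an approximant generates a separable subalgebra, which (D6) for `d` enlarges
to a separable member of `C` without raising `d`. -/
theorem approxBy_separable {k : ℕ} {A : CStarAlg.{u}} (hA : ApproxBy (HasDimLE C d k) A) :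
    ApproxBy (fun D => D.IsSeparable ∧ HasDimLE C d k D) A := by
  classical
  refine ApproxBy.trans (hA.mono fun D hD F ε hε => ?_)
  obtain ⟨B, hFB, hB⟩ := exists_separable_sub F
  obtain ⟨E, hE, hEs, hBE, hdE⟩ := hd.separable D hD.1 B hB
  exact ⟨E.toCStarAlg, E.incl, E.incl_injective, ⟨hEs, hE, hdE.trans hD.2⟩, fun x hx =>
    ⟨⟨x, hBE (hFB hx)⟩, by change ‖x - x‖ < ε; simpa using hε⟩⟩

/-- `A` approximates itself, which bounds the extension by `d A`; the converse inequality is (D5)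
for `d`. -/
theorem approxExtension_eq {A : CStarAlg.{u}} (hA : A ∈ C) : approxExtension C d A = d A := by
  refine le_antisymm ?_ ?_
  · by_cases h : d A = ⊤
    · rw [h]; exact le_top
    · obtain ⟨k, hk⟩ := ENat.ne_top_iff_exists.1 h
      rw [← hk, hd.approxExtension_le_iff]
      exact ApproxBy.of_self ⟨hA, hk.ge⟩
  · by_cases h : approxExtension C d A = ⊤
    · rw [h]; exact le_top
    · obtain ⟨k, hk⟩ := ENat.ne_top_iff_exists.1 h
      rw [← hk]
      exact hd.approx A hA k _ (fun B hB => hB)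
        ((hd.approxExtension_le_iff.1 hk.ge).approximates hd.hasDimLE_iso)

theorem isDimensionTheory_approxExtension :
    IsDimensionTheory Set.univ (approxExtension C d) where
  iso_mem _ _ _ _ := trivial
  ideal_mem _ _ _ _ := trivial
  quotient_mem _ _ _ _ := trivial
  directSum_mem _ _ _ _ := trivial
  minimalUnitization_mem _ _ := trivial
  iso A _ B _ h := le_antisymm (hd.approxExtension_le_of fun k hk => hk.iso h.symm)
    (hd.approxExtension_le_of fun k hk => hk.iso h)
  ideal A _ J hJ := hd.approxExtension_le_of fun k hk => hk.ideal hd.hasDimLE_ideal hJ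
  quotient A _ B h := hd.approxExtension_le_of fun k hk => hk.quotient hd.hasDimLE_quotient h
  directSum A _ B _ := by
    refine le_antisymm ?_ (max_le ?_ ?_)
    · by_cases h : max (approxExtension C d A) (approxExtension C d B) = ⊤
      · rw [h]; exact le_top
      · obtain ⟨k, hk⟩ := ENat.ne_top_iff_exists.1 h
        rw [← hk, hd.approxExtension_le_iff]
        exact (hd.approxExtension_le_iff.1 ((le_max_left _ _).trans hk.ge)).directSum
          hd.hasDimLE_directSum (hd.approxExtension_le_iff.1 ((le_max_right _ _).trans hk.ge))
    · exact hd.approxExtension_le_of fun k hk => hk.quotient hd.hasDimLE_quotient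
        ⟨NonUnitalStarAlgHom.fst ℂ A B, fun x => ⟨(x, 0), rfl⟩⟩
    · exact hd.approxExtension_le_of fun k hk => hk.quotient hd.hasDimLE_quotient
        ⟨NonUnitalStarAlgHom.snd ℂ A B, fun x => ⟨(0, x), rfl⟩⟩
  minimalUnitization A _ := by
    by_cases h : A.IsUnital
    · rw [minimalUnitization_of_isUnital h]
    · rw [minimalUnitization_of_not_isUnital h]
      -- Approximants of a nonunital `A` may be unital, so the full unitization of each of them is
      -- needed. Conversely `A` is an ideal of its unitization.
      refine le_antisymm
        (hd.approxExtension_le_of fun k hk => hk.unitization hd.hasDimLE_unitization)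
        (hd.approxExtension_le_of fun k hk => ?_)
      let ι : A →⋆ₙₐ[ℂ] A.unitization := Unitization.inrNonUnitalStarAlgHom ℂ A
      have hι : (Sub.range ι).IsIdeal := by
        rintro (a : Unitization ℂ A) _ ⟨x, rfl⟩
        refine ⟨⟨a.fst • x + a.snd * x, ?_⟩, ⟨a.fst • x + x * a.snd, ?_⟩⟩
        · change ((a.fst • x + a.snd * x : A) : Unitization ℂ A) = a * (x : Unitization ℂ A)
          refine Unitization.ext ?_ ?_ <;> simp
        · change ((a.fst • x + x * a.snd : A) : Unitization ℂ A) = (x : Unitization ℂ A) * a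
          refine Unitization.ext ?_ ?_ <;> simp
      exact (hk.ideal hd.hasDimLE_ideal hι).iso
        (Sub.iso_range ι Unitization.inr_injective).symm
  approx A _ n S hS hA := by
    rw [hd.approxExtension_le_iff]
    exact ApproxBy.trans (Approximates.approxBy hA fun B hB =>
      hd.approxExtension_le_iff.1 (hS B hB).2)
  separable A _ B hB := by
    by_cases h : approxExtension C d A = ⊤
    · exact ⟨B, trivial, hB, subset_rfl, by rw [h]; exact le_top⟩
    · obtain ⟨k, hk⟩ := ENat.ne_top_iff_exists.1 h
      obtain ⟨D, hD, hBD, hD'⟩ := ApproxBy.exists_separable (fun D hD => hD.1)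
        (hd.approxBy_separable (hd.approxExtension_le_iff.1 hk.ge)) B hB
      refine ⟨D, trivial, hD, hBD, ?_⟩
      rw [← hk, hd.approxExtension_le_iff]
      exact hD'.mono fun E hE => hE.2

end IsDimensionTheory

end Extension

end

noncomputable section

open Filter Topology

/-! ### Matrix units in the stabilization -/

section MatrixUnits

attribute [local instance] CStarAlgebra.spectralOrder CStarAlgebra.spectralOrderedRing

namespace MatrixLimit

variable {A B : Type u} [NonUnitalCStarAlgebra A] [NonUnitalCStarAlgebra B]

theorem mk_cornerEmbedding {m n : ℕ} (h : m ≤ n) (M : CStarMatrix (Fin m) (Fin m) A) :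
    mk n (cornerEmbedding A m n h M) = mk m M :=
  (DirectLimit.eq_of_le (f := cornerEmbedding A)
    (⟨m, M⟩ : Σ k : ℕ, CStarMatrix (Fin k) (Fin k) A) n h).symm

/-- The `n × n`-matrix with `a` at the place `(i, j)` and zeros elsewhere. -/
def single (n i j : ℕ) (a : A) : CStarMatrix (Fin n) (Fin n) A := fun p q =>
  if (p : ℕ) = i ∧ (q : ℕ) = j then a else 0

theorem single_apply (n i j : ℕ) (a : A) (p q : Fin n) :
    single n i j a p q = if (p : ℕ) = i ∧ (q : ℕ) = j then a else 0 := rfl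

theorem cornerEmbedding_single {m n : ℕ} (h : m ≤ n) {i j : ℕ} (hi : i < m) (hj : j < m) (a : A) :
    cornerEmbedding A m n h (single m i j a) = single n i j a := by
  ext p q
  simp only [cornerEmbedding_apply, single_apply]
  split_ifs <;> first | rfl | omega

theorem single_mul_single {n j k : ℕ} (hj : j < n) (i l : ℕ) (a b : A) :
    single n i j a * single n k l b = if j = k then single n i l (a * b) else 0 := by
  ext p q
  rw [CStarMatrix.mul_apply, Finset.sum_eq_single ⟨j, hj⟩]
  · simp only [single_apply]
    split_ifs with h1 h2 h3 h4 h5 <;> simp_all [single_apply]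
  · intro r _ hr
    have : (r : ℕ) ≠ j := fun h => hr (Fin.ext h)
    simp [single_apply, this]
  · simp

theorem star_single (n i j : ℕ) (a : A) : star (single n i j a) = single n j i (star a) := by
  ext p q
  rw [CStarMatrix.star_eq_conjTranspose, CStarMatrix.conjTranspose_apply]
  simp only [single_apply, and_comm]
  split_ifs
  · rfl
  · exact star_zero _

/-- The elementary matrix with `a` at the place `(i, j)`. -/
def unit (i j : ℕ) : A →ₗ[ℂ] MatrixLimit A where
  toFun a := mk (max i j + 1) (single _ i j a)
  map_add' a b := by
    rw [mk_add]
    congr 1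
    ext p q
    simp only [single_apply, CStarMatrix.add_apply]
    split_ifs <;> simp
  map_smul' c a := by
    rw [RingHom.id_apply, mk_smul]
    congr 1
    ext p q
    simp only [single_apply, CStarMatrix.smul_apply]
    split_ifs <;> simp

theorem unit_eq {n i j : ℕ} (hi : i < n) (hj : j < n) (a : A) :
    unit i j a = mk n (single n i j a) := by
  have h : max i j + 1 ≤ n := by omega
  rw [← cornerEmbedding_single h (by omega) (by omega), mk_cornerEmbedding]
  rfl

theorem unit_mul_unit (i j k l : ℕ) (a b : A) :
    unit i j a * unit k l b = if j = k then unit i l (a * b) else 0 := by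
  have h : ∃ n, i < n ∧ j < n ∧ k < n ∧ l < n := ⟨i + j + k + l + 1, by omega⟩
  obtain ⟨n, hi, hj, hk, hl⟩ := h
  rw [unit_eq hi hj, unit_eq hk hl, unit_eq hi hl, mk_mul, single_mul_single hj]
  split_ifs
  · rfl
  · exact mk_zero n

theorem star_unit (i j : ℕ) (a : A) : star (unit i j a) = unit j i (star a) := by
  have h : ∃ n, i < n ∧ j < n := ⟨i + j + 1, by omega⟩
  obtain ⟨n, hi, hj⟩ := h
  rw [unit_eq hi hj, unit_eq hj hi, mk_star, star_single]

theorem mk_eq_sum (n : ℕ) (M : CStarMatrix (Fin n) (Fin n) A) :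
    mk n M = ∑ p : Fin n, ∑ q : Fin n, unit (p : ℕ) (q : ℕ) (M p q) := by
  have h : M = ∑ p : Fin n, ∑ q : Fin n, single n p q (M p q) := by
    ext p q
    let ev : CStarMatrix (Fin n) (Fin n) A →+ A :=
      { toFun := fun N => N p q, map_zero' := rfl, map_add' := fun _ _ => rfl }
    change M p q = ev (∑ p' : Fin n, ∑ q' : Fin n, single n p' q' (M p' q'))
    rw [map_sum, Finset.sum_eq_single p, map_sum, Finset.sum_eq_single q]
    · exact (if_pos ⟨rfl, rfl⟩).symm
    · exact fun q' _ h => if_neg fun h' => h (Fin.ext h'.2.symm)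
    · simp
    · intro p' _ h
      rw [map_sum]
      exact Finset.sum_eq_zero fun q' _ => if_neg fun h' => h (Fin.ext h'.1.symm)
    · simp
  let φ : CStarMatrix (Fin n) (Fin n) A →+ MatrixLimit A :=
    { toFun := mk n, map_zero' := mk_zero n, map_add' := fun x y => (mk_add n x y).symm }
  have h2 : mk n M = φ (∑ p : Fin n, ∑ q : Fin n, single n p q (M p q)) := congrArg φ h
  rw [h2, map_sum]
  refine Finset.sum_congr rfl fun p _ => ?_
  rw [map_sum]
  exact Finset.sum_congr rfl fun q _ => (unit_eq p.2 q.2 _).symm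

theorem unit_injective (i j : ℕ) : Function.Injective (unit i j : A →ₗ[ℂ] MatrixLimit A) := by
  intro a b h
  have h1 := mk_injective _ h
  have h2 := congrFun (congrFun h1 ⟨i, by omega⟩) ⟨j, by omega⟩
  simpa [single_apply] using h2

/-- The map of matrix algebras induced by a `*`-homomorphism. -/
def map (f : A →⋆ₙₐ[ℂ] B) : MatrixLimit A →⋆ₙₐ[ℂ] MatrixLimit B where
  toFun := DirectLimit.lift (cornerEmbedding A) (fun n M => mk n (CStarMatrix.mapₙₐ f M))
    fun m n h M => by
      rw [← mk_cornerEmbedding h]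
      congr 1
      ext p q
      simp only [CStarMatrix.mapₙₐ_apply, CStarMatrix.mapₗ_apply, CStarMatrix.map_apply,
        cornerEmbedding_apply]
      split_ifs <;> simp
  map_smul' c := induction fun n M => by
    rw [mk_smul]
    change mk n _ = c • mk n _
    rw [mk_smul, map_smul]
  map_zero' := by
    rw [← mk_zero 0]
    change mk 0 _ = _
    rw [map_zero, mk_zero]
  map_add' := induction₂ fun n M N => by
    rw [mk_add]
    change mk n _ = mk n _ + mk n _
    rw [map_add, mk_add]
  map_mul' := induction₂ fun n M N => by
    rw [mk_mul]
    change mk n _ = mk n _ * mk n _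
    rw [map_mul, mk_mul]
  map_star' := induction fun n M => by
    rw [mk_star]
    change mk n _ = star (mk n _)
    rw [map_star, mk_star]

theorem map_mk (f : A →⋆ₙₐ[ℂ] B) (n : ℕ) (M : CStarMatrix (Fin n) (Fin n) A) :
    map f (mk n M) = mk n (CStarMatrix.mapₙₐ f M) := rfl

theorem map_unit (f : A →⋆ₙₐ[ℂ] B) (i j : ℕ) (a : A) : map f (unit i j a) = unit i j (f a) := by
  change map f (mk _ _) = mk _ _
  rw [map_mk]
  congr 1
  ext p q
  simp only [CStarMatrix.mapₙₐ_apply, CStarMatrix.mapₗ_apply, CStarMatrix.map_apply, single_apply]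
  split_ifs <;> simp

theorem norm_map (f : A →⋆ₙₐ[ℂ] B) (hf : Function.Injective f) (x : MatrixLimit A) :
    ‖map f x‖ = ‖x‖ := by
  refine induction (p := fun x => ‖map f x‖ = ‖x‖) (fun n M => ?_) x
  rw [map_mk, norm_mk, norm_mk]
  refine NonUnitalStarAlgHom.norm_map _ (fun M N h => ?_) M
  ext p q
  have := congrFun (congrFun h p) q
  simp only [CStarMatrix.mapₙₐ_apply, CStarMatrix.mapₗ_apply, CStarMatrix.map_apply] at this
  exact hf this

end MatrixLimit

end MatrixUnits

/-! ### Extension to completions -/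

section CompletionMap

variable {E F : Type u} [NonUnitalNormedRing E] [StarRing E] [CStarRing E] [NormedSpace ℂ E]
  [IsScalarTower ℂ E E] [SMulCommClass ℂ E E] [StarModule ℂ E]
  [NonUnitalNormedRing F] [StarRing F] [CStarRing F] [NormedSpace ℂ F]
  [IsScalarTower ℂ F F] [SMulCommClass ℂ F F] [StarModule ℂ F]

namespace CStarCompletion

/-- The canonical map into the completion, as a `*`-homomorphism. -/
def ofHom : E →⋆ₙₐ[ℂ] CStarCompletion E where
  toFun := of
  map_smul' := of_smul
  map_zero' := of_zero
  map_add' := of_add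
  map_mul' := of_mul
  map_star' := of_star

theorem ofHom_apply (x : E) : ofHom x = of x := rfl

theorem denseRange_ofHom : DenseRange (ofHom : E →⋆ₙₐ[ℂ] CStarCompletion E) :=
  UniformSpace.Completion.denseRange_coe

theorem norm_ofHom (x : E) : ‖(ofHom x : CStarCompletion E)‖ = ‖x‖ := norm_of x

/-- An isometric `*`-homomorphism extends to the completions. -/
theorem exists_extension (f : E →⋆ₙₐ[ℂ] F) (hf : ∀ x, ‖f x‖ = ‖x‖) :
    ∃ g : CStarCompletion E →⋆ₙₐ[ℂ] CStarCompletion F, Function.Injective g ∧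
      ∀ x, g (ofHom x) = ofHom (f x) := by
  let L : E →ₗ[ℂ] CStarCompletion F :=
    { toFun := fun x => ofHom (f x)
      map_add' := fun x y => by rw [map_add, map_add]
      map_smul' := fun c x => by rw [map_smul, map_smul]; rfl }
  let e : E →ₗ[ℂ] CStarCompletion E :=
    { toFun := fun x => ofHom x
      map_add' := fun x y => by rw [map_add]
      map_smul' := fun c x => by rw [map_smul]; rfl }
  have hd : DenseRange e := denseRange_ofHom
  have hn : ∀ x, ‖L x‖ ≤ 1 * ‖e x‖ := fun x => by
    change ‖ofHom (f x)‖ ≤ 1 * ‖ofHom x‖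
    rw [norm_ofHom, norm_ofHom, hf, one_mul]
  let G := L.extendOfNorm e
  have hG : ∀ x, G (ofHom x) = ofHom (f x) := LinearMap.extendOfNorm_eq hd ⟨1, hn⟩
  have hnorm : ∀ x, ‖G x‖ = ‖x‖ := fun x =>
    induction (p := fun x => ‖G x‖ = ‖x‖) (isClosed_eq (by fun_prop) (by fun_prop))
      (fun y => by
        change ‖G (ofHom y)‖ = ‖ofHom y‖
        rw [hG, norm_ofHom, norm_ofHom, hf]) x
  refine ⟨{ toFun := G
            map_smul' := map_smul G
            map_zero' := map_zero G
            map_add' := map_add G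
            map_mul' := fun x y => ?_
            map_star' := fun x => ?_ }, ?_, hG⟩
  · refine induction₂ (p := fun x y => G (x * y) = G x * G y)
      (isClosed_eq (by fun_prop) (by fun_prop)) (fun v w => ?_) x y
    change G (ofHom v * ofHom w) = G (ofHom v) * G (ofHom w)
    rw [← map_mul, hG, hG, hG, map_mul, map_mul]
  · refine induction (p := fun x => G (star x) = star (G x))
      (isClosed_eq (G.continuous.comp continuous_star') (continuous_star'.comp G.continuous))
      (fun v => ?_) x
    change G (star (ofHom v)) = star (G (ofHom v))
    rw [← map_star, hG, hG, map_star, map_star]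
  · intro x y hxy
    have h1 : G x = G y := hxy
    rw [← sub_eq_zero, ← map_sub, ← norm_eq_zero, hnorm, norm_eq_zero, sub_eq_zero] at h1
    exact h1

end CStarCompletion

end CompletionMap

namespace CStarAlg

/-! ### Matrix units in `A ⊗ 𝕂` and functoriality -/

/-- The element `a ⊗ e_{ij}` of `A ⊗ 𝕂`. -/
def stabUnit (A : CStarAlg.{u}) (i j : ℕ) : A →ₗ[ℂ] A.stabilization :=
  { toFun := fun a => CStarCompletion.ofHom (MatrixLimit.unit i j a)
    map_add' := fun a b => by rw [map_add, map_add]; rfl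
    map_smul' := fun c a => by rw [map_smul, map_smul]; rfl }

section

variable {A B : CStarAlg.{u}}

theorem stabUnit_mul_stabUnit (i j k l : ℕ) (a b : A) :
    A.stabUnit i j a * A.stabUnit k l b = if j = k then A.stabUnit i l (a * b) else 0 := by
  change (CStarCompletion.ofHom (MatrixLimit.unit i j a) *
    CStarCompletion.ofHom (MatrixLimit.unit k l b) : CStarCompletion (MatrixLimit A)) = _
  rw [← map_mul, MatrixLimit.unit_mul_unit]
  split_ifs
  · rfl
  · exact map_zero _

theorem stabUnit_mul_same (i j l : ℕ) (a b : A) :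
    A.stabUnit i j a * A.stabUnit j l b = A.stabUnit i l (a * b) := by
  rw [stabUnit_mul_stabUnit, if_pos rfl]

theorem stabUnit_mul_of_ne {i j k l : ℕ} (h : j ≠ k) (a b : A) :
    A.stabUnit i j a * A.stabUnit k l b = 0 := by
  rw [stabUnit_mul_stabUnit, if_neg h]

theorem star_stabUnit (i j : ℕ) (a : A) :
    star (A.stabUnit i j a) = A.stabUnit j i (star a) := by
  change star (CStarCompletion.ofHom (MatrixLimit.unit i j a) : CStarCompletion (MatrixLimit A)) = _
  rw [← map_star, MatrixLimit.star_unit]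
  rfl

theorem stabUnit_injective (i j : ℕ) : Function.Injective (A.stabUnit i j) := by
  intro a b h
  refine MatrixLimit.unit_injective i j ?_
  have h1 : ‖MatrixLimit.unit i j a - MatrixLimit.unit i j b‖ = 0 := by
    rw [← CStarCompletion.norm_ofHom, map_sub, norm_eq_zero, sub_eq_zero]
    exact h
  exact sub_eq_zero.1 (norm_eq_zero.1 h1)

/-- The embedding of `A` into `A ⊗ 𝕂` as the corner `(i, i)`. -/
def stabCorner (A : CStarAlg.{u}) (i : ℕ) : A →⋆ₙₐ[ℂ] A.stabilization where
  toFun := A.stabUnit i i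
  map_smul' := map_smul _
  map_zero' := map_zero _
  map_add' := map_add _
  map_mul' a b := (stabUnit_mul_same i i i a b).symm
  map_star' a := (star_stabUnit i i a).symm

theorem stabCorner_apply (i : ℕ) (a : A) : A.stabCorner i a = A.stabUnit i i a := rfl

theorem norm_stabUnit_le (i j : ℕ) (a : A) : ‖A.stabUnit i j a‖ ≤ ‖a‖ := by
  have h : ‖A.stabUnit i j a‖ * ‖A.stabUnit i j a‖ ≤ ‖a‖ * ‖a‖ := by
    rw [← CStarRing.norm_self_mul_star, ← CStarRing.norm_self_mul_star, star_stabUnit,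
      stabUnit_mul_same]
    exact NonUnitalStarAlgHom.norm_apply_le (A.stabCorner i) _
  exact (mul_self_le_mul_self_iff (norm_nonneg _) (norm_nonneg _)).2 h

theorem continuous_stabUnit (i j : ℕ) : Continuous (A.stabUnit i j) :=
  AddMonoidHomClass.continuous_of_bound _ 1 fun a => by simpa using norm_stabUnit_le i j a

theorem cspan_stabUnit (x : A.stabilization) :
    x ∈ cspan {x : A.stabilization | ∃ i j a, x = A.stabUnit i j a} := by
  refine CStarCompletion.induction (E := MatrixLimit A)
    (p := fun x : CStarCompletion (MatrixLimit A) => x ∈ cspan (A := A.stabilization)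
      {x : A.stabilization | ∃ i j a, x = A.stabUnit i j a})
    (isClosed_cspan _) (fun y => ?_) x
  refine MatrixLimit.induction (p := fun y => (CStarCompletion.of y : A.stabilization) ∈
    cspan (A := A.stabilization)
      {x : A.stabilization | ∃ i j a, x = A.stabUnit i j a}) (fun n M => ?_) y
  have h : (CStarCompletion.of (MatrixLimit.mk n M) : CStarCompletion (MatrixLimit A)) =
      ∑ p : Fin n, ∑ q : Fin n, A.stabUnit (p : ℕ) (q : ℕ) (M p q) := by
    rw [MatrixLimit.mk_eq_sum, ← CStarCompletion.ofHom_apply, map_sum]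
    refine Finset.sum_congr rfl fun p _ => ?_
    rw [map_sum]
    rfl
  have h2 : ∑ p : Fin n, ∑ q : Fin n, A.stabUnit (p : ℕ) (q : ℕ) (M p q) ∈
      cspan {x : A.stabilization | ∃ i j a, x = A.stabUnit i j a} :=
    sum_mem fun p _ => sum_mem fun q _ => subset_cspan ⟨_, _, _, rfl⟩
  exact h ▸ h2

/-- An injective `*`-homomorphism induces one of the stabilizations. -/
theorem exists_stabMap (f : A →⋆ₙₐ[ℂ] B) (hf : Function.Injective f) :
    ∃ g : A.stabilization →⋆ₙₐ[ℂ] B.stabilization, Function.Injective g ∧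
      ∀ i j a, g (A.stabUnit i j a) = B.stabUnit i j (f a) := by
  obtain ⟨g, hg, hgf⟩ := CStarCompletion.exists_extension (MatrixLimit.map f)
    (MatrixLimit.norm_map f hf)
  refine ⟨g, hg, fun i j a => ?_⟩
  exact (hgf _).trans (congrArg _ (MatrixLimit.map_unit f i j a))

end

end CStarAlg

end

noncomputable section

open Filter Topology

attribute [local instance] CStarAlgebra.spectralOrder CStarAlgebra.spectralOrderedRing

/-! ### Stable isomorphism of full corners -/

section RightIdeal

variable {A : Type*} [NonUnitalCStarAlgebra A]

/-- The closed right ideal `closure (z A)`. -/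
def closedRightIdeal (z : A) : Submodule ℂ A :=
  (LinearMap.range (LinearMap.mulLeft ℂ z)).topologicalClosure

theorem isClosed_closedRightIdeal (z : A) : IsClosed (closedRightIdeal z : Set A) :=
  isClosed_closure

theorem mul_mem_closedRightIdeal (z x : A) : z * x ∈ closedRightIdeal z :=
  subset_closure ⟨x, rfl⟩

/-- This is the factorization lemma for `q q* ≤ q²`. It permits arguments to produce only `q² a`
where `q a` is wanted. -/
theorem IsSelfAdjoint.mem_closure_mul_mul {q : A} (hq : IsSelfAdjoint q) :
    q ∈ closure (Set.range fun x => q * (q * x)) := by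
  have h : q * star q ≤ q * q := by rw [hq.star_eq]
  refine closure_mono ?_ (mem_closure_mul_of_mul_star_le h)
  rintro _ ⟨y, rfl⟩
  exact ⟨y, by simp [mul_assoc]⟩

theorem IsSelfAdjoint.map_mul_mem {B : Type*} [NonUnitalCStarAlgebra B] {q : A}
    (hq : IsSelfAdjoint q) {M : Submodule ℂ B} (hM : IsClosed (M : Set B)) (f : A →ₗ[ℂ] B)
    (hf : Continuous f) (h : ∀ a, f (q * (q * a)) ∈ M) (a : A) : f (q * a) ∈ M := by
  have h1 : f (q * a) ∈ closure (M : Set B) := by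
    refine map_mem_closure (f := fun x => f (x * a)) (by fun_prop) hq.mem_closure_mul_mul ?_
    rintro _ ⟨x, rfl⟩
    simpa only [mul_assoc, SetLike.mem_coe] using h (x * a)
  rwa [hM.closure_eq] at h1

end RightIdeal

namespace CStarAlg

variable {A : CStarAlg.{u}}

theorem exists_weighted_sum {S : Type*} [NonUnitalCStarAlgebra S] (t : ℕ → S) :
    ∃ (c : ℕ → ℂ) (T : S), (∀ n, c n ≠ 0) ∧ HasSum (fun n => c n • t n) T := by
  let c : ℕ → ℝ := fun n => (1 / 2) ^ n / (1 + ‖t n‖)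
  have hc : ∀ n, 0 < c n := fun n => by positivity
  have hs : Summable fun n => (c n : ℂ) • t n := by
    refine Summable.of_norm_bounded summable_geometric_two fun n => ?_
    rw [norm_smul, Complex.norm_of_nonneg (hc n).le, div_mul_eq_mul_div,
      div_le_iff₀ (by positivity)]
    gcongr
    linarith
  exact ⟨fun n => c n, _, fun n => Complex.ofReal_ne_zero.2 (hc n).ne', hs.hasSum⟩

/-- The core of the stable isomorphism theorem. The column `n` of `T` has an element of `p A q` in a
row `α i` and a small multiple of `q²` in row `β n`. Isolating columns by right multiplication shows
that `T` generates `p` in all rows `α i` and `q` in all rows `β i`; isolating the rows `β n` by left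
multiplication shows that `T*` generates `q` in all rows. -/
theorem exists_stab_generator (hA : A.IsSeparable) {p q : A} (hp : IsSelfAdjoint p)
    (hq : IsSelfAdjoint q) (hpq : p ∈ cspan {x : A | ∃ a b, x = a * q * b}) {α β : ℕ → ℕ}
    (hβ : Function.Injective β) (hαβ : ∀ i j, α i ≠ β j) :
    ∃ T : A.stabilization,
      T ∈ cspan {x : A.stabilization | ∃ i j a,
        x = A.stabUnit (α i) j (p * a) ∨ x = A.stabUnit (β i) j (q * a)} ∧
      (∀ i j a, A.stabUnit (α i) j (p * a) ∈ closedRightIdeal T) ∧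
      (∀ i j a, A.stabUnit (β i) j (q * a) ∈ closedRightIdeal T) ∧
      star T ∈ cspan {x : A.stabilization | ∃ i j a, x = A.stabUnit i j (q * a)} ∧
      ∀ i j a, A.stabUnit i j (q * a) ∈ closedRightIdeal (star T) := by
  have : TopologicalSpace.SeparableSpace A := hA
  obtain ⟨x, hx⟩ := TopologicalSpace.exists_dense_seq A
  -- The index `n` codes `((i, k), m)`, so each pair of a row `α i` and a dense element `x k` occurs
  -- in infinitely many columns.
  let idx : ℕ → ℕ := fun n => n.unpair.1.unpair.1
  let y : ℕ → A := fun n => p * x n.unpair.1.unpair.2 * q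
  -- The factor `(1 / 2) ^ n` makes the `β`-entry small relative to the `α`-entry of the same
  -- column. The weights `c n` introduced next only secure convergence and scale whole columns, so
  -- they could not do this.
  let t : ℕ → A.stabilization := fun n =>
    A.stabUnit (α (idx n)) n (y n) + (1 / 2 : ℂ) ^ n • A.stabUnit (β n) n (q * q)
  obtain ⟨c, T, hc, hT⟩ := exists_weighted_sum t
  have hmem : ∀ M : Submodule ℂ A.stabilization, IsClosed (M : Set A.stabilization) →
      (∀ n, t n ∈ M) → T ∈ M := fun M hM h =>
    hM.mem_of_tendsto hT (Eventually.of_forall fun F => sum_mem fun n _ => M.smul_mem _ (h n))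
  have htR : ∀ n j a, t n * A.stabUnit n j a =
      A.stabUnit (α (idx n)) j (y n * a) +
        (1 / 2 : ℂ) ^ n • A.stabUnit (β n) j (q * (q * a)) := fun n j a => by
    simp only [t, add_mul, smul_mul_assoc, stabUnit_mul_same, mul_assoc]
  have hTR : ∀ n j a, T * A.stabUnit n j a = c n • (t n * A.stabUnit n j a) := fun n j a => by
    have h1 := hT.mul_right (A.stabUnit n j a)
    have h2 := hasSum_single (f := fun m => c m • t m * A.stabUnit n j a) n fun m hm => by
      simp only [t, add_mul, smul_mul_assoc, stabUnit_mul_of_ne hm, smul_zero, add_zero]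
    rw [h1.unique h2, smul_mul_assoc]
  -- Row `β n` has a single entry, because `β` is injective and its range avoids that of `α`.
  have hTL : ∀ n j a, A.stabUnit j (β n) a * T =
      c n • (1 / 2 : ℂ) ^ n • A.stabUnit j n (a * (q * q)) := fun n j a => by
    have h1 := hT.mul_left (A.stabUnit j (β n) a)
    have h2 := hasSum_single (f := fun m => A.stabUnit j (β n) a * c m • t m) n fun m hm => by
      simp only [t, mul_add, mul_smul_comm, stabUnit_mul_of_ne (hαβ _ _).symm,
        stabUnit_mul_of_ne (hβ.ne hm.symm), smul_zero, add_zero]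
    rw [h1.unique h2]
    simp only [t, mul_add, mul_smul_comm, stabUnit_mul_of_ne (hαβ _ _).symm, stabUnit_mul_same,
      zero_add]
  have ht : ∀ n j a, t n * A.stabUnit n j a ∈ closedRightIdeal T := fun n j a => by
    have h := (closedRightIdeal T).smul_mem (c n)⁻¹ (mul_mem_closedRightIdeal T (A.stabUnit n j a))
    rwa [hTR, inv_smul_smul₀ (hc n)] at h
  have h1 : ∀ i j b a, A.stabUnit (α i) j (p * b * q * a) ∈ closedRightIdeal T := by
    intro i j b a
    refine hx.induction_on (p := fun b => A.stabUnit (α i) j (p * b * q * a) ∈ closedRightIdeal T)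
      b ((isClosed_closedRightIdeal T).preimage ((continuous_stabUnit _ _).comp (by fun_prop)))
      fun k => ?_
    -- Along the columns carrying `(i, k)` the `β`-entry tends to zero, which leaves the `α`-entry
    -- alone in the closed right ideal of `T`. Subtracting it afterwards releases the `β`-entries.
    let N : ℕ → ℕ := fun m => Nat.pair (Nat.pair i k) m
    have hN : Tendsto N atTop atTop := tendsto_atTop_mono (fun m => Nat.right_le_pair _ _) tendsto_id
    have h0 : Tendsto (fun m => (1 / 2 : ℂ) ^ N m • A.stabUnit (β (N m)) j (q * (q * a))) atTop
        (𝓝 0) := by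
      refine squeeze_zero_norm (a := fun m => (1 / 2 : ℝ) ^ N m * ‖q * (q * a)‖) (fun m => ?_) ?_
      · rw [norm_smul]
        refine mul_le_mul ?_ (norm_stabUnit_le _ _ _) (norm_nonneg _) (by positivity)
        simp
      · have := ((tendsto_pow_atTop_nhds_zero_of_lt_one (r := (1 / 2 : ℝ)) (by norm_num)
          (by norm_num)).comp hN).mul_const ‖q * (q * a)‖
        simpa using this
    have h2 := h0.const_add (A.stabUnit (α i) j (p * x k * q * a))
    rw [add_zero] at h2
    refine (isClosed_closedRightIdeal T).mem_of_tendsto h2 (Eventually.of_forall fun m => ?_)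
    have h3 := ht (N m) j a
    rw [htR] at h3
    simpa only [idx, y, N, Nat.unpair_pair, SetLike.mem_coe] using h3
  have h2 : ∀ n j a, A.stabUnit (β n) j (q * (q * a)) ∈ closedRightIdeal T := fun n j a => by
    have h3 := ht n j a
    rw [htR] at h3
    have h4 := ((closedRightIdeal T).add_mem_iff_right (h1 _ _ _ _)).1 h3
    exact ((closedRightIdeal T).smul_mem_iff (by simp)).1 h4
  refine ⟨T, ?_, fun i j => ?_, fun i j => ?_, ?_, fun i j => ?_⟩
  · refine hmem _ (isClosed_cspan _) fun n => add_mem (subset_cspan ⟨idx n, n,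
      x n.unpair.1.unpair.2 * q, Or.inl ?_⟩)
      (Submodule.smul_mem _ _ (subset_cspan ⟨n, n, q, Or.inr rfl⟩))
    simp only [y, mul_assoc]
  · refine hp.map_mul_mem (isClosed_closedRightIdeal T) _ (continuous_stabUnit _ _) fun a => ?_
    exact map_mem_of_mem_cspan (isClosed_closedRightIdeal T)
      (A.stabUnit (α i) j ∘ₗ LinearMap.mulLeft ℂ p ∘ₗ LinearMap.mulRight ℂ a)
      ((continuous_stabUnit _ _).comp (continuous_const.mul (continuous_id.mul continuous_const)))
      (by
        rintro _ ⟨b, b', rfl⟩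
        simpa [mul_assoc] using h1 i j b (b' * a)) hpq
  · exact hq.map_mul_mem (isClosed_closedRightIdeal T) _ (continuous_stabUnit _ _) (h2 i j)
  · refine star_mem_cspan (X := {x : A.stabilization | ∃ i j a, x = A.stabUnit i j (a * q)}) ?_
      (hmem _ (isClosed_cspan _) fun n => add_mem (subset_cspan ⟨_, _, _, rfl⟩)
        (Submodule.smul_mem _ _ (subset_cspan ⟨_, _, _, rfl⟩)))
    rintro _ ⟨i, j, a, rfl⟩
    exact ⟨j, i, star a, by rw [star_stabUnit, star_mul, hq.star_eq]⟩
  · refine hq.map_mul_mem (isClosed_closedRightIdeal _) _ (continuous_stabUnit _ _) fun a => ?_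
    have h3 := mul_mem_closedRightIdeal (star T) (A.stabUnit (β i) j a)
    have h4 : star T * A.stabUnit (β i) j a =
        star (c i • (1 / 2 : ℂ) ^ i • A.stabUnit j i (star a * (q * q))) := by
      rw [← hTL, star_mul, star_stabUnit, star_star]
    rw [h4, star_smul, star_smul, star_stabUnit, star_mul, star_star, star_mul, hq.star_eq,
      mul_assoc] at h3
    refine ((closedRightIdeal (star T)).smul_mem_iff ?_).1
      (((closedRightIdeal (star T)).smul_mem_iff ?_).1 h3)
    · simp
    · simpa using hc i

/-- The hereditary subalgebra `closure (z A z*)`. -/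
def Sub.her (z : A) : A.Sub := ⟨_root_.her z, isClosed_her z⟩

/-- Polar decomposition: conjugation by `z` and by `|z|` give isomorphic algebras since `|z|² = z*
z`, and `|z|` generates the same closed right ideal as `z*`. -/
theorem iso_her_star (z : A) : (Sub.her (star z)).toCStarAlg.Iso (Sub.her z).toCStarAlg := by
  obtain ⟨e, -⟩ := exists_her_equiv (star_mul_self_abs z).symm
  have h : Sub.her (star z) = Sub.her (CFC.abs z) := by
    simp only [Sub.her, her_abs]
  rw [h]
  exact ⟨e⟩

/-- If the closed right ideal of `z` consists of the matrices with entries in `closure (q A)`, then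
`closure (z 𝔸 z*)`, where `𝔸 = A ⊗ 𝕂`, is spanned by matrices with entries in `closure (q A q)`;
this is the image of the stabilized inclusion. -/
theorem stabilization_her_iso {q : A} (hq : IsSelfAdjoint q) {z : A.stabilization}
    (h1 : z ∈ cspan {x : A.stabilization | ∃ i j a, x = A.stabUnit i j (q * a)})
    (h2 : ∀ i j a, A.stabUnit i j (q * a) ∈ closedRightIdeal z) :
    (Sub.her q).toCStarAlg.stabilization.Iso (Sub.her z).toCStarAlg := by
  obtain ⟨f, hf, hfu⟩ := exists_stabMap (Sub.her q).incl (Sub.her q).incl_injective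
  refine Sub.iso_of_injective_of_range _ f hf fun y => ⟨fun hy => ?_, ?_⟩
  · have hcl : IsClosed ((Sub.range f).toSet) := (Sub.range f).isClosed
    refine her_subset hcl (fun w => ?_) hy
    have hw := cspan_stabUnit w
    have h3 : z * w ∈ cspan {x : A.stabilization | ∃ i j a, x = A.stabUnit i j (q * a)} := by
      refine mul_mem_of_mem_cspan (isClosed_cspan _) ?_ h1 hw
      rintro _ ⟨i, j, a, rfl⟩ _ ⟨k, l, b, rfl⟩
      rw [stabUnit_mul_stabUnit]
      split_ifs
      · exact subset_cspan ⟨_, _, a * b, by rw [mul_assoc]⟩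
      · exact zero_mem _
    have h4 : star z ∈ cspan {x : A.stabilization | ∃ i j a, x = A.stabUnit i j (a * q)} := by
      refine star_mem_cspan ?_ h1
      rintro _ ⟨i, j, a, rfl⟩
      exact ⟨j, i, star a, by rw [star_stabUnit, star_mul, hq.star_eq]⟩
    refine mul_mem_of_mem_cspan (M := (Sub.range f).toSubalgebra.toSubmodule) hcl ?_ h3 h4
    rintro _ ⟨i, j, a, rfl⟩ _ ⟨k, l, b, rfl⟩
    rw [stabUnit_mul_stabUnit]
    split_ifs
    · have h5 : q * (a * b) * q ∈ (Sub.her q).toSet := by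
        have := conj_mem_her q (a * b)
        rwa [hq.star_eq] at this
      obtain ⟨d, hd⟩ := Sub.exists_incl_eq _ h5
      refine ⟨(Sub.her q).toCStarAlg.stabUnit i l d, ?_⟩
      refine (hfu i l d).trans ?_
      rw [hd]
      simp only [mul_assoc]
    · exact zero_mem _
  · rintro ⟨s, rfl⟩
    refine map_mem_of_mem_cspan (M := (Sub.her z).toSubalgebra.toSubmodule) (Sub.her z).isClosed
      (f : _ →ₗ[ℂ] _) (NonUnitalStarAlgHom.continuous f) ?_ (cspan_stabUnit s)
    rintro _ ⟨i, j, b, rfl⟩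
    change f _ ∈ _root_.her z
    rw [hfu]
    refine her_subset (S := A.stabUnit i j ⁻¹' (_root_.her z : Set A.stabilization))
      ((isClosed_her z).preimage (continuous_stabUnit _ _)) (fun w => ?_) ((Sub.her q).incl_mem b)
    change A.stabUnit i j (q * w * star q) ∈ (_root_.her z : Set A.stabilization)
    rw [← (isClosed_her z).closure_eq]
    refine map_mem_closure (f := fun w => A.stabUnit i j (q * w * star q))
      ((continuous_stabUnit _ _).comp (by fun_prop)) (mem_closure_mul_self w) ?_
    rintro _ ⟨⟨a, b⟩, rfl⟩
    have := mul_mul_star_mem_her (h2 i 0 a) (h2 j 0 (star b)) (A.stabUnit 0 0 w)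
    simpa only [star_stabUnit, stabUnit_mul_same, star_mul, star_star, mul_assoc,
      SetLike.mem_coe] using this

/-- Two elements generating the same ideal of a separable `C*`-algebra generate stably isomorphic
hereditary subalgebras. -/
theorem stablyIso_her (hA : A.IsSeparable) {p q : A} (hp : IsSelfAdjoint p) (hq : IsSelfAdjoint q)
    (hpq : p ∈ cspan {x : A | ∃ a b, x = a * q * b})
    (hqp : q ∈ cspan {x : A | ∃ a b, x = a * p * b}) :
    (Sub.her p).toCStarAlg.StablyIso (Sub.her q).toCStarAlg := by
  have h0 : Function.Injective fun n : ℕ => 2 * n := fun m n h => by simpa using h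
  have h1 : Function.Injective fun n : ℕ => 2 * n + 1 := fun m n h => by simpa using h
  -- Rows are split by parity. Both matrices generate the right ideal with `p` in the even and `q`
  -- in the odd rows, so `T` and `U` have the same hereditary subalgebra.
  obtain ⟨T, hT1, hT2, hT3, hT4, hT5⟩ := exists_stab_generator hA hp hq hpq (α := fun n => 2 * n)
    h1 (fun i j => by omega)
  obtain ⟨U, hU1, hU2, hU3, hU4, hU5⟩ := exists_stab_generator hA hq hp hqp
    (α := fun n => 2 * n + 1) h0 (fun i j => by omega)
  have hTU : Sub.her T = Sub.her U := by
    have : _root_.her T = _root_.her U := by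
      refine le_antisymm (her_le ?_) (her_le ?_)
      · refine cspan_le (isClosed_closedRightIdeal U) ?_ hT1
        rintro _ ⟨i, j, a, rfl | rfl⟩
        exacts [hU3 i j a, hU2 i j a]
      · refine cspan_le (isClosed_closedRightIdeal T) ?_ hU1
        rintro _ ⟨i, j, a, rfl | rfl⟩
        exacts [hT3 i j a, hT2 i j a]
    simp only [Sub.her, this]
  have hq' := (stabilization_her_iso hq hT4 hT5).trans (iso_her_star T)
  have hp' := (stabilization_her_iso hp hU4 hU5).trans (iso_her_star U)
  exact hp'.trans ((hTU ▸ hq').symm)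

end CStarAlg

end

noncomputable section

open Filter Topology

attribute [local instance] CStarAlgebra.spectralOrder CStarAlgebra.spectralOrderedRing

namespace CStarAlg

/-! ### Hereditary embeddings -/

/-- An injective `*`-homomorphism whose image `B` satisfies `B A B ⊆ B`. -/
structure HereditaryEmbedding {A B : CStarAlg.{u}} (i : B →⋆ₙₐ[ℂ] A) : Prop where
  injective : Function.Injective i
  exists_eq : ∀ (b c : B) (a : A), ∃ d, i d = i b * a * i c

/-- The image of `i` generates `A` as an ideal. -/
def IsFullHom {A B : CStarAlg.{u}} (i : B →⋆ₙₐ[ℂ] A) : Prop :=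
  ∀ a : A, a ∈ cspan {x : A | ∃ v b w, x = v * i b * w}

variable {A B : CStarAlg.{u}}

theorem hereditaryEmbedding_incl {S : A.Sub}
    (h : ∀ b ∈ S.toSet, ∀ c ∈ S.toSet, ∀ a : A, b * a * c ∈ S.toSet) :
    HereditaryEmbedding S.incl :=
  ⟨S.incl_injective, fun b c a => S.exists_incl_eq (h _ (S.incl_mem b) _ (S.incl_mem c) a)⟩

theorem hereditaryEmbedding_her (z : A) : HereditaryEmbedding (Sub.her z).incl := by
  refine hereditaryEmbedding_incl fun b hb c hc a => ?_
  have hb' : b ∈ closure (Set.range (z * ·)) := by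
    refine her_subset isClosed_closure (fun w => ?_) hb
    exact subset_closure ⟨w * star z, by simp [mul_assoc]⟩
  have hc' : star c ∈ closure (Set.range (z * ·)) := by
    refine her_subset isClosed_closure (fun w => ?_) ((_root_.her z).star_mem' hc)
    exact subset_closure ⟨w * star z, by simp [mul_assoc]⟩
  have := mul_mul_star_mem_her hb' hc' a
  rwa [star_star] at this

theorem HereditaryEmbedding.isClosed_range {i : B →⋆ₙₐ[ℂ] A} (_hi : HereditaryEmbedding i) :
    IsClosed (Set.range i) := i.isClosed_range

/-- A strictly positive element `q` of the separable algebra `B` generates the image: `i(B)` is the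
closure of `i(q) A i(q)`. -/
theorem HereditaryEmbedding.exists_her (hB : B.IsSeparable) {i : B →⋆ₙₐ[ℂ] A}
    (hi : HereditaryEmbedding i) :
    ∃ q : B, IsSelfAdjoint q ∧ B.Iso (Sub.her (i q)).toCStarAlg ∧
      ∀ b, i b ∈ closedRightIdeal (i q) := by
  have : TopologicalSpace.SeparableSpace B := hB
  obtain ⟨q, hq0, hq⟩ := exists_strictly_positive (A := B)
  have hqs : IsSelfAdjoint q := .of_nonneg hq0
  have hiq : ∀ x, i x ∈ closedRightIdeal (i q) := fun x => by
    refine map_mem_closure i.continuous (hq x) ?_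
    rintro _ ⟨y, rfl⟩
    exact ⟨i y, by simp⟩
  refine ⟨q, hqs, Sub.iso_of_injective_of_range _ i hi.injective fun y => ⟨fun hy => ?_, ?_⟩, hiq⟩
  · refine her_subset hi.isClosed_range (fun w => ?_) hy
    rw [← map_star]
    exact hi.exists_eq _ _ _
  · rintro ⟨x, rfl⟩
    have h1 : i x ∈ closure (_root_.her (i q) : Set A) := by
      refine map_mem_closure i.continuous (mem_closure_mul_self x) ?_
      rintro _ ⟨⟨a, b⟩, rfl⟩
      have := mul_mul_star_mem_her (hiq a) (hiq (star b)) (i x)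
      simpa only [map_star, star_star, map_mul, SetLike.mem_coe] using this
    rwa [(isClosed_her _).closure_eq] at h1

theorem closedRightIdeal_le_cspan (z : A) :
    closedRightIdeal z ≤ cspan {x : A | ∃ v w, x = v * z * w} := by
  refine fun x hx => closure_minimal ?_ (isClosed_cspan _) hx
  rintro _ ⟨y, rfl⟩
  change z * y ∈ (cspan {x : A | ∃ v w, x = v * z * w} : Set A)
  rw [← (isClosed_cspan _).closure_eq]
  refine map_mem_closure (f := fun x => x * y) (by fun_prop) (mem_closure_mul_self z) ?_
  rintro _ ⟨⟨v, w⟩, rfl⟩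
  exact subset_cspan ⟨v, w * y, by simp only [mul_assoc]⟩

theorem Iso.stablyIso (h : A.Iso B) : A.StablyIso B := by
  obtain ⟨e⟩ := h
  obtain ⟨g, hg, hgu⟩ := exists_stabMap (e : A →⋆ₙₐ[ℂ] B) e.injective
  refine ⟨StarAlgEquiv.ofBijective g ⟨hg, fun y => ?_⟩⟩
  have hy : y ∈ (Sub.range g).toSubalgebra.toSubmodule := by
    refine cspan_le (Sub.range g).isClosed ?_ (cspan_stabUnit y)
    rintro _ ⟨i, j, b, rfl⟩
    refine ⟨A.stabUnit i j (e.symm b), (hgu i j _).trans ?_⟩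
    exact congrArg _ (e.apply_symm_apply b)
  exact hy

/-- Separable hereditary subalgebras generating the same ideal are stably isomorphic. -/
theorem HereditaryEmbedding.stablyIso (hA : A.IsSeparable) {B₁ B₂ : CStarAlg.{u}}
    {i : B₁ →⋆ₙₐ[ℂ] A} {j : B₂ →⋆ₙₐ[ℂ] A} (hi : HereditaryEmbedding i) (hj : HereditaryEmbedding j)
    (h12 : ∀ b, i b ∈ cspan {x : A | ∃ v c w, x = v * j c * w})
    (h21 : ∀ b, j b ∈ cspan {x : A | ∃ v c w, x = v * i c * w}) : B₁.StablyIso B₂ := by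
  -- Reduces the ideal generated by a whole algebra to the one generated by its strictly positive
  -- element, as `stablyIso_her` requires.
  have key : ∀ {D E : CStarAlg.{u}} {f : D →⋆ₙₐ[ℂ] A} {g : E →⋆ₙₐ[ℂ] A} (p : D) (q : E),
      (∀ b, f b ∈ cspan {x : A | ∃ v c w, x = v * g c * w}) →
      (∀ b, g b ∈ closedRightIdeal (g q)) → f p ∈ cspan {x : A | ∃ v w, x = v * g q * w} := by
    intro D E f g p q hfg hq
    refine cspan_le (isClosed_cspan _) ?_ (hfg p)
    rintro _ ⟨v, c, w, rfl⟩
    rw [← SetLike.mem_coe, ← (isClosed_cspan _).closure_eq]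
    refine map_mem_closure (f := fun x => v * x * w) (by fun_prop)
      (closedRightIdeal_le_cspan _ (hq c)) fun x hx => ?_
    refine map_mem_of_mem_cspan (isClosed_cspan _)
      (LinearMap.mulRight ℂ w ∘ₗ LinearMap.mulLeft ℂ v)
      ((continuous_const.mul continuous_id).mul continuous_const) ?_ (Submodule.le_topologicalClosure _ hx)
    rintro _ ⟨v', w', rfl⟩
    exact subset_cspan ⟨v * v', w' * w, by simp [mul_assoc]⟩
  obtain ⟨p, hp, ep, hp'⟩ := hi.exists_her (isSeparable_of_injective hA i hi.injective)
  obtain ⟨q, hq, eq, hq'⟩ := hj.exists_her (isSeparable_of_injective hA j hj.injective)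
  exact ep.stablyIso.trans ((stablyIso_her hA (hp.map i) (hq.map j) (key p q h12 hq')
    (key q p h21 hp')).trans eq.stablyIso.symm)

theorem hereditaryEmbedding_stabCorner (A : CStarAlg.{u}) (i : ℕ) :
    HereditaryEmbedding (A.stabCorner i) := by
  refine ⟨stabUnit_injective i i, fun b c s => ?_⟩
  have h : A.stabUnit i i b * s * A.stabUnit i i c ∈
      (Sub.range (A.stabCorner i)).toSubalgebra.toSubmodule := by
    refine map_mem_of_mem_cspan (Sub.range (A.stabCorner i)).isClosed
      (LinearMap.mulRight ℂ (A.stabUnit i i c) ∘ₗ LinearMap.mulLeft ℂ (A.stabUnit i i b))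
      ((continuous_const.mul continuous_id).mul continuous_const) ?_ (cspan_stabUnit s)
    rintro _ ⟨k, l, a, rfl⟩
    change A.stabUnit i i b * A.stabUnit k l a * A.stabUnit i i c ∈ _
    rw [stabUnit_mul_stabUnit]
    split_ifs
    · rw [stabUnit_mul_stabUnit]
      split_ifs
      · exact ⟨_, rfl⟩
      · exact zero_mem _
    · rw [zero_mul]
      exact zero_mem _
  exact h

theorem isFullHom_stabCorner (A : CStarAlg.{u}) (i : ℕ) : IsFullHom (A.stabCorner i) := by
  intro s
  refine cspan_le (isClosed_cspan _) ?_ (cspan_stabUnit s)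
  rintro _ ⟨k, l, a, rfl⟩
  rw [← SetLike.mem_coe, ← (isClosed_cspan _).closure_eq]
  refine map_mem_closure (continuous_stabUnit k l) (mem_closure_mul_self a) ?_
  rintro _ ⟨⟨v, w⟩, rfl⟩
  refine subset_cspan ⟨A.stabUnit k i v, a, A.stabUnit i l w, ?_⟩
  rw [stabCorner_apply, stabUnit_mul_same, stabUnit_mul_same]

theorem isSeparable_stabilization (hA : A.IsSeparable) : A.stabilization.IsSeparable := by
  have : TopologicalSpace.SeparableSpace A := hA
  have h1 : TopologicalSpace.IsSeparable
      {x : A.stabilization | ∃ i j a, x = A.stabUnit i j a} := by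
    have : {x : A.stabilization | ∃ i j a, x = A.stabUnit i j a} =
        ⋃ (i : ℕ) (j : ℕ), Set.range (A.stabUnit i j) := by
      ext x
      simp [eq_comm]
    rw [this]
    exact .iUnion fun i => .iUnion fun j => TopologicalSpace.isSeparable_range
      (continuous_stabUnit i j)
  have h2 : TopologicalSpace.IsSeparable (Set.univ : Set A.stabilization) :=
    (h1.span (R := ℂ)).closure.mono fun x _ => cspan_stabUnit x
  exact TopologicalSpace.isSeparable_univ_iff.1 h2

theorem mem_cspan_conj (x : A) : x ∈ cspan {y : A | ∃ v c w, y = v * c * w} := by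
  rw [← SetLike.mem_coe, ← (isClosed_cspan _).closure_eq]
  refine closure_mono ?_ (mem_closure_mul_self x)
  rintro _ ⟨⟨v, w⟩, rfl⟩
  exact subset_cspan ⟨v, x, w, rfl⟩

/-- The corner `A` is full and hereditary in `A ⊗ 𝕂`, so it is compared with all of `A ⊗ 𝕂` inside
that algebra. -/
theorem stablyIso_stabilization (hA : A.IsSeparable) : A.StablyIso A.stabilization :=
  (hereditaryEmbedding_stabCorner A 0).stablyIso (isSeparable_stabilization hA)
    (j := NonUnitalStarAlgHom.id ℂ _) ⟨Function.injective_id, fun b c a => ⟨b * a * c, rfl⟩⟩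
    (fun _ => mem_cspan_conj _) (isFullHom_stabCorner A 0)

end CStarAlg

end

noncomputable section

open Filter Topology

attribute [local instance] CStarAlgebra.spectralOrder CStarAlgebra.spectralOrderedRing

namespace CStarAlg

variable {A B : CStarAlg.{u}}

/-! ### Passage to hereditary subalgebras -/

/-- The ideal generated by the image of `i`. -/
def Sub.idealSpan (i : B →⋆ₙₐ[ℂ] A) : A.Sub where
  toSubalgebra :=
    { cspan {x : A | ∃ v b w, x = v * i b * w} with
      mul_mem' := fun {x y} hx hy => by
        refine mul_mem_of_mem_cspan (isClosed_cspan _) ?_ hx hy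
        rintro _ ⟨v, b, w, rfl⟩ _ ⟨v', b', w', rfl⟩
        exact subset_cspan ⟨v, b, w * (v' * i b' * w'), by simp only [mul_assoc]⟩
      star_mem' := fun {x} hx => by
        refine star_mem_cspan ?_ hx
        rintro _ ⟨v, b, w, rfl⟩
        exact ⟨star w, star b, star v, by simp only [star_mul, map_star, mul_assoc]⟩ }
  isClosed := isClosed_cspan _

theorem Sub.mem_idealSpan {i : B →⋆ₙₐ[ℂ] A} {x : A} :
    x ∈ (Sub.idealSpan i).toSet ↔ x ∈ cspan {x : A | ∃ v b w, x = v * i b * w} := Iff.rfl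

theorem Sub.isIdeal_idealSpan (i : B →⋆ₙₐ[ℂ] A) : (Sub.idealSpan i).IsIdeal := by
  intro a x hx
  constructor
  · refine map_mem_of_mem_cspan (isClosed_cspan _) (LinearMap.mulLeft ℂ a)
      (continuous_const.mul continuous_id) ?_ hx
    rintro _ ⟨v, b, w, rfl⟩
    exact subset_cspan ⟨a * v, b, w, by simp [mul_assoc]⟩
  · refine map_mem_of_mem_cspan (isClosed_cspan _) (LinearMap.mulRight ℂ a)
      (continuous_id.mul continuous_const) ?_ hx
    rintro _ ⟨v, b, w, rfl⟩
    exact subset_cspan ⟨v, b, w * a, by simp [mul_assoc]⟩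

/-- Both `B` and the ideal it generates are hereditary in `A` and generate the same ideal. -/
theorem HereditaryEmbedding.stablyIso_idealSpan (hA : A.IsSeparable) {i : B →⋆ₙₐ[ℂ] A}
    (hi : HereditaryEmbedding i) : B.StablyIso (Sub.idealSpan i).toCStarAlg := by
  refine hi.stablyIso hA (j := (Sub.idealSpan i).incl) (hereditaryEmbedding_incl
    fun b hb c _ a => (Sub.isIdeal_idealSpan i c _ ((Sub.isIdeal_idealSpan i a b hb).2)).2)
    (fun b => ?_) (fun b => (Sub.idealSpan i).incl_mem b)
  have hb : i b ∈ (Sub.idealSpan i).toSet := by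
    rw [Sub.mem_idealSpan, ← SetLike.mem_coe, ← (isClosed_cspan _).closure_eq]
    refine closure_mono ?_ (mem_closure_mul_self (i b))
    rintro _ ⟨⟨v, w⟩, rfl⟩
    exact subset_cspan ⟨v, b, w, rfl⟩
  rw [← SetLike.mem_coe, ← (isClosed_cspan _).closure_eq]
  refine closure_mono ?_ (mem_closure_mul_self (i b))
  rintro _ ⟨⟨v, w⟩, rfl⟩
  exact subset_cspan ⟨v, ⟨i b, hb⟩, w, rfl⟩

end CStarAlg

open CStarAlg

/-! ### Separable algebras of dimension at most `k`: stabilizations and hereditary subalgebras -/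

namespace IsDimensionTheory

variable {C : Set CStarAlg.{u}} {d : CStarAlg.{u} → ℕ∞} (hd : IsDimensionTheory C d)
  (hC : ClosedUnderStableIso C) (hs : ∀ A ∈ C, A.IsSeparable → d A = d A.stabilization)

include hd hC hs

theorem separable_hasDimLE_stabilization {k : ℕ} {D : CStarAlg.{u}}
    (hD : D.IsSeparable ∧ HasDimLE C d k D) :
    D.stabilization.IsSeparable ∧ HasDimLE C d k D.stabilization :=
  ⟨isSeparable_stabilization hD.1, hC D hD.2.1 _ (stablyIso_stabilization hD.1),
    (hs D hD.2.1 hD.1).symm.trans_le hD.2.2⟩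

/-- Let `J` be the ideal of `D` generated by `H`. Then `H` and `J` are stably isomorphic, whence
`d(H) = d(H ⊗ 𝕂) = d(J ⊗ 𝕂) = d(J) ≤ d(D)`. -/
theorem separable_hasDimLE_hereditary {k : ℕ} {D H : CStarAlg.{u}}
    (hD : D.IsSeparable ∧ HasDimLE C d k D) (i : H →⋆ₙₐ[ℂ] D) (hi : HereditaryEmbedding i) :
    H.IsSeparable ∧ HasDimLE C d k H := by
  let J := (Sub.idealSpan i).toCStarAlg
  have hJ : HasDimLE C d k J := hd.hasDimLE_ideal D hD.2 _ (Sub.isIdeal_idealSpan i)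
  have hJs : J.IsSeparable := isSeparable_of_injective hD.1 _ (Sub.incl_injective _)
  have hHs : H.IsSeparable := isSeparable_of_injective hD.1 _ hi.injective
  have hHJ : H.StablyIso J := hi.stablyIso_idealSpan hD.1
  have hH : H ∈ C := hC J hJ.1 H hHJ.symm
  refine ⟨hHs, hH, ?_⟩
  rw [hs H hH hHs, hd.iso _ (hC H hH _ (stablyIso_stabilization hHs)) _
    (hC J hJ.1 _ (stablyIso_stabilization hJs)) hHJ, ← hs J hJ.1 hJs]
  exact hJ.2

end IsDimensionTheory

namespace CStarAlg

variable {A B : CStarAlg.{u}} {P : CStarAlg.{u} → Prop}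

theorem norm_conj_self_sub_le {A : Type*} [NonUnitalCStarAlgebra A] {h x : A} {δ : ℝ}
    (hh : ‖h‖ ≤ 1) (h1 : ‖h * x - x‖ ≤ δ) (h2 : ‖x * h - x‖ ≤ δ) :
    ‖h * h * x * (h * h) - x‖ ≤ 4 * δ ∧ ‖h * h * h * x * (h * h * h) - x‖ ≤ 6 * δ := by
  have e1 := norm_conj_sub_le hh h1 h2 x
  have e2 := norm_conj_sub_le hh h1 h2 (h * x * h)
  have e3 := norm_conj_sub_le hh h1 h2 (h * (h * x * h) * h)
  rw [sub_self, norm_zero] at e1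
  constructor
  · calc _ = ‖h * (h * x * h) * h - x‖ := by simp only [mul_assoc]
      _ ≤ _ := by linarith
  · calc _ = ‖h * (h * (h * x * h) * h) * h - x‖ := by simp only [mul_assoc]
      _ ≤ _ := by linarith

theorem exists_lift {E : CStarAlg.{u}} {i : B →⋆ₙₐ[ℂ] A} (hi : Function.Injective i)
    (φ : E →⋆ₙₐ[ℂ] A) (h : ∀ x, φ x ∈ Set.range i) :
    ∃ g : E →⋆ₙₐ[ℂ] B, ∀ x, i (g x) = φ x := by
  let e : B ≃⋆ₐ[ℂ] (Sub.range i).toCStarAlg :=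
    StarAlgEquiv.ofBijective ((Sub.range i).codRestrict i fun x => ⟨x, rfl⟩)
      ⟨fun x y hxy => hi (congrArg (Sub.range i).incl hxy), fun ⟨y, x, hx⟩ => ⟨x, Subtype.ext hx⟩⟩
  refine ⟨(e.symm : _ →⋆ₙₐ[ℂ] B).comp ((Sub.range i).codRestrict φ h), fun x => ?_⟩
  exact congrArg (Sub.range i).incl (e.apply_symm_apply ((Sub.range i).codRestrict φ h x))

/-- The element `z w z*` of `Sub.her z`. -/
def Sub.conj (z w : A) : (Sub.her z).toCStarAlg := ⟨z * w * star z, conj_mem_her z w⟩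

theorem Sub.incl_conj (z w : A) : (Sub.her z).incl (Sub.conj z w) = z * w * star z := rfl

theorem exists_her_abs_hom (z : A) :
    ∃ e : (Sub.her z).toCStarAlg →⋆ₙₐ[ℂ] (Sub.her (CFC.abs z)).toCStarAlg,
      Function.Injective e ∧ ∀ w, e (Sub.conj z w) = Sub.conj (CFC.abs z) w := by
  obtain ⟨e, he⟩ := exists_her_equiv (star_mul_self_abs z)
  exact ⟨{ toFun := e, map_smul' := map_smul e, map_zero' := map_zero e, map_add' := map_add e,
           map_mul' := map_mul e, map_star' := map_star e }, e.injective, he⟩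

/-- If `c ∈ closure (z A)`, the polar decomposition of `z` moves `closure (c A c)` into
`closure (z* A z)`. -/
theorem exists_her_hom {D : CStarAlg.{u}} (f : D →⋆ₙₐ[ℂ] A) (hf : Function.Injective f) {c : D}
    (hc : IsSelfAdjoint c) {z : A} (hz : f c ∈ closedRightIdeal z) {i : B →⋆ₙₐ[ℂ] A}
    (hi : HereditaryEmbedding i) (hzi : ∃ b, star z ∈ closedRightIdeal (i b)) :
    ∃ g : (Sub.her c).toCStarAlg →⋆ₙₐ[ℂ] B, Function.Injective g ∧ ∀ y, ∃ s, ∀ w,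
      ‖i (g s) - CFC.abs z * w * CFC.abs z‖ = ‖f c * f y * f c - z * w * star z‖ := by
  have habs : star (CFC.abs z) = CFC.abs z := (IsSelfAdjoint.of_nonneg (CFC.abs_nonneg z)).star_eq
  have h1 : ∀ x, f ((Sub.her c).incl x) ∈ (Sub.her z).toSet := fun x => by
    refine her_subset (S := f ⁻¹' (Sub.her z).toSet) ((isClosed_her z).preimage f.continuous)
      (fun w => ?_) x.2
    change f (c * w * star c) ∈ _root_.her z
    rw [map_mul, map_mul, map_star]
    exact mul_mul_star_mem_her hz hz _
  obtain ⟨e, he, hew⟩ := exists_her_abs_hom z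
  let φ := (Sub.her z).codRestrict (f.comp (Sub.her c).incl) h1
  have hφi : ∀ x, (Sub.her z).incl (φ x) = f ((Sub.her c).incl x) := fun x => rfl
  have hφ : Function.Injective φ := fun x y hxy =>
    (Sub.her c).incl_injective (hf (congrArg (Sub.her z).incl hxy))
  -- The map sends `closure (c D c)` into `closure (z A z*)`, then to `closure (|z| A |z|) = closure
  -- (z* A z)`. The latter lies in the image of `i` because `z*` is in the closed right ideal of
  -- some `i b`.
  have h2 : ∀ x, ((Sub.her (CFC.abs z)).incl.comp (e.comp φ)) x ∈ Set.range i := fun x => by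
    have h3 : (Sub.her (CFC.abs z)).incl (e (φ x)) ∈ _root_.her (CFC.abs z) :=
      (Sub.her (CFC.abs z)).incl_mem _
    rw [her_abs] at h3
    obtain ⟨b, hb⟩ := hzi
    refine her_subset hi.isClosed_range (fun w => ?_) (her_le hb h3)
    rw [← map_star]
    exact hi.exists_eq _ _ _
  obtain ⟨g, hg⟩ := exists_lift hi.injective _ h2
  have hg' : ∀ x, i (g x) = (Sub.her (CFC.abs z)).incl (e (φ x)) := hg
  refine ⟨g, fun x y hxy => ?_, fun y => ⟨Sub.conj c y, fun w => ?_⟩⟩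
  · have h3 := congrArg i hxy
    rw [hg', hg'] at h3
    exact hφ (he ((Sub.her (CFC.abs z)).incl_injective h3))
  · have h3 : (Sub.her (CFC.abs z)).incl (e (Sub.conj z w)) = CFC.abs z * w * CFC.abs z := by
      rw [hew, Sub.incl_conj, habs]
    rw [hg', ← h3, ← map_sub, ← map_sub, Sub.norm_incl, NonUnitalStarAlgHom.norm_map e he,
      ← Sub.norm_incl, map_sub, hφi, Sub.incl_conj, Sub.incl_conj, hc.star_eq, map_mul, map_mul]

/-- For an almost unit `h` of `B`, the cut-down `f n (c n)` lies in the closed right ideal of `z n =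
f n (c n) * i h` but in general not in `B`. The polar decomposition of `z n` moves `closure (c n D c
n)` into `B`. Since `z n` tends to the positive element `i (h³)`, so does `|z n|`, and conjugation
by `|z n|` hardly moves the given elements. -/
theorem ApproxBy.hereditary (hP : ∀ (D H : CStarAlg.{u}) (i : H →⋆ₙₐ[ℂ] D), P D →
    HereditaryEmbedding i → P H) (hA : ApproxBy P A) {i : B →⋆ₙₐ[ℂ] A}
    (hi : HereditaryEmbedding i) : ApproxBy P B := by
  classical
  intro F ε hε
  -- Conjugation by `h²` and by `h³` costs `4δ` and `6δ`. The two limiting norms are at most `4δ +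
  -- 6δ` and `6δ`, in total `16δ < ε`.
  have hδ : 0 < ε / 17 := by positivity
  obtain ⟨h, hh0, hh1, hF⟩ := exists_approx_unit F hδ
  have hhs : IsSelfAdjoint h := .of_nonneg hh0
  obtain ⟨D, f, y, c, hD, hc, hy⟩ := hA.exists_cutDown (F.image i) (hhs.map i)
  let z : ∀ n, A := fun n => f n (c n) * i h
  have hz : Tendsto z atTop (𝓝 (i (h * h * h))) := by
    simpa only [map_mul] using hc.mul_const (i h)
  have habs : Tendsto (fun n => CFC.abs (z n)) atTop (𝓝 (i (h * h * h))) := by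
    have h1 := ((CFC.continuous_abs (A := A)).tendsto _).comp hz
    have h2 : 0 ≤ i (h * h * h) := by
      have : h * h * h = star h * h * h := by rw [hhs.star_eq]
      have h3 : 0 ≤ h * h * h := by
        simpa [hhs.star_eq] using star_left_conjugate_nonneg hh0 h
      exact map_nonneg i h3
    rwa [CFC.abs_of_nonneg _ h2] at h1
  have hev : ∀ᶠ n in atTop, ∀ x ∈ F,
      ‖f n (c n) * f n (y n (i x)) * f n (c n) - z n * i x * star (z n)‖ +
        ‖CFC.abs (z n) * i x * CFC.abs (z n) - i x‖ < ε := by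
    rw [eventually_all_finset]
    intro x hx
    have hlim := ((((hc.mul (hy _ (Finset.mem_image_of_mem _ hx))).mul hc).sub
      ((hz.mul_const (i x)).mul hz.star)).norm).add
      (((habs.mul_const (i x)).mul habs).sub_const (i x)).norm
    refine hlim.eventually_lt_const ?_
    obtain ⟨e1, e2⟩ := norm_conj_self_sub_le hh1 (hF x hx).1.le (hF x hx).2.le
    have hs3 : star (i (h * h * h)) = i (h * h * h) := by
      rw [← map_star]; simp [hhs.star_eq, mul_assoc]
    rw [hs3]
    simp only [← map_mul, ← map_sub, NonUnitalStarAlgHom.norm_map i hi.injective]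
    have e3 : ‖h * h * x * (h * h) - h * h * h * x * (h * h * h)‖ ≤ 4 * (ε / 17) + 6 * (ε / 17) := by
      rw [← sub_sub_sub_cancel_right _ _ x]
      exact (norm_sub_le _ _).trans (add_le_add e1 e2)
    linarith
  obtain ⟨n, hn⟩ := hev.exists
  have hcs := (hD n).2.2.1
  obtain ⟨g, hg, hgy⟩ := exists_her_hom (f n) (hD n).1 hcs (z := z n) (hD n).2.2.2 hi
    ⟨h, by
      simp only [z, star_mul, (hhs.map i).star_eq]
      exact mul_mem_closedRightIdeal _ _⟩
  refine ⟨_, g, hg, hP _ _ _ (hD n).2.1 (hereditaryEmbedding_her (c n)), fun x hx => ?_⟩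
  obtain ⟨s, hs⟩ := hgy (y n (i x))
  refine ⟨s, ?_⟩
  rw [← NonUnitalStarAlgHom.norm_map i hi.injective, map_sub, norm_sub_rev]
  refine lt_of_le_of_lt ?_ (hn x hx)
  rw [← hs]
  exact norm_sub_le_norm_sub_add_norm_sub _ _ _

end CStarAlg

end

noncomputable section

open Filter Topology

attribute [local instance] CStarAlgebra.spectralOrder CStarAlgebra.spectralOrderedRing

namespace CStarAlg

variable {A B : CStarAlg.{u}} {P : CStarAlg.{u} → Prop}

/-! ### Passage from full hereditary subalgebras -/

theorem Sub.IsHereditary.conj_mem {S : A.Sub} (hS : S.IsHereditary) {a b : A} (ha : 0 ≤ a)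
    (hb : b ∈ S.toSet) : b * a * star b ∈ S.toSet := by
  have h1 : b * a * star b ≤ (‖a‖ : ℂ) • (b * star b) := by
    have := CStarAlgebra.star_right_conjugate_le_norm_smul (a := b) (b := a) (.of_nonneg ha)
    simpa using this
  refine hS _ ((‖a‖ : ℂ) • (b * star b)) ?_ ?_ ?_
  · exact S.toSubalgebra.smul_mem _ (S.toSubalgebra.mul_mem hb (S.toSubalgebra.star_mem' hb))
  · exact CStarAlgebra.nonneg_iff_eq_star_mul_self.1 (star_right_conjugate_nonneg ha b)
  · exact CStarAlgebra.nonneg_iff_eq_star_mul_self.1 (sub_nonneg.2 h1)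

/-- For `a ≥ 0`, `b a b* ≤ ‖a‖ b b*` gives `b a b* ∈ S`. Polarization in `b` yields `b a c* ∈ S`,
and positive elements span `A`. -/
theorem Sub.IsHereditary.hereditaryEmbedding {S : A.Sub} (hS : S.IsHereditary) :
    HereditaryEmbedding S.incl := by
  have key : ∀ b ∈ S.toSubalgebra, ∀ c ∈ S.toSubalgebra, ∀ a : A, 0 ≤ a →
      b * a * star c ∈ S.toSubalgebra := by
    intro b hb c hc a ha
    have hR : ∀ c ∈ S.toSubalgebra, b * a * star c + c * a * star b ∈ S.toSubalgebra := by
      intro c hc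
      have h1 : (b + c) * a * star (b + c) ∈ S.toSubalgebra := hS.conj_mem ha (add_mem hb hc)
      have h2 : b * a * star b ∈ S.toSubalgebra := hS.conj_mem ha hb
      have h3 : c * a * star c ∈ S.toSubalgebra := hS.conj_mem ha hc
      have h4 := sub_mem (sub_mem h1 h2) h3
      convert h4 using 1
      rw [star_add]
      noncomm_ring
    have h1 := hR c hc
    have h2 := S.toSubalgebra.smul_mem Complex.I
      (hR (Complex.I • c) (S.toSubalgebra.smul_mem Complex.I hc))
    have h3 := S.toSubalgebra.smul_mem (1 / 2 : ℂ) (add_mem h1 h2)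
    have h4 : b * a * star c = (1 / 2 : ℂ) • (b * a * star c + c * a * star b +
        Complex.I • (b * a * star (Complex.I • c) + Complex.I • c * a * star b)) := by
      simp only [star_smul, mul_smul_comm, smul_mul_assoc, smul_add, smul_smul]
      simp
      module
    rwa [h4]
  refine hereditaryEmbedding_incl fun b hb c hc a => ?_
  have ha : a ∈ Submodule.span ℂ {a : A | 0 ≤ a} := by
    rw [CStarAlgebra.span_nonneg]; trivial
  change b * a * c ∈ S.toSubalgebra.toSubmodule
  refine Submodule.span_induction (p := fun a _ => b * a * c ∈ S.toSubalgebra.toSubmodule)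
    (fun a ha => ?_) ?_ (fun x y _ _ hx hy => ?_) (fun r x _ hx => ?_) ha
  · have := key b hb (star c) (S.toSubalgebra.star_mem' hc) a ha
    rwa [star_star] at this
  · rw [mul_zero, zero_mul]; exact zero_mem _
  · rw [mul_add, add_mul]; exact add_mem hx hy
  · rw [mul_smul_comm, smul_mul_assoc]; exact Submodule.smul_mem _ _ hx

theorem Sub.IsFull.isFullHom {S : A.Sub} (hS : S.IsFull) : IsFullHom S.incl := by
  intro a
  refine closure_mono (Submodule.span_mono ?_) (hS a)
  rintro _ ⟨v, w, b, hb, rfl⟩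
  exact ⟨v, ⟨b, hb⟩, w, rfl⟩

/-- The limits of sequences in the images of a sequence of homomorphisms. -/
def seqLimits {D : ℕ → CStarAlg.{u}} (f : ∀ n, D n →⋆ₙₐ[ℂ] A) : Submodule ℂ A where
  carrier := {x | ∃ t : ∀ n, D n, Tendsto (fun n => f n (t n)) atTop (𝓝 x)}
  add_mem' := by
    rintro x y ⟨s, hs⟩ ⟨t, ht⟩
    exact ⟨fun n => s n + t n, by simpa only [map_add] using hs.add ht⟩
  zero_mem' := ⟨fun _ => 0, by simp⟩
  smul_mem' := by
    rintro c x ⟨s, hs⟩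
    exact ⟨fun n => c • s n, by simpa only [map_smul] using hs.const_smul c⟩

/-- Up to `ε / 2` only finitely many matrix entries occur. If these are limits from the `D n`, then
so are the elements they span, because `seqLimits` is a subspace. -/
theorem ApproxBy.stabilization (hP : ∀ D, P D → P D.stabilization) (hA : ApproxBy P A) :
    ApproxBy P A.stabilization := by
  classical
  intro F ε hε
  have h1 : ∀ x : A.stabilization, ∃ s : A.stabilization,
      ‖x - s‖ < ε / 2 ∧ ∃ T : Finset A.stabilization,
        (∀ y ∈ T, ∃ i j a, y = A.stabUnit i j a) ∧ s ∈ Submodule.span ℂ (T : Set A.stabilization) := by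
    intro x
    obtain ⟨s, hs, hxs⟩ := Metric.mem_closure_iff.1 (cspan_stabUnit x) (ε / 2) (half_pos hε)
    obtain ⟨T, hT, hsT⟩ := Submodule.mem_span_finite_of_mem_span hs
    exact ⟨s, by rwa [← dist_eq_norm], T, fun y hy => hT hy, hsT⟩
  choose s hs T hT hsT using h1
  choose! i j a ha using hT
  obtain ⟨D, f, y, hD⟩ := hA.exists_seq (F.biUnion fun x => (T x).image (a x))
  have hg := fun n => exists_stabMap (f n) (hD n).1
  choose g hg hgu using hg
  have hlim : ∀ b ∈ F.biUnion fun x => (T x).image (a x),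
      Tendsto (fun n => f n (y n b)) atTop (𝓝 b) := fun b hb => by
    rw [tendsto_iff_norm_sub_tendsto_zero]
    refine squeeze_zero (fun n => norm_nonneg _) (fun n => ?_)
      (tendsto_one_div_add_atTop_nhds_zero_nat (𝕜 := ℝ))
    rw [norm_sub_rev]
    exact ((hD n).2.2 b hb).le
  have hmem : ∀ x ∈ F, s x ∈ seqLimits g := by
    intro x hx
    refine Submodule.span_le.2 (fun v hv => ?_) (hsT x)
    have hb : a x v ∈ F.biUnion fun x => (T x).image (a x) :=
      Finset.mem_biUnion.2 ⟨x, hx, Finset.mem_image_of_mem _ hv⟩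
    rw [ha x v hv]
    refine ⟨fun n => (D n).stabUnit (i x v) (j x v) (y n (a x v)), ?_⟩
    simp only [hgu]
    exact ((continuous_stabUnit _ _).tendsto _).comp (hlim _ hb)
  choose! t ht using hmem
  have hev : ∀ᶠ n in atTop, ∀ x ∈ F, ‖s x - g n (t x n)‖ < ε / 2 := by
    rw [eventually_all_finset]
    intro x hx
    have := ((ht x hx).const_sub (s x)).norm
    rw [sub_self, norm_zero] at this
    exact this.eventually_lt_const (half_pos hε)
  obtain ⟨n, hn⟩ := hev.exists
  refine ⟨_, g n, hg n, hP _ (hD n).2.1, fun x hx => ⟨t x n, ?_⟩⟩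
  calc ‖x - g n (t x n)‖ ≤ ‖x - s x‖ + ‖s x - g n (t x n)‖ := norm_sub_le_norm_sub_add_norm_sub _ _ _
    _ < ε := by linarith [hs x, hn x hx]

theorem HereditaryEmbedding.of_comp {E : CStarAlg.{u}} {j : B →⋆ₙₐ[ℂ] E} {g : E →⋆ₙₐ[ℂ] A}
    (hg : Function.Injective g) {i : B →⋆ₙₐ[ℂ] A} (hi : HereditaryEmbedding i)
    (h : ∀ x, g (j x) = i x) : HereditaryEmbedding j := by
  refine ⟨fun x y hxy => hi.injective ?_, fun b c a => ?_⟩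
  · rw [← h, ← h, hxy]
  · obtain ⟨d, hd⟩ := hi.exists_eq b c (g a)
    exact ⟨d, hg (by rw [h, hd, map_mul, map_mul, h, h])⟩

/-- An element `∑ vⱼ bⱼ wⱼ` of the algebraic ideal generated by `i` is, in the corner of `A ⊗ 𝕂`, the
product of the row `(vⱼ bⱼ)` and the column `(wⱼ)`. -/
theorem exists_factorization (i : B →⋆ₙₐ[ℂ] A) {u : A}
    (hu : u ∈ Submodule.span ℂ {x : A | ∃ v b w, x = v * i b * w}) :
    ∃ z t : A.stabilization, A.stabUnit 0 0 u = z * t ∧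
      z ∈ cspan {x : A.stabilization | ∃ j a b, x = A.stabUnit 0 j (a * i b)} := by
  obtain ⟨n, c, g, rfl⟩ := Submodule.mem_span_set'.1 hu
  choose v b w hg using fun j => (g j).2
  refine ⟨∑ j : Fin n, A.stabUnit 0 j (c j • v j * i (b j)), ∑ j : Fin n, A.stabUnit j 0 (w j), ?_,
    sum_mem fun j _ => subset_cspan ⟨_, _, _, rfl⟩⟩
  rw [Finset.sum_mul_sum, map_sum]
  refine Finset.sum_congr rfl fun j _ => ?_
  rw [Finset.sum_eq_single j, stabUnit_mul_same, hg]
  · simp only [smul_mul_assoc]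
  · exact fun k _ hk => stabUnit_mul_of_ne (fun h => hk (Fin.ext h.symm)) _ _
  · simp

/-- An almost unit satisfies the inequalities, which are open conditions, so some element of the
dense algebraic span does too. An honest finite sum is what the factorizations below need. -/
theorem exists_mem_span_conj_approx {X : Set A} (hX : ∀ a, a ∈ cspan X) (F : Finset A) {ε : ℝ}
    (hε : 0 < ε) : ∃ u ∈ Submodule.span ℂ X, ∀ x ∈ F, ‖x - u * x * star u‖ < ε := by
  have hδ : 0 < ε / 3 := by positivity
  obtain ⟨h, hh0, hh1, hF⟩ := exists_approx_unit F hδ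
  have hopen : IsOpen {u : A | ∀ x ∈ F, ‖x - u * x * star u‖ < ε} := by
    have : {u : A | ∀ x ∈ F, ‖x - u * x * star u‖ < ε} =
        ⋂ x ∈ F, {u : A | ‖x - u * x * star u‖ < ε} := by
      ext; simp
    rw [this]
    exact isOpen_biInter_finset fun x _ => isOpen_lt (by fun_prop) continuous_const
  obtain ⟨u, hu1, hu2⟩ := mem_closure_iff.1 (hX h) _ hopen fun x hx => by
    rw [(IsSelfAdjoint.of_nonneg hh0).star_eq, norm_sub_rev]
    have := norm_mul_mul_sub_le (b := h) (x := x) hh1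
    linarith [hF x hx]
  exact ⟨u, hu2, hu1⟩

/-- Factor an almost unit `u = z t` in `A ⊗ 𝕂` with `z` a row whose entries lie in `A i(B)`. Then
`closure (z* 𝔸 z)`, where `𝔸 = A ⊗ 𝕂`, is a hereditary subalgebra of `B ⊗ 𝕂`, so it inherits the
approximation. Its isomorphic copy `closure (z 𝔸 z*)` sits in the corner `A` and contains `u x u* =
z (t x t*) z*`, which is close to `x`. -/
theorem ApproxBy.of_full (hPs : ∀ D, P D → P D.stabilization)
    (hP : ∀ (D H : CStarAlg.{u}) (i : H →⋆ₙₐ[ℂ] D), P D → HereditaryEmbedding i → P H)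
    {i : B →⋆ₙₐ[ℂ] A} (hi : HereditaryEmbedding i) (hf : IsFullHom i) (hB : ApproxBy P B) :
    ApproxBy P A := by
  classical
  refine ApproxBy.trans fun F ε hε => ?_
  obtain ⟨u, hu, huF⟩ := exists_mem_span_conj_approx hf F hε
  obtain ⟨z, t, hzt, hz⟩ := exists_factorization i hu
  obtain ⟨g, hg, hgu⟩ := exists_stabMap i hi.injective
  have hz' : star z ∈ cspan {x : A.stabilization | ∃ j a b, x = A.stabUnit j 0 (i b * a)} := by
    refine star_mem_cspan ?_ hz
    rintro _ ⟨j, a, b, rfl⟩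
    exact ⟨j, star a, star b, by rw [star_stabUnit, star_mul, map_star]⟩
  have h1 : ∀ x, (Sub.her (star z)).incl x ∈ Set.range g := fun x => by
    refine her_subset (Sub.range g).isClosed (fun s => ?_) ((Sub.her (star z)).incl_mem x)
    rw [star_star]
    have h2 : star z * s ∈
        cspan {x : A.stabilization | ∃ j l a b, x = A.stabUnit j l (i b * a)} := by
      refine mul_mem_of_mem_cspan (isClosed_cspan _) ?_ hz' (cspan_stabUnit s)
      rintro _ ⟨j, a, b, rfl⟩ _ ⟨k, l, c, rfl⟩
      rw [stabUnit_mul_stabUnit]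
      split_ifs
      · exact subset_cspan ⟨_, _, a * c, b, by rw [mul_assoc]⟩
      · exact zero_mem _
    refine mul_mem_of_mem_cspan (M := (Sub.range g).toSubalgebra.toSubmodule)
      (Sub.range g).isClosed ?_ h2 hz
    rintro _ ⟨j, l, a, b, rfl⟩ _ ⟨k, a', b', rfl⟩
    rw [stabUnit_mul_stabUnit]
    split_ifs
    · obtain ⟨d, hd⟩ := hi.exists_eq b b' (a * a')
      exact ⟨B.stabUnit j k d, (hgu _ _ _).trans (by rw [hd]; simp only [mul_assoc])⟩
    · exact zero_mem _
  obtain ⟨φ, hφ⟩ := exists_lift hg _ h1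
  have hher : ApproxBy P (Sub.her z).toCStarAlg :=
    ((hB.stabilization hPs).hereditary hP (HereditaryEmbedding.of_comp hg
      (hereditaryEmbedding_her (star z)) hφ)).iso (iso_her_star z)
  -- Since `z` has only row `0`, everything of the form `z s z*` lies in the corner `(0, 0)`.
  have h2 : ∀ x, (Sub.her z).incl x ∈ Set.range (A.stabCorner 0) := fun x => by
    refine her_subset (Sub.range (A.stabCorner 0)).isClosed (fun s => ?_) ((Sub.her z).incl_mem x)
    have h3 : z * s ∈ cspan {x : A.stabilization | ∃ l a, x = A.stabUnit 0 l a} := by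
      refine mul_mem_of_mem_cspan (isClosed_cspan _) ?_ hz (cspan_stabUnit s)
      rintro _ ⟨j, a, b, rfl⟩ _ ⟨k, l, c, rfl⟩
      rw [stabUnit_mul_stabUnit]
      split_ifs
      · exact subset_cspan ⟨_, _, rfl⟩
      · exact zero_mem _
    refine mul_mem_of_mem_cspan (M := (Sub.range (A.stabCorner 0)).toSubalgebra.toSubmodule)
      (Sub.range (A.stabCorner 0)).isClosed ?_ h3 hz'
    rintro _ ⟨l, a, rfl⟩ _ ⟨k, a', b', rfl⟩
    rw [stabUnit_mul_stabUnit]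
    split_ifs
    · exact ⟨_, rfl⟩
    · exact zero_mem _
  obtain ⟨ψ, hψ⟩ := exists_lift (stabUnit_injective 0 0) _ h2
  refine ⟨_, ψ, fun x y hxy => (Sub.her z).incl_injective ?_, hher, fun x hx =>
    ⟨Sub.conj z (t * A.stabUnit 0 0 x * star t), ?_⟩⟩
  · rw [← hψ, ← hψ, hxy]
  · rw [← NonUnitalStarAlgHom.norm_map (A.stabCorner 0) (stabUnit_injective 0 0), map_sub, hψ,
      Sub.incl_conj]
    have h3 : z * (t * A.stabUnit 0 0 x * star t) * star z = A.stabCorner 0 (u * x * star u) := by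
      calc _ = (z * t) * A.stabUnit 0 0 x * star (z * t) := by simp only [star_mul, mul_assoc]
        _ = _ := by
          rw [← hzt, star_stabUnit, stabUnit_mul_same, stabUnit_mul_same]; rfl
    rw [h3, ← map_sub, NonUnitalStarAlgHom.norm_map (A.stabCorner 0) (stabUnit_injective 0 0)]
    exact huF x hx

end CStarAlg

end

noncomputable section

open Filter Topology

attribute [local instance] CStarAlgebra.spectralOrder CStarAlgebra.spectralOrderedRing

theorem IsSelfAdjoint.eq_zero_of_mul_mul {A : Type*} [NonUnitalCStarAlgebra A] {w : A}
    (hw : IsSelfAdjoint w) (h : w * w * w = 0) : w = 0 := by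
  have h1 : w * w = 0 := by
    rw [← CStarRing.star_mul_self_eq_zero_iff, star_mul, hw.star_eq, ← mul_assoc, h, zero_mul]
  rwa [← CStarRing.star_mul_self_eq_zero_iff, hw.star_eq]

theorem IsDimensionTheory.approxExtension_eq_of_full {C : Set CStarAlg.{u}}
    {d : CStarAlg.{u} → ℕ∞} (hd : IsDimensionTheory C d) (hC : ClosedUnderStableIso C)
    (hs : ∀ A ∈ C, A.IsSeparable → d A = d A.stabilization) {A B : CStarAlg.{u}}
    {i : B →⋆ₙₐ[ℂ] A} (hi : CStarAlg.HereditaryEmbedding i) (hf : CStarAlg.IsFullHom i) :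
    approxExtension C d A = approxExtension C d B := by
  refine le_antisymm (hd.approxExtension_le_of fun k hB => ?_)
    (hd.approxExtension_le_of fun k hA => ?_)
  · exact (CStarAlg.ApproxBy.of_full (P := fun D => D.IsSeparable ∧ HasDimLE C d k D)
      (fun _ => hd.separable_hasDimLE_stabilization hC hs)
      (fun _ _ i hD => hd.separable_hasDimLE_hereditary hC hs hD i) hi hf
      (hd.approxBy_separable hB)).mono fun _ h => h.2
  · exact ((hd.approxBy_separable hA).hereditary
      (fun _ _ i hD => hd.separable_hasDimLE_hereditary hC hs hD i) hi).mono fun _ h => h.2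

namespace CStarAlg

variable {A B : CStarAlg.{u}}

/-! ### Matrix algebras -/

/-- The algebra `M_n(B)`. -/
def matrixAlg (B : CStarAlg.{u}) (n : ℕ) : CStarAlg.{u} := ⟨CStarMatrix (Fin n) (Fin n) B⟩

/-- The matrix with entries `M`. -/
def toMatrixAlg {n : ℕ} (M : Fin n → Fin n → B) : B.matrixAlg n := CStarMatrix.ofMatrix M

/-- The entries of a matrix. -/
def entry {n : ℕ} (j k : Fin n) : B.matrixAlg n →ₗ[ℂ] B where
  toFun M := (show CStarMatrix (Fin n) (Fin n) B from M) j k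
  map_add' _ _ := rfl
  map_smul' _ _ := rfl

theorem entry_toMatrixAlg {n : ℕ} (M : Fin n → Fin n → B) (j k : Fin n) :
    entry j k (toMatrixAlg M) = M j k := rfl

theorem matrixAlg_ext {n : ℕ} {M N : B.matrixAlg n} (h : ∀ j k, entry j k M = entry j k N) :
    M = N := CStarMatrix.ext h

theorem entry_mul {n : ℕ} (M N : B.matrixAlg n) (j k : Fin n) :
    entry j k (M * N) = ∑ l, entry j l M * entry l k N :=
  CStarMatrix.mul_apply (M := (show CStarMatrix (Fin n) (Fin n) B from M))

theorem entry_star {n : ℕ} (M : B.matrixAlg n) (j k : Fin n) :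
    entry j k (star M) = star (entry k j M) := rfl

theorem continuous_entry {n : ℕ} (j k : Fin n) :
    Continuous (entry j k : B.matrixAlg n →ₗ[ℂ] B) := by
  have : Continuous fun M : Fin n → Fin n → B => M j k := by fun_prop
  exact this

theorem continuous_toMatrixAlg {n : ℕ} {Y : Type*} [TopologicalSpace Y] {f : Y → Fin n → Fin n → B}
    (hf : ∀ j k, Continuous fun y => f y j k) : Continuous fun y => toMatrixAlg (f y) := by
  have : Continuous f := continuous_pi fun j => continuous_pi fun k => hf j k
  exact this

/-- Test with `T = Q⁻`: the diagonal entries of `-(Q⁻)³` are then nonnegative. Writing `(Q⁻)³ = s*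
s`, these are minus sums of squares of the entries of `s`, so `s = 0` and `Q⁻ = 0`. -/
theorem matrixAlg_nonneg {n : ℕ} {Q : B.matrixAlg n} (hQ : IsSelfAdjoint Q)
    (h : ∀ T k, 0 ≤ entry k k (star T * Q * T)) : 0 ≤ Q := by
  have hN : IsSelfAdjoint Q⁻ := .of_nonneg (CFC.negPart_nonneg Q)
  have h1 : star Q⁻ * Q * Q⁻ = -(Q⁻ * Q⁻ * Q⁻) := by
    have h2 : Q⁻ * Q = Q⁻ * (Q⁺ - Q⁻) := by rw [CFC.posPart_sub_negPart Q hQ]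
    rw [hN.star_eq, h2, mul_sub, CFC.negPart_mul_posPart, zero_sub, neg_mul]
  have h2 : 0 ≤ Q⁻ * Q⁻ * Q⁻ := by
    simpa only [hN.star_eq] using star_left_conjugate_nonneg (CFC.negPart_nonneg Q) Q⁻
  obtain ⟨s, hs⟩ := CStarAlgebra.nonneg_iff_eq_star_mul_self.1 h2
  have h3 : s = 0 := by
    refine matrixAlg_ext fun i k => ?_
    have h4 := h Q⁻ k
    rw [h1, hs, map_neg, entry_mul, neg_nonneg] at h4
    have h5 : ∀ l ∈ Finset.univ, 0 ≤ entry k l (star s) * entry l k s := fun l _ => by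
      rw [entry_star]; exact star_mul_self_nonneg _
    have h6 := (Finset.sum_eq_zero_iff_of_nonneg h5).1
      (le_antisymm h4 (Finset.sum_nonneg h5)) i (Finset.mem_univ _)
    rw [entry_star, CStarRing.star_mul_self_eq_zero_iff] at h6
    rw [h6, map_zero]
  have h4 : Q⁻ = 0 := hN.eq_zero_of_mul_mul (by rw [hs, h3, mul_zero])
  rw [← CFC.posPart_sub_negPart Q hQ, h4, sub_zero]
  exact CFC.posPart_nonneg Q

/-- The corner embedding `M_n(B) → B ⊗ 𝕂`. -/
def stabMatrix (B : CStarAlg.{u}) (n : ℕ) : B.matrixAlg n →⋆ₙₐ[ℂ] B.stabilization where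
  toFun M := CStarCompletion.ofHom (MatrixLimit.mk n M)
  map_smul' c _ := (congrArg CStarCompletion.ofHom (MatrixLimit.mk_smul n c _).symm).trans
    (map_smul CStarCompletion.ofHom c _)
  map_zero' := (congrArg CStarCompletion.ofHom (MatrixLimit.mk_zero n)).trans (map_zero _)
  map_add' _ _ := (congrArg CStarCompletion.ofHom (MatrixLimit.mk_add n _ _).symm).trans
    (map_add _ _ _)
  map_mul' _ _ := (congrArg CStarCompletion.ofHom (MatrixLimit.mk_mul n _ _).symm).trans
    (map_mul _ _ _)
  map_star' _ := (congrArg CStarCompletion.ofHom (MatrixLimit.mk_star n _).symm).trans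
    (map_star _ _)

theorem stabMatrix_eq_sum {n : ℕ} (M : B.matrixAlg n) :
    B.stabMatrix n M = ∑ p : Fin n, ∑ q : Fin n, B.stabUnit p q (entry p q M) := by
  refine (congrArg CStarCompletion.ofHom (MatrixLimit.mk_eq_sum n _)).trans ?_
  rw [map_sum]
  refine Finset.sum_congr rfl fun p _ => ?_
  rw [map_sum]
  rfl

theorem stabUnit_mem_range_stabMatrix {n : ℕ} (p q : Fin n) (b : B) :
    B.stabUnit p q b ∈ Set.range (B.stabMatrix n) :=
  ⟨(MatrixLimit.single n p q b : CStarMatrix (Fin n) (Fin n) B),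
    congrArg CStarCompletion.ofHom (MatrixLimit.unit_eq p.2 q.2 b).symm⟩

theorem hereditaryEmbedding_stabMatrix (B : CStarAlg.{u}) (n : ℕ) :
    HereditaryEmbedding (B.stabMatrix n) := by
  refine ⟨fun M N h => MatrixLimit.mk_injective n ?_, fun M N s => ?_⟩
  · have h1 : ‖MatrixLimit.mk n M - MatrixLimit.mk n N‖ = 0 := by
      rw [← CStarCompletion.norm_ofHom, map_sub, norm_eq_zero, sub_eq_zero]
      exact h
    exact sub_eq_zero.1 (norm_eq_zero.1 h1)
  · have h : B.stabMatrix n M * s * B.stabMatrix n N ∈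
        (Sub.range (B.stabMatrix n)).toSubalgebra.toSubmodule := by
      refine map_mem_of_mem_cspan (Sub.range (B.stabMatrix n)).isClosed
        (LinearMap.mulRight ℂ (B.stabMatrix n N) ∘ₗ LinearMap.mulLeft ℂ (B.stabMatrix n M))
        ((continuous_const.mul continuous_id).mul continuous_const) ?_ (cspan_stabUnit s)
      rintro _ ⟨k, l, a, rfl⟩
      change B.stabMatrix n M * B.stabUnit k l a * B.stabMatrix n N ∈ _
      rw [stabMatrix_eq_sum, stabMatrix_eq_sum]
      simp only [Finset.sum_mul, Finset.mul_sum]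
      refine sum_mem fun p _ => sum_mem fun q _ => sum_mem fun p' _ => sum_mem fun q' _ => ?_
      rw [stabUnit_mul_stabUnit]
      split_ifs
      · rw [stabUnit_mul_stabUnit]
        split_ifs
        · exact stabUnit_mem_range_stabMatrix _ _ _
        · exact zero_mem _
      · rw [zero_mul]
        exact zero_mem _
    exact h

end CStarAlg

end

noncomputable section

open Filter Topology

attribute [local instance] CStarAlgebra.spectralOrder CStarAlgebra.spectralOrderedRing

namespace CStarAlg

/-! ### Imprimitivity bimodules -/

/-- The conjugate of a complex vector space. -/
def ConjModule (X : Type u) : Type u := X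

instance (X : Type u) [AddCommGroup X] : AddCommGroup (ConjModule X) :=
  inferInstanceAs (AddCommGroup X)

instance (X : Type u) [AddCommGroup X] [Module ℂ X] : Module ℂ (ConjModule X) :=
  Module.compHom X (starRingEnd ℂ)

namespace ImprimitivityBimodule

variable {A B : CStarAlg.{u}} {X : Type u} [AddCommGroup X] [Module ℂ X]
  (M : ImprimitivityBimodule A B X)

/-- `x ↦ ⟨x, y⟩_A`. -/
def left (y : X) : X →ₗ[ℂ] A where
  toFun x := M.linner x y
  map_add' x x' := M.linner_add x x' y
  map_smul' c x := M.linner_smul c x y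

/-- `y ↦ ⟨x, y⟩_B`. -/
def right (x : X) : X →ₗ[ℂ] B where
  toFun y := M.rinner x y
  map_add' y y' := M.rinner_add x y y'
  map_smul' c y := M.rinner_smul c x y

theorem left_apply (x y : X) : M.left y x = M.linner x y := rfl

theorem right_apply (x y : X) : M.right x y = M.rinner x y := rfl

theorem rinner_add_left (x x' y : X) :
    M.rinner (x + x') y = M.rinner x y + M.rinner x' y := by
  rw [← M.star_rinner, M.rinner_add, star_add, M.star_rinner, M.star_rinner]

theorem rinner_smul_left (c : ℂ) (x y : X) : M.rinner (c • x) y = star c • M.rinner x y := by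
  rw [← M.star_rinner, M.rinner_smul, star_smul, M.star_rinner]

theorem rinner_rsmul_left (x y : X) (b : B) :
    M.rinner (M.rsmul x b) y = star b * M.rinner x y := by
  rw [← M.star_rinner, M.rinner_rsmul, star_mul, M.star_rinner]

theorem rinner_sum_left {ι : Type*} (s : Finset ι) (f : ι → X) (y : X) :
    M.rinner (∑ i ∈ s, f i) y = ∑ i ∈ s, M.rinner (f i) y := by
  rw [← M.star_rinner, ← right_apply, map_sum, star_sum]
  exact Finset.sum_congr rfl fun i _ => M.star_rinner _ _

theorem linner_add_right (x y y' : X) :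
    M.linner x (y + y') = M.linner x y + M.linner x y' := by
  rw [← M.star_linner, M.linner_add, star_add, M.star_linner, M.star_linner]

theorem linner_smul_right (c : ℂ) (x y : X) : M.linner x (c • y) = star c • M.linner x y := by
  rw [← M.star_linner, M.linner_smul, star_smul, M.star_linner]

theorem linner_lsmul_right (x y : X) (a : A) :
    M.linner x (M.lsmul a y) = M.linner x y * star a := by
  rw [← M.star_linner, M.linner_lsmul, star_mul, M.star_linner]

theorem linner_mul_linner (x y x' y' : X) (b b' : B) :
    M.linner (M.rsmul x b) y * M.linner (M.rsmul x' b') y' =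
      M.linner (M.rsmul x (b * M.rinner y x' * b')) y' := by
  rw [← M.linner_lsmul, M.compat, M.rinner_rsmul, ← M.rsmul_mul, mul_assoc]

/-- For `x = y` this is a positive linear map, hence automatically continuous; the general case
follows by polarization with `x + y` and then with `i y`. -/
theorem continuous_rinner_lsmul (x y : X) : Continuous fun a => M.rinner x (M.lsmul a y) := by
  have hpos : ∀ x, Continuous (M.right x ∘ₗ M.lsmul.flip x) := fun x => by
    let f : A →ₚ[ℂ] B := PositiveLinearMap.mk₀ (M.right x ∘ₗ M.lsmul.flip x) fun a ha => by
      obtain ⟨c, rfl⟩ := CStarAlgebra.nonneg_iff_eq_star_mul_self.1 ha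
      have h : (M.right x ∘ₗ M.lsmul.flip x) (star c * c) =
          M.rinner (M.lsmul c x) (M.lsmul c x) := by
        change M.rinner x (M.lsmul (star c * c) x) = _
        rw [M.mul_lsmul, M.rinner_lsmul]
      rw [h]
      exact CStarAlgebra.nonneg_iff_eq_star_mul_self.2 (M.rinner_pos _)
    exact map_continuous f
  have h1 : ∀ y, Continuous fun a => M.rinner x (M.lsmul a y) + M.rinner y (M.lsmul a x) := by
    intro y
    convert ((hpos (x + y)).sub (hpos x)).sub (hpos y) using 2 with a
    change _ = M.rinner (x + y) (M.lsmul a (x + y)) - M.rinner x (M.lsmul a x) -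
      M.rinner y (M.lsmul a y)
    rw [map_add, rinner_add_left, M.rinner_add, M.rinner_add]
    abel
  convert ((h1 y).sub ((h1 (Complex.I • y)).const_smul Complex.I)).const_smul (1 / 2 : ℂ)
    using 2 with a
  change _ = (1 / 2 : ℂ) • (M.rinner x (M.lsmul a y) + M.rinner y (M.lsmul a x) -
    Complex.I • (M.rinner x (M.lsmul a (Complex.I • y)) + M.rinner (Complex.I • y) (M.lsmul a x)))
  rw [map_smul, M.rinner_smul, rinner_smul_left, smul_add, smul_smul, smul_smul]
  simp
  module

/-- The dual bimodule. -/
def dual : ImprimitivityBimodule B A (ConjModule X) :=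
  { lsmul := LinearMap.mk₂ ℂ (fun b (x : X) => M.rsmul x (star b))
      (fun b b' (x : X) => (congrArg (M.rsmul x) (star_add b b')).trans (map_add _ _ _))
      (fun c b (x : X) => (congrArg (M.rsmul x) (star_smul c b)).trans (map_smul _ _ _))
      (fun b (x x' : X) => LinearMap.map_add₂ M.rsmul x x' (star b))
      (fun c b (x : X) => LinearMap.map_smul₂ M.rsmul (star c) x (star b))
    rsmul := LinearMap.mk₂ ℂ (fun (x : X) a => M.lsmul (star a) x)
      (fun (x x' : X) a => map_add (M.lsmul (star a)) x x')
      (fun c (x : X) a => map_smul (M.lsmul (star a)) (star c) x)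
      (fun (x : X) a a' => (congrArg (M.lsmul.flip x) (star_add a a')).trans (map_add _ _ _))
      (fun c (x : X) a => (congrArg (M.lsmul.flip x) (star_smul c a)).trans (map_smul _ _ _))
    linner := M.rinner
    rinner := M.linner
    mul_lsmul := fun b b' (x : X) =>
      (congrArg (M.rsmul x) (star_mul b b')).trans (M.rsmul_mul x _ _)
    rsmul_mul := fun (x : X) a a' =>
      (congrArg (M.lsmul.flip x) (star_mul a a')).trans (M.mul_lsmul _ _ x)
    lsmul_rsmul := fun b (x : X) a => (M.lsmul_rsmul (star a) x (star b)).symm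
    linner_add := M.rinner_add_left
    linner_smul := fun c x y => by
      exact (M.rinner_smul_left (star c) x y).trans (by rw [star_star])
    linner_lsmul := fun b (x y : X) =>
      (M.rinner_rsmul_left x y (star b)).trans (congrArg (· * _) (star_star b))
    star_linner := M.star_rinner
    linner_pos := M.rinner_pos
    linner_definite := M.rinner_definite
    rinner_add := M.linner_add_right
    rinner_smul := fun c x y => (M.linner_smul_right (star c) x y).trans (by rw [star_star])
    rinner_rsmul := fun (x y : X) a =>
      (M.linner_lsmul_right x y (star a)).trans (congrArg (_ * ·) (star_star a))
    star_rinner := M.star_linner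
    rinner_pos := M.linner_pos
    rinner_definite := M.linner_definite
    rinner_lsmul := fun b (x y : X) => M.linner_rsmul x (star b) y
    linner_rsmul := fun (x : X) a (y : X) => M.rinner_lsmul (star a) x y
    compat := fun (x y z : X) => (congrArg (M.rsmul z) (M.star_rinner x y)).trans
      ((M.compat z y x).symm.trans (congrArg (M.lsmul.flip x) (M.star_linner y z).symm))
    linner_full := M.rinner_full
    rinner_full := M.linner_full
    linner_complete := M.rinner_complete
    rinner_complete := M.linner_complete }

theorem continuous_linner_rsmul (x y : X) : Continuous fun b => M.linner (M.rsmul x b) y := by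
  have h : Continuous fun b => M.linner y (M.rsmul x (star (star b))) :=
    (M.dual.continuous_rinner_lsmul y x).comp continuous_star
  simpa only [M.star_linner, star_star] using h.star

end ImprimitivityBimodule

theorem MoritaEquivalent.symm {A B : CStarAlg.{u}} (h : A.MoritaEquivalent B) :
    B.MoritaEquivalent A := by
  obtain ⟨X, _, _, ⟨M⟩⟩ := h
  exact ⟨ConjModule X, _, _, ⟨M.dual⟩⟩

namespace ImprimitivityBimodule

variable {A B : CStarAlg.{u}} {X : Type u} [AddCommGroup X] [Module ℂ X]
  (M : ImprimitivityBimodule A B X) {n : ℕ} (x : Fin n → X)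

/-- The matrix `⟨x_j, a x_k⟩_B`. -/
def compress (a : A) : B.matrixAlg n :=
  toMatrixAlg fun j k => M.rinner (x j) (M.lsmul a (x k))

/-- The Gram matrix `⟨x_j, x_k⟩_B`. -/
def gram : B.matrixAlg n := toMatrixAlg fun j k => M.rinner (x j) (x k)

/-- The map `T ↦ ∑ ⟨x_j T_{jk}, x_k⟩_A`. -/
def expand : B.matrixAlg n →ₗ[ℂ] A :=
  ∑ j, ∑ k, M.left (x k) ∘ₗ M.rsmul (x j) ∘ₗ entry j k

theorem expand_apply (T : B.matrixAlg n) :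
    M.expand x T = ∑ j, ∑ k, M.linner (M.rsmul (x j) (entry j k T)) (x k) := by
  simp [expand, left_apply]

theorem continuous_expand : Continuous (M.expand x) := by
  have : ⇑(M.expand x) = fun T => ∑ j, ∑ k, M.linner (M.rsmul (x j) (entry j k T)) (x k) :=
    funext (M.expand_apply x)
  rw [this]
  exact continuous_finsetSum _ fun j _ => continuous_finsetSum _ fun k _ =>
    (M.continuous_linner_rsmul _ _).comp (continuous_entry j k)

theorem continuous_compress : Continuous (M.compress x) :=
  continuous_toMatrixAlg fun _ _ => M.continuous_rinner_lsmul _ _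

theorem star_expand (T : B.matrixAlg n) : star (M.expand x T) = M.expand x (star T) := by
  rw [expand_apply, expand_apply, Finset.sum_comm]
  simp only [star_sum]
  refine Finset.sum_congr rfl fun j _ => Finset.sum_congr rfl fun k _ => ?_
  rw [M.star_linner, M.linner_rsmul, entry_star, star_star]

theorem linner_rsmul_sum {ι : Type*} (s : Finset ι) (f : ι → B) (x y : X) :
    M.linner (M.rsmul x (∑ i ∈ s, f i)) y = ∑ i ∈ s, M.linner (M.rsmul x (f i)) y :=
  map_sum (M.left y ∘ₗ M.rsmul x) f s

/-- `expand` is multiplicative for the twisted product `S G T`, with `G` the Gram matrix. If `r² =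
G`, the map `T ↦ r T r` is multiplicative for the same product, which is why the two can be paired.
-/
theorem expand_mul (S T : B.matrixAlg n) :
    M.expand x S * M.expand x T = M.expand x (S * M.gram x * T) := by
  simp only [expand_apply, entry_mul, Finset.sum_mul, linner_rsmul_sum]
  refine Finset.sum_congr rfl fun j _ => ?_
  simp only [Finset.mul_sum, M.linner_mul_linner]
  rw [Finset.sum_comm]
  refine (Finset.sum_congr rfl fun l _ => Finset.sum_comm).trans ?_
  rw [Finset.sum_comm]
  rfl

theorem compress_expand (T : B.matrixAlg n) :
    M.compress x (M.expand x T) = M.gram x * T * M.gram x := by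
  refine matrixAlg_ext fun j k => ?_
  simp only [entry_mul, Finset.sum_mul]
  change M.rinner (x j) (M.lsmul.flip (x k) (M.expand x T)) = _
  rw [expand_apply, map_sum, ← right_apply, map_sum, Finset.sum_comm]
  simp only [map_sum]
  refine Finset.sum_congr rfl fun l _ => Finset.sum_congr rfl fun m _ => ?_
  rw [right_apply, LinearMap.flip_apply, M.compat, M.rinner_rsmul, M.rinner_rsmul]
  rfl

theorem isSelfAdjoint_gram : IsSelfAdjoint (M.gram x) :=
  matrixAlg_ext fun j k => by
    rw [entry_star]
    exact M.star_rinner _ _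

/-- The diagonal entries of `T* G T` are `⟨ξ, ξ⟩_B` with `ξ = ∑ x_j T_{jk}`, so the positivity test
for matrices applies. -/
theorem gram_nonneg : 0 ≤ M.gram x := by
  refine matrixAlg_nonneg (M.isSelfAdjoint_gram x) fun T k => ?_
  have h : entry k k (star T * M.gram x * T) = M.rinner (∑ j, M.rsmul (x j) (entry j k T))
      (∑ j, M.rsmul (x j) (entry j k T)) := by
    rw [← right_apply, map_sum]
    simp only [right_apply, rinner_sum_left, M.rinner_rsmul, rinner_rsmul_left, entry_mul,
      entry_star]
    rfl
  rw [h]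
  exact CStarAlgebra.nonneg_iff_eq_star_mul_self.2 (M.rinner_pos _)

end ImprimitivityBimodule

end CStarAlg

end

noncomputable section

open Filter Topology

attribute [local instance] CStarAlgebra.spectralOrder CStarAlgebra.spectralOrderedRing

namespace CStarAlg

/-! ### Subalgebras of `A` isomorphic to hereditary subalgebras of `M_n(B)` -/

namespace ImprimitivityBimodule

variable {A B : CStarAlg.{u}} {X : Type u} [AddCommGroup X] [Module ℂ X]
  (M : ImprimitivityBimodule A B X) {n : ℕ} (x : Fin n → X)

/-- The map `T ↦ (∑ ⟨x_j T_{jk}, x_k⟩_A, r T r)`, where `r` is a square root of the Gram matrix. -/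
def expandPair (r : B.matrixAlg n) : B.matrixAlg n →ₗ[ℂ] A.directSum (B.matrixAlg n) :=
  (M.expand x).prod (LinearMap.mulRight ℂ r ∘ₗ LinearMap.mulLeft ℂ r)

theorem expandPair_apply (r T : B.matrixAlg n) :
    M.expandPair x r T = (M.expand x T, r * T * r) := rfl

/-- The closure of the image of `expandPair`. -/
def expandAlg {r : B.matrixAlg n} (hr : IsSelfAdjoint r) (hrr : r * r = M.gram x) :
    (A.directSum (B.matrixAlg n)).Sub where
  toSubalgebra :=
    { (LinearMap.range (M.expandPair x r)).topologicalClosure with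
      mul_mem' := fun {y z} hy hz => by
        refine map_mem_closure₂ continuous_mul hy hz ?_
        rintro _ ⟨S, rfl⟩ _ ⟨T, rfl⟩
        refine ⟨S * M.gram x * T, ?_⟩
        rw [expandPair_apply, expandPair_apply, expandPair_apply, ← expand_mul, ← hrr]
        have h : r * (S * (r * r) * T) * r = r * S * r * (r * T * r) := by simp only [mul_assoc]
        exact Prod.ext rfl h
      star_mem' := fun {y} hy => by
        refine map_mem_closure continuous_star hy ?_
        rintro _ ⟨T, rfl⟩
        refine ⟨star T, ?_⟩
        rw [expandPair_apply, expandPair_apply, ← star_expand]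
        have h : r * star T * r = star (r * T * r) := by
          simp only [star_mul, hr.star_eq, mul_assoc]
        exact Prod.ext rfl h }
  isClosed := isClosed_closure

variable {x} {r : B.matrixAlg n} (hr : IsSelfAdjoint r) (hrr : r * r = M.gram x)

theorem expandAlg_induction {p : A.directSum (B.matrixAlg n) → Prop} (hp : IsClosed {y | p y})
    (h : ∀ T, p (M.expand x T, r * T * r)) {y : A.directSum (B.matrixAlg n)}
    (hy : y ∈ (M.expandAlg x hr hrr).toSet) : p y := by
  refine closure_minimal (t := {y | p y}) ?_ hp hy
  rintro _ ⟨T, rfl⟩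
  exact h T

/-- The closure of the pairs is the graph of an isomorphism: neither coordinate can vanish alone.
This replaces a direct comparison of the norms of `expand x T` and `r T r`. -/
theorem expandAlg_eq_zero {y : A.directSum (B.matrixAlg n)}
    (hy : y ∈ (M.expandAlg x hr hrr).toSet) (h : y.1 = 0 ∨ y.2 = 0) : y = 0 := by
  have hfst : Continuous fun y : A.directSum (B.matrixAlg n) => y.1 := continuous_fst
  have hsnd : Continuous fun y : A.directSum (B.matrixAlg n) => y.2 := continuous_snd
  have key : ∀ w ∈ (M.expandAlg x hr hrr).toSet, IsSelfAdjoint w → (w.1 = 0 ∨ w.2 = 0) →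
      w = 0 := by
    intro w hw hws h
    refine hws.eq_zero_of_mul_mul ?_
    rcases h with h | h
    · have h1 : ∀ T, r * T * r * w.2 * (r * T * r) = 0 := by
        intro T
        have h2 : r * T * r * w.2 * (r * T * r) = r * (T * M.compress x w.1 * T) * r := by
          refine M.expandAlg_induction hr hrr
            (p := fun w => r * T * r * w.2 * (r * T * r) = r * (T * M.compress x w.1 * T) * r)
            (isClosed_eq (by fun_prop) ?_) (fun S => ?_) hw
          · have := (M.continuous_compress x).comp hfst
            simp only [Function.comp_def] at this
            fun_prop
          · rw [compress_expand, ← hrr]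
            simp only [mul_assoc]
        have h3 : M.compress x 0 = 0 := matrixAlg_ext fun j k => by
          change M.rinner (x j) (M.lsmul 0 (x k)) = 0
          rw [map_zero, LinearMap.zero_apply, ← right_apply, map_zero]
        rw [h2, h, h3, mul_zero, zero_mul, mul_zero, zero_mul]
      have h2 : w.2 * w.2 * w.2 = 0 := M.expandAlg_induction hr hrr
        (p := fun z => z.2 * w.2 * z.2 = 0) (isClosed_eq (by fun_prop) continuous_const) h1 hw
      have h3 : w.1 * w.1 * w.1 = 0 := by rw [h, mul_zero]
      exact Prod.ext h3 h2
    · have h1 : ∀ T, M.expand x T * w.1 * M.expand x T = 0 := by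
        intro T
        have h2 : M.expand x T * w.1 * M.expand x T = M.expand x (T * (r * w.2 * r) * T) := by
          refine M.expandAlg_induction hr hrr
            (p := fun w => M.expand x T * w.1 * M.expand x T = M.expand x (T * (r * w.2 * r) * T))
            (isClosed_eq (by fun_prop) ((M.continuous_expand x).comp (by fun_prop)))
            (fun S => ?_) hw
          rw [expand_mul, expand_mul, ← hrr]
          simp only [mul_assoc]
        rw [h2, h, mul_zero, zero_mul, mul_zero, zero_mul, map_zero]
      have h2 : w.1 * w.1 * w.1 = 0 := M.expandAlg_induction hr hrr
        (p := fun z => z.1 * w.1 * z.1 = 0) (isClosed_eq (by fun_prop) continuous_const) h1 hw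
      have h3 : w.2 * w.2 * w.2 = 0 := by rw [h, mul_zero]
      exact Prod.ext h2 h3
  rw [← CStarRing.star_mul_self_eq_zero_iff]
  have hyy : star y * y ∈ (M.expandAlg x hr hrr).toSet :=
    (M.expandAlg x hr hrr).toSubalgebra.mul_mem
      ((M.expandAlg x hr hrr).toSubalgebra.star_mem' hy) hy
  refine key _ hyy (.star_mul_self y) (h.imp (fun h => ?_) fun h => ?_)
  · change star y.1 * y.1 = 0
    rw [h, mul_zero]
  · change star y.2 * y.2 = 0
    rw [h, mul_zero]

/-- The two coordinate projections on `expandAlg`. -/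
theorem exists_expandAlg_hom :
    ∃ (f : (M.expandAlg x hr hrr).toCStarAlg →⋆ₙₐ[ℂ] A)
      (g : (M.expandAlg x hr hrr).toCStarAlg →⋆ₙₐ[ℂ] B.matrixAlg n),
      Function.Injective f ∧ HereditaryEmbedding g ∧ ∀ T, ∃ y, f y = M.expand x T := by
  let π₁ : A.directSum (B.matrixAlg n) →⋆ₙₐ[ℂ] A := NonUnitalStarAlgHom.fst ℂ A (B.matrixAlg n)
  let π₂ : A.directSum (B.matrixAlg n) →⋆ₙₐ[ℂ] B.matrixAlg n :=
    NonUnitalStarAlgHom.snd ℂ A (B.matrixAlg n)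
  let S := M.expandAlg x hr hrr
  have hmem : ∀ T, (M.expand x T, r * T * r) ∈ S.toSet := fun T => subset_closure ⟨T, rfl⟩
  refine ⟨π₁.comp S.incl, π₂.comp S.incl, ?_, ⟨?_, fun b c s => ?_⟩, fun T => ⟨⟨_, hmem T⟩, rfl⟩⟩
  · refine (injective_iff_map_eq_zero _).2 fun y hy => S.incl_injective ?_
    rw [map_zero]
    exact M.expandAlg_eq_zero hr hrr (S.incl_mem y) (Or.inl hy)
  · refine (injective_iff_map_eq_zero _).2 fun y hy => S.incl_injective ?_
    rw [map_zero]
    exact M.expandAlg_eq_zero hr hrr (S.incl_mem y) (Or.inr hy)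
  · have h1 : ∀ b ∈ S.toSet, ∀ c ∈ S.toSet, b.2 * s * c.2 ∈ (Sub.range (π₂.comp S.incl)).toSet := by
      have hsnd : Continuous fun y : A.directSum (B.matrixAlg n) => y.2 := continuous_snd
      intro b hb c hc
      refine M.expandAlg_induction hr hrr
        (p := fun b => b.2 * s * c.2 ∈ (Sub.range (π₂.comp S.incl)).toSet)
        ((Sub.range (π₂.comp S.incl)).isClosed.preimage (by fun_prop)) (fun T => ?_) hb
      refine M.expandAlg_induction hr hrr
        (p := fun c => r * T * r * s * c.2 ∈ (Sub.range (π₂.comp S.incl)).toSet)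
        ((Sub.range (π₂.comp S.incl)).isClosed.preimage (by fun_prop)) (fun U => ?_) hc
      refine ⟨⟨_, hmem (T * r * s * r * U)⟩, ?_⟩
      change r * (T * r * s * r * U) * r = r * T * r * s * (r * U * r)
      simp only [mul_assoc]
    exact h1 _ (S.incl_mem b) _ (S.incl_mem c)

end ImprimitivityBimodule

/-- Take an almost unit `u = ∑ ⟨x_j, y_j⟩_A`. Then `u a u* = ∑ ⟨x_j ⟨y_j, a y_k⟩_B, x_k⟩_A` is
`expand` of the matrix `⟨y_j, a y_k⟩_B`. The algebra containing it embeds hereditarily into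
`M_n(B)`, which is hereditary in `B ⊗ 𝕂`. -/
theorem ApproxBy.of_moritaEquivalent {A B : CStarAlg.{u}} {P : CStarAlg.{u} → Prop}
    (hPs : ∀ D, P D → P D.stabilization)
    (hP : ∀ (D H : CStarAlg.{u}) (i : H →⋆ₙₐ[ℂ] D), P D → HereditaryEmbedding i → P H)
    (h : A.MoritaEquivalent B) (hB : ApproxBy P B) : ApproxBy P A := by
  obtain ⟨X, _, _, ⟨M⟩⟩ := h
  refine ApproxBy.trans fun F ε hε => ?_
  obtain ⟨u, hu, huF⟩ := exists_mem_span_conj_approx M.linner_full F hε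
  obtain ⟨n, c, g, rfl⟩ := Submodule.mem_span_set'.1 hu
  choose x y hg using fun j => (g j).2
  have hr := CFC.sqrt_mul_sqrt_self _ (M.gram_nonneg fun j => c j • x j)
  have hrs : IsSelfAdjoint (CFC.sqrt (M.gram fun j => c j • x j)) :=
    .of_nonneg (CFC.sqrt_nonneg _)
  obtain ⟨f, φ, hf, hφ, hfT⟩ := M.exists_expandAlg_hom hrs hr
  refine ⟨_, f, hf, ((hB.stabilization hPs).hereditary hP
    (hereditaryEmbedding_stabMatrix B n)).hereditary hP hφ, fun a ha => ?_⟩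
  obtain ⟨s, hs⟩ := hfT (toMatrixAlg fun j k => M.rinner (y j) (M.lsmul a (y k)))
  refine ⟨s, ?_⟩
  have h1 : f s = (∑ j, c j • (g j : A)) * a * star (∑ j, c j • (g j : A)) := by
    have h2 : ∀ j, c j • (g j : A) = M.linner (c j • x j) (y j) := fun j => by
      rw [hg, M.linner_smul]
    rw [hs, M.expand_apply]
    simp only [h2, star_sum, Finset.sum_mul, Finset.mul_sum, M.star_linner]
    have h3 : ∀ j k, M.linner (M.rsmul (c j • x j) (M.rinner (y j) (M.lsmul a (y k)))) (c k • x k) =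
        M.linner (c j • x j) (y j) * a * M.linner (y k) (c k • x k) := fun j k => by
      rw [mul_assoc, ← M.linner_lsmul, ← M.linner_lsmul, M.compat]
    simp only [entry_toMatrixAlg, h3]
    exact Finset.sum_comm
  rw [h1]
  exact huF a ha

end CStarAlg

theorem IsDimensionTheory.approxExtension_eq_of_moritaEquivalent {C : Set CStarAlg.{u}}
    {d : CStarAlg.{u} → ℕ∞} (hd : IsDimensionTheory C d) (hC : ClosedUnderStableIso C)
    (hs : ∀ A ∈ C, A.IsSeparable → d A = d A.stabilization) {A B : CStarAlg.{u}}
    (h : A.MoritaEquivalent B) : approxExtension C d A = approxExtension C d B := by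
  have key : ∀ {A B : CStarAlg.{u}}, A.MoritaEquivalent B →
      approxExtension C d A ≤ approxExtension C d B := fun h =>
    hd.approxExtension_le_of fun k hB =>
      (CStarAlg.ApproxBy.of_moritaEquivalent (P := fun D => D.IsSeparable ∧ HasDimLE C d k D)
        (fun _ => hd.separable_hasDimLE_stabilization hC hs)
        (fun _ _ i hD => hd.separable_hasDimLE_hereditary hC hs hD i) h
        (hd.approxBy_separable hB)).mono fun _ h => h.2
  -- The reverse inequality comes from the dual bimodule.
  exact le_antisymm (key h) (key h.symm)

end

theorem mainTheorem7 (C : Set CStarAlg.{u}) (d : CStarAlg.{u} → ℕ∞)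
    (hd : IsDimensionTheory C d) :
    IsDimensionTheory Set.univ (approxExtension C d) ∧
      (∀ A ∈ C, approxExtension C d A = d A) ∧
      (ClosedUnderStableIso C →
        (∀ A ∈ C, A.IsSeparable → d A = d A.stabilization) →
          MoritaInvariant (approxExtension C d)) :=
  ⟨hd.isDimensionTheory_approxExtension, fun _ hA => hd.approxExtension_eq hA, fun hC hs =>
    ⟨fun _ _ hB hf => hd.approxExtension_eq_of_full hC hs hB.hereditaryEmbedding hf.isFullHom,
      fun _ _ h => hd.approxExtension_eq_of_moritaEquivalent hC hs h,
      fun A => (hd.approxExtension_eq_of_full hC hs (CStarAlg.hereditaryEmbedding_stabCorner A 0)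
        (CStarAlg.isFullHom_stabCorner A 0)).symm⟩⟩
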